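/- Let $X\xrightarrow{\phi}Y\rightrightarrows M$ be a Lie groupoid extension, i.e. a morphism of (finite-dimensional, smooth) Lie groupoids over the identity of $M$ which is a surjective submersion; products $xy$ are defined when $\mathbf t(x)=\mathbf s(y)$. Let $\mathcal K=\ker\phi\to M$ be its kernel, a bundle of Lie groups, let $\mathfrak K\to M$ be the corresponding bundle of Lie algebras, let $Z(\mathfrak K)_m$ be the center of the Lie algebra $\mathfrak K_m$, and let $\mathrm{Ad}_x:\mathfrak K_{\mathbf t(x)}\to\mathfrak K_{\mathbf s(x)}$ be the derivative at the unit of $g\mapsto xgx^{-1}$. For $\xi\in\mathfrak K_{\mathbf t(x)}$ put $\xi^{\triangleright}_x=\frac{d}{d\tau}\big|_{0}\,x\exp(\tau\xi)$. Let $\alpha\in\Omega^1(X,\mathbf t^*\mathfrak K)$ be a connection (right connection 1-form): $\alpha(\xi^{\triangleright})=\xi$ for all $\xi\in\mathfrak K$, and $\partial^{\triangleright}\alpha=0$, i.e. $\alpha(u\cdot v)=\alpha(v)+\mathrm{Ad}_{y^{-1}}\alpha(u)$ for all composable $u\in T_xX$, $v\in T_yX$ in the tangent groupoid $TX\rightrightarrows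 TM$. Let $\omega\in\Omega^2(X,\mathbf t^*\mathfrak K)$, $\omega(U,V)=-\alpha([\mathrm{Hor}\,U,\mathrm{Hor}\,V])$ with $\mathrm{Hor}\,U=U-\alpha(U)^{\triangleright}$, be its Ehresmann curvature. Let $\nabla$ be the covariant derivative induced by $\alpha$ on $\mathfrak K\to M$ (the linearization along the units of the connection which $\alpha$ induces on $\mathcal K\to M$), and $d^\nabla$ its exterior covariant derivative. For $\eta\in\Omega^k(M,\mathfrak K)$ put $(\partial^{\triangleright}\eta)_x=(\mathbf t^*\eta)_x-\mathrm{Ad}_{x^{-1}}(\mathbf s^*\eta)_x$, a $\mathbf t^*\mathfrak K$-valued $k$-form on $X$. Let $B\in\Omega^2(M,\mathfrak K)$ be a curving, i.e. $\partial^{\triangleright}B=\omega$. Then the 3-curvature $\Omega=d^\nabla B\in\Omega^3(M,\mathfrak K)$ takes values in the center bundle: $\Omega\in\Omega^3(M,Z(\mathfrak K))$. Moreover, $$d^\nabla\Omega=0\qquad\text{and}\qquad\partial^{\triangleright}\Omega=0 .$$ -/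

import Mathlib

open scoped Manifold ContDiff Topology
open Set VectorField

noncomputable section

/-- A Lie groupoid `G ⇉ M`.  The product `mul x y` is only meaningful on composable pairs, that is
for `tgt x = src y` (so that `src (mul x y) = src x` and `tgt (mul x y) = tgt y`); outside of this
set `mul` is an arbitrary total extension, about which nothing is assumed.  Since the source and the
target are submersions, the composable pairs form an embedded submanifold of `G × G`, and the
product is smooth on it. -/
structure LieGroupoid (E₀ E M G : Type*)
    [NormedAddCommGroup E₀] [NormedSpace ℝ E₀] [NormedAddCommGroup E] [NormedSpace ℝ E]
    [TopologicalSpace M] [ChartedSpace E₀ M] [TopologicalSpace G] [ChartedSpace E G] where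
  src : G → M
  tgt : G → M
  one : M → G
  inv : G → G
  mul : G → G → G
  src_one : ∀ m, src (one m) = m
  tgt_one : ∀ m, tgt (one m) = m
  src_inv : ∀ x, src (inv x) = tgt x
  tgt_inv : ∀ x, tgt (inv x) = src x
  src_mul : ∀ x y, tgt x = src y → src (mul x y) = src x
  tgt_mul : ∀ x y, tgt x = src y → tgt (mul x y) = tgt y
  mul_assoc : ∀ x y z, tgt x = src y → tgt y = src z → mul (mul x y) z = mul x (mul y z)
  one_mul : ∀ x, mul (one (src x)) x = x
  mul_one : ∀ x, mul x (one (tgt x)) = x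
  mul_inv : ∀ x, mul x (inv x) = one (src x)
  inv_mul : ∀ x, mul (inv x) x = one (tgt x)
  isSubmersion_src : Manifold.IsSubmersion 𝓘(ℝ, E) 𝓘(ℝ, E₀) ∞ src
  isSubmersion_tgt : Manifold.IsSubmersion 𝓘(ℝ, E) 𝓘(ℝ, E₀) ∞ tgt
  contMDiff_one : ContMDiff 𝓘(ℝ, E₀) 𝓘(ℝ, E) ∞ one
  contMDiff_inv : ContMDiff 𝓘(ℝ, E) 𝓘(ℝ, E) ∞ inv
  contMDiffOn_mul : ContMDiffOn (𝓘(ℝ, E).prod 𝓘(ℝ, E)) 𝓘(ℝ, E) ∞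
    (fun p : G × G => mul p.1 p.2) {p | tgt p.1 = src p.2}

/-- A Lie groupoid extension `X → Y ⇉ M`: a morphism of Lie groupoids over the identity of `M`
which is a surjective submersion. -/
structure LieGroupoidExtension (E₀ E₁ E₂ M X Y : Type*)
    [NormedAddCommGroup E₀] [NormedSpace ℝ E₀] [NormedAddCommGroup E₁] [NormedSpace ℝ E₁]
    [NormedAddCommGroup E₂] [NormedSpace ℝ E₂]
    [TopologicalSpace M] [ChartedSpace E₀ M] [TopologicalSpace X] [ChartedSpace E₁ X]
    [TopologicalSpace Y] [ChartedSpace E₂ Y] where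
  total : LieGroupoid E₀ E₁ M X
  quot : LieGroupoid E₀ E₂ M Y
  φ : X → Y
  src_φ : ∀ x, quot.src (φ x) = total.src x
  tgt_φ : ∀ x, quot.tgt (φ x) = total.tgt x
  φ_mul : ∀ x y, total.tgt x = total.src y → φ (total.mul x y) = quot.mul (φ x) (φ y)
  surjective_φ : Function.Surjective φ
  isSubmersion_φ : Manifold.IsSubmersion 𝓘(ℝ, E₁) 𝓘(ℝ, E₂) ∞ φ

namespace LieGroupoidExtension

variable {E₀ E₁ E₂ M X Y : Type*}
  [NormedAddCommGroup E₀] [NormedSpace ℝ E₀] [NormedAddCommGroup E₁] [NormedSpace ℝ E₁]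
  [NormedAddCommGroup E₂] [NormedSpace ℝ E₂]
  [TopologicalSpace M] [ChartedSpace E₀ M] [TopologicalSpace X] [ChartedSpace E₁ X]
  [TopologicalSpace Y] [ChartedSpace E₂ Y]
  (𝓔 : LieGroupoidExtension E₀ E₁ E₂ M X Y)

/-- The source map of `X`. -/
abbrev s : X → M := 𝓔.total.src

/-- The target map of `X`. -/
abbrev t : X → M := 𝓔.total.tgt

/-- The unit of `X` over a point of `M`. -/
abbrev e : M → X := 𝓔.total.one

/-- The fiber over `m` of the kernel of the extension, which is a Lie group with unit `e m`. -/
def ker (m : M) : Set X := {x | 𝓔.φ x = 𝓔.quot.one m}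

/-- The fiber over `m` of the bundle of Lie algebras of the kernel: the tangent space at the unit of
the fiber `ker m` of the submersion `φ`, as a subspace of the tangent space of `X`.  The bundle of
Lie algebras is in this way a smooth subbundle of the pullback of `TX` by the unit map. -/
def lieAlg (m : M) : Submodule ℝ (TangentSpace 𝓘(ℝ, E₁) (𝓔.e m)) :=
  LinearMap.ker (mfderiv 𝓘(ℝ, E₁) 𝓘(ℝ, E₂) 𝓔.φ (𝓔.e m)).toLinearMap

/-- The adjoint representation: the derivative at the unit of the conjugation
`ker (t x) → ker (s x)`, `g ↦ x g x⁻¹`.  Only its values on `lieAlg (t x)` are meaningful: the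
conjugation is differentiated along the submanifold `ker (t x)`, whose tangent space at the unit is
`lieAlg (t x)`.  The base point `x · e (t x) · x⁻¹` of the result is `e (s x)`. -/
def Ad (x : X) :
    TangentSpace 𝓘(ℝ, E₁) (𝓔.e (𝓔.t x)) →L[ℝ] TangentSpace 𝓘(ℝ, E₁) (𝓔.e (𝓔.s x)) :=
  mfderivWithin 𝓘(ℝ, E₁) 𝓘(ℝ, E₁)
    (fun g => 𝓔.total.mul (𝓔.total.mul x g) (𝓔.total.inv x)) (𝓔.ker (𝓔.t x)) (𝓔.e (𝓔.t x))

/-- The adjoint action of `x⁻¹`, from the fiber over `s x` to the fiber over `t x`. -/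
def AdInv (x : X) :
    TangentSpace 𝓘(ℝ, E₁) (𝓔.e (𝓔.s x)) →L[ℝ] TangentSpace 𝓘(ℝ, E₁) (𝓔.e (𝓔.t x)) :=
  𝓔.Ad (𝓔.total.inv x)

/-- The Lie bracket of the Lie algebra `lieAlg m` of the Lie group `ker m`, as the derivative of the
adjoint representation at the unit: `[ξ, η]` is the derivative of `k ↦ Ad k η`, `k ∈ ker m`, at the
unit in the direction of `ξ`. -/
def bracket (m : M) (ξ η : TangentSpace 𝓘(ℝ, E₁) (𝓔.e m)) : TangentSpace 𝓘(ℝ, E₁) (𝓔.e m) :=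
  mfderivWithin 𝓘(ℝ, E₁) 𝓘(ℝ, E₁) (fun k => (𝓔.Ad k η : E₁)) (𝓔.ker m) (𝓔.e m) ξ

/-- The fiber over `m` of the center bundle: the center of the Lie algebra `lieAlg m`. -/
def center (m : M) : Set (TangentSpace 𝓘(ℝ, E₁) (𝓔.e m)) :=
  {ξ | ξ ∈ 𝓔.lieAlg m ∧ ∀ η ∈ 𝓔.lieAlg m, 𝓔.bracket m ξ η = 0}

/-- The right fundamental vector `ξ^▷` at `x` of an element `ξ` of `lieAlg (t x)`: the image of `ξ`
under the derivative at the unit of `ker (t x) → X`, `g ↦ x g`.  The base point `x · e (t x)` of the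
result is `x`. -/
def fund (x : X) : TangentSpace 𝓘(ℝ, E₁) (𝓔.e (𝓔.t x)) →L[ℝ] TangentSpace 𝓘(ℝ, E₁) x :=
  mfderivWithin 𝓘(ℝ, E₁) 𝓘(ℝ, E₁) (fun g => 𝓔.total.mul x g) (𝓔.ker (𝓔.t x)) (𝓔.e (𝓔.t x))

/-- The product `u · v` in the tangent groupoid `TX ⇉ TM` of two tangent vectors at composable
points, meaningful if `u` and `v` are composable, that is `t_* u = s_* v`: the value on `(u, v)` of
the derivative of the product along the submanifold of composable pairs, whose tangent space
consists of the pairs of composable tangent vectors. -/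
def tmul (x y : X) (u : TangentSpace 𝓘(ℝ, E₁) x) (v : TangentSpace 𝓘(ℝ, E₁) y) :
    TangentSpace 𝓘(ℝ, E₁) (𝓔.total.mul x y) :=
  mfderivWithin (𝓘(ℝ, E₁).prod 𝓘(ℝ, E₁)) 𝓘(ℝ, E₁) (fun p : X × X => 𝓔.total.mul p.1 p.2)
    {p | 𝓔.t p.1 = 𝓔.s p.2} (x, y) ((u, v) : E₁ × E₁)

/-- Smoothness at a point of a vector field on a manifold. -/
def SmoothFieldAt {F N : Type*} [NormedAddCommGroup F] [NormedSpace ℝ F] [TopologicalSpace N]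
    [ChartedSpace F N] [IsManifold 𝓘(ℝ, F) ∞ N]
    (V : ∀ n : N, TangentSpace 𝓘(ℝ, F) n) (n₀ : N) : Prop :=
  ContMDiffAt 𝓘(ℝ, F) 𝓘(ℝ, F).tangent ∞ (fun n => (⟨n, V n⟩ : TangentBundle 𝓘(ℝ, F) N)) n₀

/-- Smooth differential `k`-forms on a manifold `N` with values in the pullback of the bundle of Lie
algebras along `f : N → M`.  Smoothness means that the evaluation on smooth vector fields is a
smooth section. -/
structure Form (F : Type*) {N : Type*} [NormedAddCommGroup F] [NormedSpace ℝ F] [TopologicalSpace N]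
    [ChartedSpace F N] [IsManifold 𝓘(ℝ, F) ∞ N] [IsManifold 𝓘(ℝ, E₁) ∞ X]
    (f : N → M) (k : ℕ) where
  val : ∀ n : N, TangentSpace 𝓘(ℝ, F) n [⋀^Fin k]→L[ℝ] TangentSpace 𝓘(ℝ, E₁) (𝓔.e (f n))
  mem : ∀ n v, val n v ∈ 𝓔.lieAlg (f n)
  smooth : ∀ (n₀ : N) (V : Fin k → ∀ n : N, TangentSpace 𝓘(ℝ, F) n),
    (∀ i, SmoothFieldAt (V i) n₀) →
    ContMDiffAt 𝓘(ℝ, F) 𝓘(ℝ, E₁).tangent ∞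
      (fun n => (⟨𝓔.e (f n), val n (fun i => V i n)⟩ : TangentBundle 𝓘(ℝ, E₁) X)) n₀

variable [IsManifold 𝓘(ℝ, E₀) ∞ M] [IsManifold 𝓘(ℝ, E₁) ∞ X]

/-- Smooth `k`-forms on `M` with values in the bundle of Lie algebras. -/
abbrev BaseForm (k : ℕ) := 𝓔.Form E₀ (fun m : M => m) k

/-- Smooth `k`-forms on `X` with values in the pullback by the target map of the bundle of Lie
algebras. -/
abbrev ArrowForm (k : ℕ) := 𝓔.Form E₁ 𝓔.t k

/-- The coboundary `∂^▷ η = t^* η - Ad_{x⁻¹} s^* η`, a form on `X` with values in the pullback by `t`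
of the bundle of Lie algebras, of a form `η` on `M`. -/
def delta {k : ℕ} (η : 𝓔.BaseForm k) (x : X) (v : Fin k → TangentSpace 𝓘(ℝ, E₁) x) :
    TangentSpace 𝓘(ℝ, E₁) (𝓔.e (𝓔.t x)) :=
  η.val (𝓔.t x) (fun i => mfderiv 𝓘(ℝ, E₁) 𝓘(ℝ, E₀) 𝓔.t x (v i)) -
    𝓔.AdInv x (η.val (𝓔.s x) (fun i => mfderiv 𝓘(ℝ, E₁) 𝓘(ℝ, E₀) 𝓔.s x (v i)))

variable {𝓔}

/-- The value of a 1-form on a tangent vector of `X`. -/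
def Form.ev (α : 𝓔.ArrowForm 1) (x : X) (u : TangentSpace 𝓘(ℝ, E₁) x) :
    TangentSpace 𝓘(ℝ, E₁) (𝓔.e (𝓔.t x)) :=
  α.val x (fun _ => u)

/-- Right connection 1-forms: `α (ξ^▷) = ξ`, and `∂^▷ α = 0`, where
`(∂^▷ α)_{(x, y)} = α_y - (product)^* α + Ad_{y⁻¹} α_x` on the space of composable pairs, that is
`α (u · v) = α v + Ad_{y⁻¹} (α u)` for composable tangent vectors `u` at `x` and `v` at `y`. -/
structure IsRightConnection (α : 𝓔.ArrowForm 1) : Prop where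
  fund : ∀ (x : X), ∀ ξ ∈ 𝓔.lieAlg (𝓔.t x), α.ev x (𝓔.fund x ξ) = ξ
  delta : ∀ (x y : X), 𝓔.t x = 𝓔.s y →
    ∀ (u : TangentSpace 𝓘(ℝ, E₁) x) (v : TangentSpace 𝓘(ℝ, E₁) y),
      (mfderiv 𝓘(ℝ, E₁) 𝓘(ℝ, E₀) 𝓔.t x u : E₀) = mfderiv 𝓘(ℝ, E₁) 𝓘(ℝ, E₀) 𝓔.s y v →
      (α.ev (𝓔.total.mul x y) (𝓔.tmul x y u v) : E₁) = α.ev y v + 𝓔.AdInv y (α.ev x u)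

/-- The horizontal part of a vector field on `X`. -/
def Form.hor (α : 𝓔.ArrowForm 1) (U : ∀ x : X, TangentSpace 𝓘(ℝ, E₁) x) (x : X) :
    TangentSpace 𝓘(ℝ, E₁) x :=
  U x - 𝓔.fund x (α.ev x (U x))

/-- `curv` is the Ehresmann curvature of the connection `α`: `curv (U, V) = - Ver [Hor U, Hor V]` for all
vector fields `U` and `V`, where the vertical space of `X → Y` at `x` is identified with
`lieAlg (t x)` by `ξ ↦ ξ^▷`, so that `Ver` becomes `α`. -/
def Form.IsEhresmannCurvature (α : 𝓔.ArrowForm 1)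
    (curv : ∀ x : X, (Fin 2 → TangentSpace 𝓘(ℝ, E₁) x) → TangentSpace 𝓘(ℝ, E₁) (𝓔.e (𝓔.t x))) :
    Prop :=
  ∀ (x : X) (U V : ∀ x : X, TangentSpace 𝓘(ℝ, E₁) x), SmoothFieldAt U x → SmoothFieldAt V x →
    curv x ![U x, V x] = - α.ev x (mlieBracket 𝓘(ℝ, E₁) (α.hor U) (α.hor V) x)

/-- A curving of the connection `α`: a 2-form `B` on `M` with values in the bundle of Lie algebras
such that `∂^▷ B` is the Ehresmann curvature. -/
def Form.IsCurving (α : 𝓔.ArrowForm 1) (B : 𝓔.BaseForm 2) : Prop :=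
  α.IsEhresmannCurvature (𝓔.delta B)

/-- `w` is the value at `m`, in the direction of the tangent vector `v`, of the covariant derivative
of the section `σ` of the bundle of Lie algebras, for the connection induced by `α` on this bundle,
which is the linearization along the units of the connection induced on the bundle of groups `ker`.
That is, let `γ` be a curve in `M` with velocity `v` at `0` and `k (r, τ) ∈ ker (γ τ)` a smooth
family starting at the unit `k (0, τ) = e (γ τ)` with the velocity `∂_r k (0, τ) = σ (γ τ)`, such as
`k (r, τ) = exp (r σ (γ τ))`; then `w` is the derivative at `r = 0` of the vertical part, measured
by `α`, of the velocity at `τ = 0` of the curve `τ ↦ k (r, τ)`. -/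
def Form.HasCovDerivAt (α : 𝓔.ArrowForm 1) (σ : ∀ m : M, TangentSpace 𝓘(ℝ, E₁) (𝓔.e m))
    (m : M) (v : TangentSpace 𝓘(ℝ, E₀) m) (w : TangentSpace 𝓘(ℝ, E₁) (𝓔.e m)) : Prop :=
  ∀ (γ : ℝ → M) (k : ℝ × ℝ → X),
    ContMDiffAt 𝓘(ℝ, ℝ) 𝓘(ℝ, E₀) ∞ γ 0 →
    (⟨γ 0, mfderiv 𝓘(ℝ, ℝ) 𝓘(ℝ, E₀) γ 0 (1 : ℝ)⟩ : TangentBundle 𝓘(ℝ, E₀) M) = ⟨m, v⟩ →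
    ContMDiffAt 𝓘(ℝ, ℝ × ℝ) 𝓘(ℝ, E₁) ∞ k (0, 0) →
    (∀ᶠ p in 𝓝 (0 : ℝ × ℝ), k p ∈ 𝓔.ker (γ p.2)) →
    (∀ᶠ τ in 𝓝 (0 : ℝ),
      (⟨k (0, τ), mfderiv 𝓘(ℝ, ℝ) 𝓘(ℝ, E₁) (fun r : ℝ => k (r, τ)) 0 (1 : ℝ)⟩ :
        TangentBundle 𝓘(ℝ, E₁) X) = ⟨𝓔.e (γ τ), σ (γ τ)⟩) →
    HasDerivAt (fun r : ℝ =>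
      (α.ev (k (r, 0)) (mfderiv 𝓘(ℝ, ℝ) 𝓘(ℝ, E₁) (fun τ : ℝ => k (r, τ)) 0 (1 : ℝ)) : E₁))
      (w : E₁) 0

open scoped Classical in
/-- The induced covariant derivative `∇_v σ` at `m` of a section of the bundle of Lie algebras. -/
def Form.covDeriv (α : 𝓔.ArrowForm 1) (σ : ∀ m : M, TangentSpace 𝓘(ℝ, E₁) (𝓔.e m))
    (m : M) (v : TangentSpace 𝓘(ℝ, E₀) m) : TangentSpace 𝓘(ℝ, E₁) (𝓔.e m) :=
  if h : ∃ w, α.HasCovDerivAt σ m v w then h.choose else 0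

/-- `θ = d^∇ η` is the exterior covariant derivative of the `(k + 1)`-form `η` on `M` with respect
to the connection induced by `α`: for all vector fields `V_0, …, V_{k+1}`,
`θ (V_0, …, V_{k+1})` is `∑_i (-1)^i ∇_{V_i} (η (V_0, …, V̂_i, …, V_{k+1}))` plus
`∑_{i < j} (-1)^{i + j} η ([V_i, V_j], V_0, …, V̂_i, …, V̂_j, …, V_{k+1})`.
The pair `i ≤ j` in the code stands for the pair `i < j + 1`, whence the sign of the second sum. -/
def Form.IsExtCovDeriv (α : 𝓔.ArrowForm 1) {k : ℕ} (η : 𝓔.BaseForm (k + 1))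
    (θ : ∀ m : M, (Fin (k + 2) → TangentSpace 𝓘(ℝ, E₀) m) → TangentSpace 𝓘(ℝ, E₁) (𝓔.e m)) :
    Prop :=
  ∀ (m : M) (V : Fin (k + 2) → ∀ m : M, TangentSpace 𝓘(ℝ, E₀) m), (∀ i, SmoothFieldAt (V i) m) →
    θ m (fun i => V i m) =
      (∑ i : Fin (k + 2), (-1 : ℝ) ^ (i : ℕ) •
        α.covDeriv (fun m' => η.val m' (i.removeNth (fun l => V l m'))) m (V i m)) -
      ∑ i : Fin (k + 1), ∑ j ∈ Finset.Ici i, (-1 : ℝ) ^ (i + j : ℕ) •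
        η.val m (Matrix.vecCons (mlieBracket 𝓘(ℝ, E₀) (V i.castSucc) (V j.succ) m)
          (j.removeNth (i.castSucc.removeNth (fun l => V l m))))

end LieGroupoidExtension

end

/-! The heart of the matter is a structure equation for the connection `α`. On two horizontal
vectors `dα` is the curvature `∂^▷ B`; on a fundamental and a horizontal vector it is the connection
form of `∇` pulled back by the target map (`daloc_fundE`); on two fundamental vectors it is some
bilinear expression `Q` (`daloc_eq`). The mixed case rests on the multiplicativity of `α`, which
also shows that `Ad_{x⁻¹}` intertwines the pullbacks of `∇` by `s` and `t` in horizontal directions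
(`KerFamily.covCurve_adI`, `fderiv_adI_operator`).

Differentiating the structure equation and using `d²α = 0` gives a Bianchi identity. For `u`, `v`
horizontal and `w` arbitrary, `d^∇ (∂^▷ B) (u, v, w) = R (t_* u, t_* v) α(w) - Q (∂^▷ B (u, v),
α(w))`, where `R` is the curvature of `∇`. By the intertwining property the left side is `∂^▷ Ω (u,
v, w)` up to a term that contains the covariant derivative of `Ad_{x⁻¹}` in the direction `w`
(`exists_bianchi_curving`).

All the conclusions come from this identity. If `w` is horizontal too, the extra term and the right
side vanish; since `s_*` and `t_*` kill fundamental vectors, `∂^▷ Ω = 0` (`deltaE_three`). At a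
unit, with `u`, `v` tangent to the units and `w = ξ` vertical, it says `R (u, v) ξ = [ξ, B (u, v)]`
(`connCurv_Gam`, `bracketE_eq_daloc`). Hence `d^∇ Ω = R ∧ B` is a sum of brackets of values of `B`,
which cancel in pairs (`isExtCovDeriv_three_zero`). Finally, `∂^▷ Ω = 0` at the points of the kernel
says that `Ω` is invariant under the adjoint action of the kernel; the derivative of this invariance
is centrality (`bracketE_valE_eq_zero`).

Computations take place in charts. A tangent space is definitionally the model space, so `tmap`,
`evE`, `adI`, `fundE`, `valE` have plain types and base points can be rewritten. Elements of the Lie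
algebras are handled as velocities of curves in the kernel. -/

set_option linter.unusedSectionVars false

noncomputable section

/-! ### Smoothness of operator-valued maps, tested on vectors. -/

section Alternating

variable {P E F : Type*} [NormedAddCommGroup P] [NormedSpace ℝ P]
  [NormedAddCommGroup E] [NormedSpace ℝ E] [FiniteDimensional ℝ E]
  [NormedAddCommGroup F] [NormedSpace ℝ F] [FiniteDimensional ℝ F]

/-- An operator is recovered from its values on a basis by a linear map `L`, which is continuous
because its domain is finite-dimensional. -/
theorem contDiffAt_clm_of_apply {n : WithTop ℕ∞} {f : P → E →L[ℝ] F} {p : P}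
    (h : ∀ v, ContDiffAt ℝ n (fun q => f q v) p) : ContDiffAt ℝ n f p := by
  let J : (E →L[ℝ] F) →ₗ[ℝ] (Fin (Module.finrank ℝ E) → F) :=
    { toFun := fun f i => f (Module.finBasis ℝ E i)
      map_add' := fun f g => rfl
      map_smul' := fun c f => rfl }
  have hJ : LinearMap.ker J = ⊥ := by
    refine LinearMap.ker_eq_bot'.2 fun f hf => ?_
    apply ContinuousLinearMap.coe_injective
    exact (Module.finBasis ℝ E).ext fun i => congrFun hf i
  obtain ⟨L, hL⟩ := LinearMap.exists_leftInverse_of_injective J hJ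
  let L' : (Fin (Module.finrank ℝ E) → F) →L[ℝ] (E →L[ℝ] F) :=
    ⟨L, L.continuous_of_finiteDimensional⟩
  have hf : f = fun q => L' (fun i => f q (Module.finBasis ℝ E i)) := by
    funext q
    exact (LinearMap.congr_fun hL (f q)).symm
  rw [hf]
  exact L'.contDiff.contDiffAt.comp p (contDiffAt_pi.2 fun i => h _)

theorem contDiffAt_continuousAlternatingMap_of_apply {k : ℕ} {n : WithTop ℕ∞}
    {f : P → E [⋀^Fin k]→L[ℝ] F} {p : P}
    (h : ∀ v : Fin k → E, ContDiffAt ℝ n (fun q => f q v) p) : ContDiffAt ℝ n f p := by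
  let J : (E [⋀^Fin k]→L[ℝ] F) →ₗ[ℝ] ((Fin k → Fin (Module.finrank ℝ E)) → F) :=
    { toFun := fun f i => f (fun j => Module.finBasis ℝ E (i j))
      map_add' := fun f g => rfl
      map_smul' := fun c f => rfl }
  have hJ : LinearMap.ker J = ⊥ := by
    refine LinearMap.ker_eq_bot'.2 fun f hf => ?_
    apply ContinuousAlternatingMap.toAlternatingMap_injective
    apply AlternatingMap.coe_multilinearMap_injective
    refine Module.Basis.ext_multilinear (fun _ => Module.finBasis ℝ E) fun i => ?_
    exact congrFun hf i
  obtain ⟨L, hL⟩ := LinearMap.exists_leftInverse_of_injective J hJ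
  let L' : ((Fin k → Fin (Module.finrank ℝ E)) → F) →L[ℝ] (E [⋀^Fin k]→L[ℝ] F) :=
    ⟨L, L.continuous_of_finiteDimensional⟩
  have hf : f = fun q => L' (fun i => f q (fun j => Module.finBasis ℝ E (i j))) := by
    funext q
    exact (LinearMap.congr_fun hL (f q)).symm
  rw [hf]
  exact L'.contDiff.contDiffAt.comp p (contDiffAt_pi.2 fun i => h _)

end Alternating

/-! ### Tangent maps and tangent bundles in coordinates. -/

section Charts

variable {F N F' N' F'' N'' : Type*}
  [NormedAddCommGroup F] [NormedSpace ℝ F] [TopologicalSpace N] [ChartedSpace F N]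
  [NormedAddCommGroup F'] [NormedSpace ℝ F'] [TopologicalSpace N'] [ChartedSpace F' N']
  [NormedAddCommGroup F''] [NormedSpace ℝ F''] [TopologicalSpace N''] [ChartedSpace F'' N'']

/-- The tangent map in the preferred charts, with values in plain model spaces. -/
def tmap (F F' : Type*) {N N' : Type*}
    [NormedAddCommGroup F] [NormedSpace ℝ F] [TopologicalSpace N] [ChartedSpace F N]
    [NormedAddCommGroup F'] [NormedSpace ℝ F'] [TopologicalSpace N'] [ChartedSpace F' N']
    (f : N → N') (x : N) : F →L[ℝ] F' := mfderiv 𝓘(ℝ, F) 𝓘(ℝ, F') f x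

/-- The tangent map within a set, with values in plain model spaces. -/
def tmapWithin (F F' : Type*) {N N' : Type*}
    [NormedAddCommGroup F] [NormedSpace ℝ F] [TopologicalSpace N] [ChartedSpace F N]
    [NormedAddCommGroup F'] [NormedSpace ℝ F'] [TopologicalSpace N'] [ChartedSpace F' N']
    (f : N → N') (s : Set N) (x : N) : F →L[ℝ] F' :=
  mfderivWithin 𝓘(ℝ, F) 𝓘(ℝ, F') f s x

/-- The chart at `x₀` as a map to the model space. -/
abbrev chart (F : Type*) {N : Type*} [NormedAddCommGroup F] [NormedSpace ℝ F] [TopologicalSpace N]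
    [ChartedSpace F N] (x₀ : N) : N → F := extChartAt 𝓘(ℝ, F) x₀

/-- The inverse of the chart at `x₀`. -/
abbrev param (F : Type*) {N : Type*} [NormedAddCommGroup F] [NormedSpace ℝ F] [TopologicalSpace N]
    [ChartedSpace F N] (x₀ : N) : F → N := (extChartAt 𝓘(ℝ, F) x₀).symm

/-- The domain of the chart at `x₀`. -/
abbrev dom (F : Type*) {N : Type*} [NormedAddCommGroup F] [NormedSpace ℝ F] [TopologicalSpace N]
    [ChartedSpace F N] (x₀ : N) : Set N := (extChartAt 𝓘(ℝ, F) x₀).source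

/-- Coordinates, in the chart at `x₀`, of tangent vectors at `x`. -/
def dchart (F : Type*) {N : Type*} [NormedAddCommGroup F] [NormedSpace ℝ F] [TopologicalSpace N]
    [ChartedSpace F N] (x₀ x : N) : F →L[ℝ] F := tmap F F (chart F x₀) x

/-- The inverse of `dchart`. -/
def dparam (F : Type*) {N : Type*} [NormedAddCommGroup F] [NormedSpace ℝ F] [TopologicalSpace N]
    [ChartedSpace F N] (x₀ x : N) : F →L[ℝ] F := tmap F F (param F x₀) (chart F x₀ x)

theorem tmap_eq_fderiv (f : F → F') (x : F) : tmap F F' f x = fderiv ℝ f x := mfderiv_eq_fderiv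

theorem tmap_comp {g : N' → N''} {f : N → N'} {x : N}
    (hg : MDifferentiableAt 𝓘(ℝ, F') 𝓘(ℝ, F'') g (f x))
    (hf : MDifferentiableAt 𝓘(ℝ, F) 𝓘(ℝ, F') f x) :
    tmap F F'' (fun y => g (f y)) x = (tmap F' F'' g (f x)).comp (tmap F F' f x) :=
  mfderiv_comp x hg hf

theorem tmap_congr {f g : N → N'} {x : N} (h : f =ᶠ[𝓝 x] g) : tmap F F' f x = tmap F F' g x := by
  exact h.mfderiv_eq

/-- Unique differentiability of `s` plays no role: whatever derivative `mfderivWithin` picks, its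
composition with the derivative of a map that stays in `s` is a derivative without restriction,
hence unique. This gives `fund`, `Ad`, `tmul` and `bracket`, which are differentiated along
submanifolds, their meaning on velocities of curves inside these. -/
theorem tmap_comp_within {g : N' → N''} {f : N → N'} {s : Set N'} {x : N}
    (hg : MDifferentiableWithinAt 𝓘(ℝ, F') 𝓘(ℝ, F'') g s (f x))
    (hf : MDifferentiableAt 𝓘(ℝ, F) 𝓘(ℝ, F') f x) (hs : ∀ᶠ y in 𝓝 x, f y ∈ s) :
    tmap F F'' (fun y => g (f y)) x = (tmapWithin F' F'' g s (f x)).comp (tmap F F' f x) := by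
  have h1 := hg.hasMFDerivWithinAt
  have h2 : HasMFDerivWithinAt 𝓘(ℝ, F) 𝓘(ℝ, F') f (f ⁻¹' s) x (mfderiv 𝓘(ℝ, F) 𝓘(ℝ, F') f x) :=
    hf.hasMFDerivAt.hasMFDerivWithinAt
  have h3 := h1.comp x h2 Subset.rfl
  exact (h3.hasMFDerivAt hs).mfderiv

theorem isOpen_dom (x₀ : N) : IsOpen (dom F x₀) := isOpen_extChartAt_source x₀

theorem mem_dom_self (x₀ : N) : x₀ ∈ dom F x₀ := mem_extChartAt_source x₀

theorem param_chart {x₀ x : N} (hx : x ∈ dom F x₀) : param F x₀ (chart F x₀ x) = x :=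
  (extChartAt 𝓘(ℝ, F) x₀).left_inv hx

theorem target_mem_nhds {x₀ x : N} (hx : x ∈ dom F x₀) :
    (extChartAt 𝓘(ℝ, F) x₀).target ∈ 𝓝 (chart F x₀ x) :=
  (isOpen_extChartAt_target x₀).mem_nhds ((extChartAt 𝓘(ℝ, F) x₀).map_source hx)

theorem chart_param_eventually {x₀ x : N} (hx : x ∈ dom F x₀) :
    ∀ᶠ q in 𝓝 (chart F x₀ x), chart F x₀ (param F x₀ q) = q := by
  filter_upwards [target_mem_nhds hx] with q hq
  exact (extChartAt 𝓘(ℝ, F) x₀).right_inv hq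

theorem param_mem_dom_eventually {x₀ x : N} (hx : x ∈ dom F x₀) :
    ∀ᶠ q in 𝓝 (chart F x₀ x), param F x₀ q ∈ dom F x₀ := by
  filter_upwards [target_mem_nhds hx] with q hq
  exact (extChartAt 𝓘(ℝ, F) x₀).map_target hq

variable [IsManifold 𝓘(ℝ, F) ∞ N]

theorem contMDiffAt_chart {x₀ x : N} (hx : x ∈ dom F x₀) :
    ContMDiffAt 𝓘(ℝ, F) 𝓘(ℝ, F) ∞ (chart F x₀) x :=
  contMDiffAt_extChartAt' (by rwa [dom, extChartAt_source] at hx)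

theorem contMDiffAt_param {x₀ x : N} (hx : x ∈ dom F x₀) :
    ContMDiffAt 𝓘(ℝ, F) 𝓘(ℝ, F) ∞ (param F x₀) (chart F x₀ x) :=
  (contMDiffOn_extChartAt_symm x₀).contMDiffAt (target_mem_nhds hx)

theorem tendsto_param {x₀ x : N} (hx : x ∈ dom F x₀) :
    Filter.Tendsto (param F x₀) (𝓝 (chart F x₀ x)) (𝓝 x) := by
  have := (contMDiffAt_param hx).continuousAt.tendsto
  rwa [param_chart hx] at this

theorem tendsto_chart {x₀ x : N} (hx : x ∈ dom F x₀) :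
    Filter.Tendsto (chart F x₀) (𝓝 x) (𝓝 (chart F x₀ x)) :=
  (contMDiffAt_chart hx).continuousAt.tendsto

theorem mdiff_chart {x₀ x : N} (hx : x ∈ dom F x₀) :
    MDifferentiableAt 𝓘(ℝ, F) 𝓘(ℝ, F) (chart F x₀) x :=
  (contMDiffAt_chart hx).mdifferentiableAt (by simp)

theorem mdiff_param {x₀ x : N} (hx : x ∈ dom F x₀) :
    MDifferentiableAt 𝓘(ℝ, F) 𝓘(ℝ, F) (param F x₀) (chart F x₀ x) :=
  (contMDiffAt_param hx).mdifferentiableAt (by simp)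

theorem dchart_dparam {x₀ x : N} (hx : x ∈ dom F x₀) (v : F) :
    dchart F x₀ x (dparam F x₀ x v) = v := by
  have h := tmap_comp (g := chart F x₀) (f := param F x₀) (x := chart F x₀ x)
    (by rw [param_chart hx]; exact mdiff_chart hx) (mdiff_param hx)
  rw [param_chart hx] at h
  have h2 : tmap F F (fun y => chart F x₀ (param F x₀ y)) (chart F x₀ x) = ContinuousLinearMap.id ℝ F := by
    rw [tmap_congr (g := fun y => y) (chart_param_eventually hx), tmap_eq_fderiv]
    exact fderiv_id
  rw [h2] at h
  exact (congrArg (fun L : F →L[ℝ] F => L v) h).symm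

theorem dparam_dchart {x₀ x : N} (hx : x ∈ dom F x₀) (v : F) :
    dparam F x₀ x (dchart F x₀ x v) = v := by
  have h := tmap_comp (g := param F x₀) (f := chart F x₀) (x := x)
    (mdiff_param hx) (mdiff_chart hx)
  have h2 : tmap F F (fun y => param F x₀ (chart F x₀ y)) x = ContinuousLinearMap.id ℝ F := by
    rw [tmap_congr (g := fun y => y)]
    · exact mfderiv_id
    · filter_upwards [(isOpen_dom x₀).mem_nhds hx] with y hy
      exact param_chart hy
  rw [h2] at h
  exact (congrArg (fun L : F →L[ℝ] F => L v) h).symm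

/-- The tangent space at `x` is identified with the model space by the preferred chart at `x`
itself, so coordinate changes disappear whenever the charts are centred at the point of interest. -/
theorem dchart_self (x : N) : dchart F x x = ContinuousLinearMap.id ℝ F :=
  mfderiv_extChartAt_self

theorem dparam_self (x : N) : dparam F x x = ContinuousLinearMap.id ℝ F := by
  ext v
  have := dparam_dchart (mem_dom_self (F := F) x) v
  rwa [dchart_self] at this

theorem dchart_injective {x₀ x : N} (hx : x ∈ dom F x₀) : Function.Injective (dchart F x₀ x) :=
  Function.LeftInverse.injective (dparam_dchart hx)

theorem hasFDerivAt_chart_comp {P : Type*} [NormedAddCommGroup P] [NormedSpace ℝ P] {f : P → N}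
    {p : P} {x₀ : N} (hf : MDifferentiableAt 𝓘(ℝ, P) 𝓘(ℝ, F) f p) (hx : f p ∈ dom F x₀) :
    HasFDerivAt (fun q => chart F x₀ (f q)) ((dchart F x₀ (f p)).comp (tmap P F f p)) p := by
  have h1 : MDifferentiableAt 𝓘(ℝ, P) 𝓘(ℝ, F) (fun q => chart F x₀ (f q)) p :=
    (mdiff_chart hx).comp p hf
  have h2 := tmap_comp (g := chart F x₀) (mdiff_chart hx) hf
  rw [tmap_eq_fderiv] at h2
  have h3 := (mdifferentiableAt_iff_differentiableAt.1 h1).hasFDerivAt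
  rwa [h2] at h3

/-- Smoothness of a map to the tangent bundle, in an arbitrary chart. -/
theorem contMDiffAt_tangent_iff_of_le {k : WithTop ℕ∞} (hk : k + 1 ≤ ∞) {f : N' → N}
    {v : N' → F} {p : N'} {x₀ : N} (hx : f p ∈ dom F x₀) :
    ContMDiffAt 𝓘(ℝ, F') 𝓘(ℝ, F).tangent k (fun n => (⟨f n, v n⟩ : TangentBundle 𝓘(ℝ, F) N)) p ↔
      ContMDiffAt 𝓘(ℝ, F') 𝓘(ℝ, F) k f p ∧
      ContMDiffAt 𝓘(ℝ, F') 𝓘(ℝ, F) k (fun n => dchart F x₀ (f n) (v n)) p := by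
  have : IsManifold 𝓘(ℝ, F) (k + 1) N := IsManifold.of_le hk
  have : ContMDiffVectorBundle k F (TangentSpace 𝓘(ℝ, F) : N → Type _) 𝓘(ℝ, F) :=
    TangentBundle.contMDiffVectorBundle
  have hx' : f p ∈ (chartAt F x₀).source := by rwa [dom, extChartAt_source] at hx
  have := Bundle.Trivialization.contMDiffAt_iff (IM := 𝓘(ℝ, F')) (IB := 𝓘(ℝ, F)) (n := k)
    (e := trivializationAt F (TangentSpace 𝓘(ℝ, F) : N → Type _) x₀)
    (f := fun n => (⟨f n, v n⟩ : TangentBundle 𝓘(ℝ, F) N)) (x₀ := p)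
    (by rw [TangentBundle.trivializationAt_source]; exact hx')
  rw [show 𝓘(ℝ, F).tangent = 𝓘(ℝ, F).prod 𝓘(ℝ, F) from rfl, this]
  refine and_congr_right fun hf => ?_
  refine Filter.EventuallyEq.contMDiffAt_iff ?_
  filter_upwards [hf.continuousAt.preimage_mem_nhds ((chartAt F x₀).open_source.mem_nhds hx')]
    with n hn
  have h := TangentBundle.continuousLinearMapAt_trivializationAt (I := 𝓘(ℝ, F)) (x₀ := x₀) hn
  have h3 := congrArg (fun L : F →L[ℝ] F => L (v n)) h
  refine Eq.trans ?_ h3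
  symm
  exact Bundle.Trivialization.continuousLinearMapAt_apply_of_mem ℝ _ hn _

theorem contMDiffAt_tangent_iff {f : N' → N} {v : N' → F} {p : N'} {x₀ : N} (hx : f p ∈ dom F x₀) :
    ContMDiffAt 𝓘(ℝ, F') 𝓘(ℝ, F).tangent ∞ (fun n => (⟨f n, v n⟩ : TangentBundle 𝓘(ℝ, F) N)) p ↔
      ContMDiffAt 𝓘(ℝ, F') 𝓘(ℝ, F) ∞ f p ∧
      ContMDiffAt 𝓘(ℝ, F') 𝓘(ℝ, F) ∞ (fun n => dchart F x₀ (f n) (v n)) p :=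
  contMDiffAt_tangent_iff_of_le (by simp) hx

end Charts

/-! ### Local sections of submersions. -/

/-- Near a point, a submersion `f` admits a smooth family of local sections: `L (y, x)` lies over
`y`, and `L (f x, x) = x`. -/
theorem Manifold.IsSubmersion.exists_section_family {F N F' N' : Type*}
    [NormedAddCommGroup F] [NormedSpace ℝ F] [TopologicalSpace N] [ChartedSpace F N]
    [NormedAddCommGroup F'] [NormedSpace ℝ F'] [TopologicalSpace N'] [ChartedSpace F' N']
    [IsManifold 𝓘(ℝ, F) ∞ N] [IsManifold 𝓘(ℝ, F') ∞ N']
    {f : N → N'} (hf : Manifold.IsSubmersion 𝓘(ℝ, F) 𝓘(ℝ, F') ∞ f) (x₀ : N) :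
    ∃ L : N' × N → N,
      ContMDiffAt (𝓘(ℝ, F').prod 𝓘(ℝ, F)) 𝓘(ℝ, F) ∞ L (f x₀, x₀) ∧
      (∀ᶠ p in 𝓝 (f x₀, x₀), f (L p) = p.1) ∧ ∀ᶠ x in 𝓝 x₀, L (f x, x) = x := by
  obtain ⟨Fc, _, _, h⟩ := hf.isSubmersionAt x₀
  have hD := h.mem_domChart_source
  have hC := h.mem_codChart_source
  have key : ∀ x ∈ h.domChart.source, h.codChart (f x) = (h.equiv (h.domChart x)).1 := by
    intro x hx
    have hx' : x ∈ (h.domChart.extend 𝓘(ℝ, F)).source := by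
      rw [OpenPartialHomeomorph.extend_source]; exact hx
    have h1 := h.writtenInCharts ((h.domChart.extend 𝓘(ℝ, F)).map_source hx')
    have h2 : (h.domChart.extend 𝓘(ℝ, F)).symm (h.domChart.extend 𝓘(ℝ, F) x) = x :=
      (h.domChart.extend 𝓘(ℝ, F)).left_inv hx'
    rw [Function.comp_apply, Function.comp_apply, h2] at h1
    exact h1
  -- In adapted charts `f` is a projection; `A` takes the base coordinate from `p.1` and the fibre
  -- coordinate from `p.2`.
  let A : N' × N → F := fun p => h.equiv.symm (h.codChart p.1, (h.equiv (h.domChart p.2)).2)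
  have hA : ∀ x ∈ h.domChart.source, A (f x, x) = h.domChart x := by
    intro x hx
    simp only [A, key x hx]
    exact h.equiv.symm_apply_apply _
  have hDsm : ContMDiffAt 𝓘(ℝ, F) 𝓘(ℝ, F) ∞ h.domChart x₀ :=
    contMDiffAt_of_mem_maximalAtlas h.domChart_mem_maximalAtlas hD
  have hCsm : ContMDiffAt 𝓘(ℝ, F') 𝓘(ℝ, F') ∞ h.codChart (f x₀) :=
    contMDiffAt_of_mem_maximalAtlas h.codChart_mem_maximalAtlas hC
  have hAsm : ContMDiffAt (𝓘(ℝ, F').prod 𝓘(ℝ, F)) 𝓘(ℝ, F) ∞ A (f x₀, x₀) := by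
    have e1 : ContMDiffAt (𝓘(ℝ, F').prod 𝓘(ℝ, F)) 𝓘(ℝ, F') ∞
        (fun p : N' × N => h.codChart p.1) (f x₀, x₀) :=
      ContMDiffAt.comp (f x₀, x₀) (g := h.codChart) hCsm contMDiffAt_fst
    have e2 : ContMDiffAt (𝓘(ℝ, F').prod 𝓘(ℝ, F)) 𝓘(ℝ, F) ∞
        (fun p : N' × N => h.domChart p.2) (f x₀, x₀) :=
      ContMDiffAt.comp (f x₀, x₀) (g := h.domChart) hDsm contMDiffAt_snd
    have e3 : ContMDiffAt (𝓘(ℝ, F').prod 𝓘(ℝ, F)) 𝓘(ℝ, F' × Fc) ∞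
        (fun p : N' × N => (h.codChart p.1, (h.equiv (h.domChart p.2)).2)) (f x₀, x₀) :=
      e1.prodMk_space (((ContinuousLinearMap.snd ℝ F' Fc).comp
        (h.equiv : F →L[ℝ] F' × Fc)).contDiff.comp_contMDiffAt e2)
    exact (h.equiv.symm : (F' × Fc) →L[ℝ] F).contDiff.comp_contMDiffAt e3
  have hA0 : A (f x₀, x₀) = h.domChart x₀ := hA x₀ hD
  refine ⟨fun p => h.domChart.symm (A p), ?_, ?_, ?_⟩
  · refine ContMDiffAt.comp (f x₀, x₀) (g := h.domChart.symm) ?_ hAsm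
    rw [hA0]
    exact contMDiffAt_symm_of_mem_maximalAtlas h.domChart_mem_maximalAtlas
      (h.domChart.map_source hD)
  · have c1 : ∀ᶠ p in 𝓝 (f x₀, x₀), A p ∈ h.domChart.target :=
      hAsm.continuousAt.preimage_mem_nhds (by
        rw [hA0]; exact h.domChart.open_target.mem_nhds (h.domChart.map_source hD))
    have c2 : ∀ᶠ p : N' × N in 𝓝 (f x₀, x₀), p.1 ∈ h.codChart.source :=
      continuousAt_fst.preimage_mem_nhds (h.codChart.open_source.mem_nhds hC)
    filter_upwards [c1, c2] with p h1 h2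
    have h3 := h.domChart.map_target h1
    have h4 := key _ h3
    rw [h.domChart.right_inv h1] at h4
    simp only [A, ContinuousLinearEquiv.apply_symm_apply] at h4
    exact h.codChart.injOn (h.source_subset_preimage_source h3) h2 h4
  · filter_upwards [h.domChart.open_source.mem_nhds hD] with x hx
    simp only [hA x hx]
    exact h.domChart.left_inv hx

/-! ### Groupoid algebra. -/

namespace LieGroupoid

variable {E₀ E M G : Type*}
    [NormedAddCommGroup E₀] [NormedSpace ℝ E₀] [NormedAddCommGroup E] [NormedSpace ℝ E]
    [TopologicalSpace M] [ChartedSpace E₀ M] [TopologicalSpace G] [ChartedSpace E G]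
    (𝒢 : LieGroupoid E₀ E M G)

theorem inv_inv (x : G) : 𝒢.inv (𝒢.inv x) = x := by
  have h1 := 𝒢.mul_one (𝒢.inv (𝒢.inv x))
  rw [𝒢.tgt_inv, 𝒢.src_inv, ← 𝒢.inv_mul, ← 𝒢.mul_assoc _ _ _ (by rw [𝒢.tgt_inv])
    (by rw [𝒢.tgt_inv]), 𝒢.inv_mul, 𝒢.tgt_inv, 𝒢.one_mul] at h1
  exact h1.symm

theorem one_mul' (x : G) {m : M} (h : 𝒢.src x = m) : 𝒢.mul (𝒢.one m) x = x := by
  rw [← h, 𝒢.one_mul]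

theorem mul_one' (x : G) {m : M} (h : 𝒢.tgt x = m) : 𝒢.mul x (𝒢.one m) = x := by
  rw [← h, 𝒢.mul_one]

theorem inv_mul_cancel_left (x y : G) (h : 𝒢.tgt x = 𝒢.src y) :
    𝒢.mul (𝒢.inv x) (𝒢.mul x y) = y := by
  rw [← 𝒢.mul_assoc _ _ _ (𝒢.tgt_inv x) h, 𝒢.inv_mul, 𝒢.one_mul' _ h.symm]

theorem mul_inv_cancel_left (x y : G) (h : 𝒢.src x = 𝒢.src y) :
    𝒢.mul x (𝒢.mul (𝒢.inv x) y) = y := by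
  rw [← 𝒢.mul_assoc _ _ _ (𝒢.src_inv x).symm (by rw [𝒢.tgt_inv, h]), 𝒢.mul_inv,
    𝒢.one_mul' _ h.symm]

theorem eq_one_of_mul_self {x : G} {m : M} (hs : 𝒢.src x = m) (ht : 𝒢.tgt x = m)
    (h : 𝒢.mul x x = x) : x = 𝒢.one m := by
  have h1 := 𝒢.inv_mul_cancel_left x x (by rw [hs, ht])
  rw [h, 𝒢.inv_mul, ht] at h1
  exact h1.symm

theorem inv_one (m : M) : 𝒢.inv (𝒢.one m) = 𝒢.one m := by
  have h1 := 𝒢.inv_mul (𝒢.one m)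
  rw [𝒢.mul_one' _ (by rw [𝒢.tgt_inv, 𝒢.src_one]), 𝒢.tgt_one] at h1
  exact h1

theorem contMDiff_src : ContMDiff 𝓘(ℝ, E) 𝓘(ℝ, E₀) ∞ 𝒢.src := 𝒢.isSubmersion_src.contMDiff

theorem contMDiff_tgt : ContMDiff 𝓘(ℝ, E) 𝓘(ℝ, E₀) ∞ 𝒢.tgt := 𝒢.isSubmersion_tgt.contMDiff

theorem contMDiffAt_mul {Q H N : Type*} [NormedAddCommGroup Q] [NormedSpace ℝ Q]
    [TopologicalSpace H] {I : ModelWithCorners ℝ Q H} [TopologicalSpace N] [ChartedSpace H N]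
    {f g : N → G} {p : N} (hf : ContMDiffAt I 𝓘(ℝ, E) ∞ f p) (hg : ContMDiffAt I 𝓘(ℝ, E) ∞ g p)
    (h : ∀ᶠ q in 𝓝 p, 𝒢.tgt (f q) = 𝒢.src (g q)) :
    ContMDiffAt I 𝓘(ℝ, E) ∞ (fun q => 𝒢.mul (f q) (g q)) p := by
  have h1 := 𝒢.contMDiffOn_mul (f p, g p) h.self_of_nhds
  have h2 : ContMDiffAt I (𝓘(ℝ, E).prod 𝓘(ℝ, E)) ∞ (fun q => (f q, g q)) p := hf.prodMk hg
  have h3 := ContMDiffWithinAt.comp p h1 (h2.contMDiffWithinAt (s := {q | 𝒢.tgt (f q) = 𝒢.src (g q)}))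
    (fun q hq => hq)
  exact h3.contMDiffAt h

end LieGroupoid

/-! ### The kernel, and derivatives of products, translations and conjugations. -/

namespace LieGroupoidExtension

variable {E₀ E₁ E₂ M X Y : Type*}
  [NormedAddCommGroup E₀] [NormedSpace ℝ E₀] [NormedAddCommGroup E₁] [NormedSpace ℝ E₁]
  [NormedAddCommGroup E₂] [NormedSpace ℝ E₂]
  [TopologicalSpace M] [ChartedSpace E₀ M] [TopologicalSpace X] [ChartedSpace E₁ X]
  [TopologicalSpace Y] [ChartedSpace E₂ Y]
  (𝓔 : LieGroupoidExtension E₀ E₁ E₂ M X Y)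

/-- Preservation of units is not part of the data: the image of a unit is idempotent, and an
idempotent whose source and target agree is a unit. -/
theorem φ_one (m : M) : 𝓔.φ (𝓔.e m) = 𝓔.quot.one m := by
  apply 𝓔.quot.eq_one_of_mul_self
  · rw [𝓔.src_φ, 𝓔.total.src_one]
  · rw [𝓔.tgt_φ, 𝓔.total.tgt_one]
  · rw [← 𝓔.φ_mul _ _ (by rw [𝓔.total.src_one, 𝓔.total.tgt_one]),
      𝓔.total.one_mul' _ (𝓔.total.src_one m)]

theorem one_mem_ker (m : M) : 𝓔.e m ∈ 𝓔.ker m := 𝓔.φ_one m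

variable {𝓔}

theorem s_e (m : M) : 𝓔.s (𝓔.e m) = m := 𝓔.total.src_one m
theorem t_e (m : M) : 𝓔.t (𝓔.e m) = m := 𝓔.total.tgt_one m
theorem s_inv (x : X) : 𝓔.s (𝓔.total.inv x) = 𝓔.t x := 𝓔.total.src_inv x
theorem t_inv (x : X) : 𝓔.t (𝓔.total.inv x) = 𝓔.s x := 𝓔.total.tgt_inv x
theorem s_mul {x y : X} (h : 𝓔.t x = 𝓔.s y) : 𝓔.s (𝓔.total.mul x y) = 𝓔.s x :=
  𝓔.total.src_mul x y h
theorem t_mul {x y : X} (h : 𝓔.t x = 𝓔.s y) : 𝓔.t (𝓔.total.mul x y) = 𝓔.t y :=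
  𝓔.total.tgt_mul x y h
theorem quot_src_φ (x : X) : 𝓔.quot.src (𝓔.φ x) = 𝓔.s x := 𝓔.src_φ x
theorem quot_tgt_φ (x : X) : 𝓔.quot.tgt (𝓔.φ x) = 𝓔.t x := 𝓔.tgt_φ x
theorem φ_mul' {x y : X} (h : 𝓔.t x = 𝓔.s y) :
    𝓔.φ (𝓔.total.mul x y) = 𝓔.quot.mul (𝓔.φ x) (𝓔.φ y) := 𝓔.φ_mul x y h

theorem s_of_mem_ker {m : M} {k : X} (h : k ∈ 𝓔.ker m) : 𝓔.s k = m := by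
  have h : 𝓔.φ k = 𝓔.quot.one m := h
  rw [← quot_src_φ, h, 𝓔.quot.src_one]

theorem t_of_mem_ker {m : M} {k : X} (h : k ∈ 𝓔.ker m) : 𝓔.t k = m := by
  have h : 𝓔.φ k = 𝓔.quot.one m := h
  rw [← quot_tgt_φ, h, 𝓔.quot.tgt_one]

theorem φ_inv_mul (x : X) : 𝓔.quot.mul (𝓔.φ (𝓔.total.inv x)) (𝓔.φ x) = 𝓔.quot.one (𝓔.t x) := by
  rw [← 𝓔.φ_mul _ _ (𝓔.total.tgt_inv x), 𝓔.total.inv_mul, 𝓔.φ_one]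

theorem inv_conj_mem_ker {x k : X} (h : k ∈ 𝓔.ker (𝓔.s x)) :
    𝓔.total.mul (𝓔.total.mul (𝓔.total.inv x) k) x ∈ 𝓔.ker (𝓔.t x) := by
  have hs := s_of_mem_ker h
  have ht := t_of_mem_ker h
  have h1 : 𝓔.t (𝓔.total.inv x) = 𝓔.s k := by rw [t_inv, hs]
  have hk : 𝓔.φ k = 𝓔.quot.one (𝓔.s x) := h
  change 𝓔.φ _ = _
  rw [φ_mul' (by rw [t_mul h1, ht]), φ_mul' h1, hk,
    𝓔.quot.mul_one' _ (by rw [quot_tgt_φ, t_inv]), φ_inv_mul]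

theorem inv_mem_ker {m : M} {k : X} (h : k ∈ 𝓔.ker m) : 𝓔.total.inv k ∈ 𝓔.ker m := by
  have h1 := 𝓔.φ_inv_mul k
  have hk : 𝓔.φ k = 𝓔.quot.one m := h
  rw [t_of_mem_ker h, hk, 𝓔.quot.mul_one' _ (by
    rw [quot_tgt_φ, t_inv, s_of_mem_ker h])] at h1
  exact h1

variable (𝓔)

theorem contMDiff_s : ContMDiff 𝓘(ℝ, E₁) 𝓘(ℝ, E₀) ∞ 𝓔.s := 𝓔.total.contMDiff_src
theorem contMDiff_t : ContMDiff 𝓘(ℝ, E₁) 𝓘(ℝ, E₀) ∞ 𝓔.t := 𝓔.total.contMDiff_tgt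
theorem contMDiff_e : ContMDiff 𝓘(ℝ, E₀) 𝓘(ℝ, E₁) ∞ 𝓔.e := 𝓔.total.contMDiff_one
theorem contMDiff_φ : ContMDiff 𝓘(ℝ, E₁) 𝓘(ℝ, E₂) ∞ 𝓔.φ := 𝓔.isSubmersion_φ.contMDiff

/-- The tangent space at the unit of the kernel, as a subspace of the model space. -/
def K (m : M) : Submodule ℝ E₁ := LinearMap.ker (tmap E₁ E₂ 𝓔.φ (𝓔.e m)).toLinearMap

/-- `AdInv` on the model space. -/
def adI (x : X) : E₁ →L[ℝ] E₁ := 𝓔.AdInv x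

/-- `fund` on the model space. -/
def fundE (x : X) : E₁ →L[ℝ] E₁ := 𝓔.fund x

/-- `tmul` on the model space. -/
def tmulE (x y : X) : E₁ × E₁ →L[ℝ] E₁ :=
  mfderivWithin (𝓘(ℝ, E₁).prod 𝓘(ℝ, E₁)) 𝓘(ℝ, E₁) (fun p : X × X => 𝓔.total.mul p.1 p.2)
    {p | 𝓔.t p.1 = 𝓔.s p.2} (x, y)

variable {Q P : Type*} [NormedAddCommGroup Q] [NormedSpace ℝ Q] [TopologicalSpace P] [ChartedSpace Q P]

/-- The pair `(f, g)` stays among the composable pairs, the only place where the derivative defining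
`tmul` is meaningful. -/
theorem tmap_mul {f g : P → X} {p : P} (hf : MDifferentiableAt 𝓘(ℝ, Q) 𝓘(ℝ, E₁) f p)
    (hg : MDifferentiableAt 𝓘(ℝ, Q) 𝓘(ℝ, E₁) g p)
    (h : ∀ᶠ q in 𝓝 p, 𝓔.t (f q) = 𝓔.s (g q)) (v : Q) :
    tmap Q E₁ (fun q => 𝓔.total.mul (f q) (g q)) p v =
      𝓔.tmulE (f p) (g p) (tmap Q E₁ f p v, tmap Q E₁ g p v) := by
  have h1 := ((𝓔.total.contMDiffOn_mul (f p, g p) h.self_of_nhds).mdifferentiableWithinAt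
    (by simp)).hasMFDerivWithinAt
  have h2 : HasMFDerivAt 𝓘(ℝ, Q) (𝓘(ℝ, E₁).prod 𝓘(ℝ, E₁)) (fun q => (f q, g q)) p _ :=
    hf.hasMFDerivAt.prodMk hg.hasMFDerivAt
  have h3 := h1.comp p (h2.hasMFDerivWithinAt (s := {q | 𝓔.t (f q) = 𝓔.s (g q)}))
    (show {q | 𝓔.t (f q) = 𝓔.s (g q)} ⊆ (fun q => (f q, g q)) ⁻¹' {p | 𝓔.t p.1 = 𝓔.s p.2} from
      fun q hq => hq)
  exact congrArg (fun L : Q →L[ℝ] E₁ => L v) (h3.hasMFDerivAt h).mfderiv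

theorem tmap_fund {g : P → X} {p : P} (hg : MDifferentiableAt 𝓘(ℝ, Q) 𝓘(ℝ, E₁) g p) (x : X)
    (h0 : g p = 𝓔.e (𝓔.t x)) (h : ∀ᶠ q in 𝓝 p, g q ∈ 𝓔.ker (𝓔.t x)) (v : Q) :
    tmap Q E₁ (fun q => 𝓔.total.mul x (g q)) p v = 𝓔.fundE x (tmap Q E₁ g p v) := by
  have h1 : ContMDiffWithinAt 𝓘(ℝ, E₁) 𝓘(ℝ, E₁) ∞ (fun g => 𝓔.total.mul x g) (𝓔.ker (𝓔.t x))
      (g p) := by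
    refine ContMDiffWithinAt.comp (g p) (𝓔.total.contMDiffOn_mul (x, g p) ?_)
      (f := fun g => (x, g)) ?_ ?_
    · exact (s_of_mem_ker h.self_of_nhds).symm
    · exact contMDiffWithinAt_const.prodMk contMDiffWithinAt_id
    · exact fun k hk => (s_of_mem_ker hk).symm
  have h2 := tmap_comp_within (h1.mdifferentiableWithinAt (by simp))
    hg h
  rw [h2, h0]
  rfl

theorem tmap_conj {g : P → X} {p : P} (hg : MDifferentiableAt 𝓘(ℝ, Q) 𝓘(ℝ, E₁) g p) (x : X)
    (h0 : g p = 𝓔.e (𝓔.t x)) (h : ∀ᶠ q in 𝓝 p, g q ∈ 𝓔.ker (𝓔.t x)) (v : Q) :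
    tmap Q E₁ (fun q => 𝓔.total.mul (𝓔.total.mul x (g q)) (𝓔.total.inv x)) p v =
      (𝓔.Ad x : E₁ →L[ℝ] E₁) (tmap Q E₁ g p v) := by
  have hs : ∀ k ∈ 𝓔.ker (𝓔.t x), 𝓔.total.tgt x = 𝓔.total.src k :=
    fun k hk => (s_of_mem_ker hk).symm
  have h1 : ContMDiffWithinAt 𝓘(ℝ, E₁) 𝓘(ℝ, E₁) ∞ (fun g => 𝓔.total.mul x g) (𝓔.ker (𝓔.t x))
      (g p) := by
    refine ContMDiffWithinAt.comp (g p) (𝓔.total.contMDiffOn_mul (x, g p) ?_)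
      (f := fun g => (x, g)) ?_ ?_
    · exact hs _ h.self_of_nhds
    · exact contMDiffWithinAt_const.prodMk contMDiffWithinAt_id
    · exact hs
  have ht : ∀ k ∈ 𝓔.ker (𝓔.t x), 𝓔.total.tgt (𝓔.total.mul x k) = 𝓔.total.src (𝓔.total.inv x) :=
    fun k hk => by
      rw [𝓔.total.tgt_mul _ _ (hs k hk), 𝓔.total.src_inv]
      exact t_of_mem_ker hk
  have h1' : ContMDiffWithinAt 𝓘(ℝ, E₁) 𝓘(ℝ, E₁) ∞
      (fun g => 𝓔.total.mul (𝓔.total.mul x g) (𝓔.total.inv x)) (𝓔.ker (𝓔.t x)) (g p) := by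
    refine ContMDiffWithinAt.comp (g p)
      (𝓔.total.contMDiffOn_mul (𝓔.total.mul x (g p), 𝓔.total.inv x) ?_)
      (f := fun g => (𝓔.total.mul x g, 𝓔.total.inv x)) ?_ ?_
    · exact ht _ h.self_of_nhds
    · exact h1.prodMk contMDiffWithinAt_const
    · exact ht
  have h2 := tmap_comp_within (h1'.mdifferentiableWithinAt (by simp))
    hg h
  rw [h2, h0]
  rfl

theorem tmap_inv_conj {g : P → X} {p : P} (hg : MDifferentiableAt 𝓘(ℝ, Q) 𝓘(ℝ, E₁) g p) (x : X)
    (h0 : g p = 𝓔.e (𝓔.s x)) (h : ∀ᶠ q in 𝓝 p, g q ∈ 𝓔.ker (𝓔.s x)) (v : Q) :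
    tmap Q E₁ (fun q => 𝓔.total.mul (𝓔.total.mul (𝓔.total.inv x) (g q)) x) p v =
      𝓔.adI x (tmap Q E₁ g p v) := by
  have h1 := 𝓔.tmap_conj hg (𝓔.total.inv x) (by rw [h0, t_inv])
    (by rwa [t_inv]) v
  rw [𝓔.total.inv_inv] at h1
  exact h1

end LieGroupoidExtension

/-! ### Vertical translations, and curves and families in the kernel. -/

/-- Move `x` by `w` in the chart, then return to the fibre over `f x` by the family `L` of local
sections. To first order the return leaves vertical vectors unchanged, so each of them is the
velocity of a motion inside the fibre. Applied to `φ`, this takes the place of the exponential maps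
of the kernel. -/
theorem Manifold.IsSubmersion.exists_vertical_translation {F N F' N' : Type*}
    [NormedAddCommGroup F] [NormedSpace ℝ F] [TopologicalSpace N] [ChartedSpace F N]
    [NormedAddCommGroup F'] [NormedSpace ℝ F'] [TopologicalSpace N'] [ChartedSpace F' N']
    [IsManifold 𝓘(ℝ, F) ∞ N] [IsManifold 𝓘(ℝ, F') ∞ N']
    {f : N → N'} (hf : Manifold.IsSubmersion 𝓘(ℝ, F) 𝓘(ℝ, F') ∞ f) (x₀ : N) :
    ∃ V : N × F → N,
      ContMDiffAt (𝓘(ℝ, F).prod 𝓘(ℝ, F)) 𝓘(ℝ, F) ∞ V (x₀, 0) ∧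
      (∀ᶠ p in 𝓝 (x₀, 0), f (V p) = f p.1) ∧ (∀ᶠ x in 𝓝 x₀, V (x, 0) = x) ∧
      ∀ᶠ x in 𝓝 x₀, MDifferentiableAt 𝓘(ℝ, F) 𝓘(ℝ, F) (fun w => V (x, w)) 0 ∧
        ∀ v, tmap F F' f x v = 0 → tmap F F (fun w => V (x, w)) 0 (dchart F x₀ x v) = v := by
  obtain ⟨L, hL, hfL, hLf⟩ := hf.exists_section_family x₀
  have hfs := hf.contMDiff
  have hx₀ := mem_dom_self (F := F) x₀
  let A : N × F → N' × N := fun p => (f p.1, param F x₀ (chart F x₀ p.1 + p.2))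
  have hA0 : ∀ x ∈ dom F x₀, A (x, 0) = (f x, x) := fun x hx => by
    simp only [A, add_zero, param_chart hx]
  have hA : ContMDiffAt (𝓘(ℝ, F).prod 𝓘(ℝ, F)) (𝓘(ℝ, F').prod 𝓘(ℝ, F)) ∞ A (x₀, 0) := by
    refine ContMDiffAt.prodMk ?_ ?_
    · exact ContMDiffAt.comp (x₀, (0 : F)) (g := f) (hfs x₀) contMDiffAt_fst
    · refine ContMDiffAt.comp (x₀, (0 : F)) (g := param F x₀) (I' := 𝓘(ℝ, F))
        (f := fun p : N × F => chart F x₀ p.1 + p.2) ?_ ?_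
      · simp only [add_zero]
        exact contMDiffAt_param hx₀
      · have h1 : ContMDiffAt (𝓘(ℝ, F).prod 𝓘(ℝ, F)) 𝓘(ℝ, F) ∞
            (fun p : N × F => chart F x₀ p.1) (x₀, 0) :=
          ContMDiffAt.comp (x₀, (0 : F)) (g := chart F x₀) (contMDiffAt_chart hx₀) contMDiffAt_fst
        have h2 : ContMDiffAt (𝓘(ℝ, F).prod 𝓘(ℝ, F)) 𝓘(ℝ, F) ∞
            (fun p : N × F => p.2) (x₀, 0) := contMDiffAt_snd
        exact (ContinuousLinearMap.fst ℝ F F + ContinuousLinearMap.snd ℝ F F).contDiff.comp_contMDiffAt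
          (h1.prodMk_space h2)
  have hAt : Filter.Tendsto A (𝓝 (x₀, 0)) (𝓝 (f x₀, x₀)) := by
    have := hA.continuousAt.tendsto
    rwa [hA0 x₀ hx₀] at this
  refine ⟨fun p => L (A p), ?_, ?_, ?_, ?_⟩
  · refine ContMDiffAt.comp (x₀, (0 : F)) (g := L) ?_ hA
    rw [hA0 x₀ hx₀]
    exact hL
  · exact hAt.eventually hfL
  · filter_upwards [hLf, (isOpen_dom x₀).mem_nhds hx₀] with x h1 h2
    rw [hA0 x h2, h1]
  · have hL1 : ∀ᶠ p in 𝓝 (f x₀, x₀), MDifferentiableAt (𝓘(ℝ, F').prod 𝓘(ℝ, F)) 𝓘(ℝ, F) L p := by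
      have h1 : ContMDiffAt (𝓘(ℝ, F').prod 𝓘(ℝ, F)) 𝓘(ℝ, F) 1 L (f x₀, x₀) := hL.of_le (by simp)
      filter_upwards [(contMDiffAt_iff_contMDiffAt_nhds (by simp)).1 h1] with p hp
      exact hp.mdifferentiableAt (by simp)
    have hg : Filter.Tendsto (fun x => (f x, x)) (𝓝 x₀) (𝓝 (f x₀, x₀)) :=
      ((hfs x₀).continuousAt.prodMk continuousAt_id).tendsto
    filter_upwards [hg.eventually hL1, hLf.eventually_nhds, (isOpen_dom x₀).mem_nhds hx₀]
      with x h1 h2 h3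
    have hc : MDifferentiableAt 𝓘(ℝ, F) 𝓘(ℝ, F) (fun w => param F x₀ (chart F x₀ x + w)) 0 := by
      refine MDifferentiableAt.comp (0 : F) (g := param F x₀) (I' := 𝓘(ℝ, F))
        (f := fun w => chart F x₀ x + w) ?_ ?_
      · rw [add_zero]; exact mdiff_param h3
      · exact mdifferentiableAt_iff_differentiableAt.2
          ((differentiableAt_const _).add differentiableAt_id)
    have hc0 : param F x₀ (chart F x₀ x + 0) = x := by rw [add_zero, param_chart h3]
    have hcd : tmap F F (fun w => param F x₀ (chart F x₀ x + w)) 0 = dparam F x₀ x := by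
      have := tmap_comp (F := F) (F' := F) (F'' := F) (g := param F x₀)
        (f := fun w => chart F x₀ x + w) (x := 0)
        (by rw [add_zero]; exact mdiff_param h3)
        (mdifferentiableAt_iff_differentiableAt.2
          ((differentiableAt_const _).add differentiableAt_id))
      rw [this, tmap_eq_fderiv, fderiv_const_add, fderiv_fun_id, add_zero]
      rfl
    have e1 : MDifferentiableAt 𝓘(ℝ, F) 𝓘(ℝ, F) (fun w => L (A (x, w))) 0 := by
      refine MDifferentiableAt.comp (0 : F) (g := L) (I' := 𝓘(ℝ, F').prod 𝓘(ℝ, F)) ?_ ?_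
      · simp only [A, hc0]; exact h1
      · exact (mdifferentiableAt_const (c := f x)).prodMk hc
    refine ⟨e1, fun v hv => ?_⟩
    -- derivative of `L` on `(f x, x)`
    have hLx := (h1 : MDifferentiableAt _ _ L (f x, x)).hasMFDerivAt
    have d1 : HasMFDerivAt 𝓘(ℝ, F) 𝓘(ℝ, F) (fun y => L (f y, y)) x _ :=
      HasMFDerivAt.comp x hLx (((hfs x).mdifferentiableAt (by simp)).hasMFDerivAt.prodMk
        (hasMFDerivAt_id x))
    have d2 : HasMFDerivAt 𝓘(ℝ, F) 𝓘(ℝ, F) (fun y => L (f y, y)) x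
        (ContinuousLinearMap.id ℝ F) :=
      (hasMFDerivAt_id x).congr_of_eventuallyEq h2
    -- Differentiating `L (f y, y) = y` gives `v = dL (df v, v)`, which is `dL (0, v)` for vertical
    -- `v`.
    have hid : ContinuousLinearMap.id ℝ F = _ := hasMFDerivAt_unique d2 d1
    have hcm := hc.hasMFDerivAt
    have hL' : HasMFDerivAt (𝓘(ℝ, F').prod 𝓘(ℝ, F)) 𝓘(ℝ, F) L
        ((fun w => ((f x, param F x₀ (chart F x₀ x + w)) : N' × N)) 0)
        (mfderiv (𝓘(ℝ, F').prod 𝓘(ℝ, F)) 𝓘(ℝ, F) L (f x, x)) := by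
      change HasMFDerivAt _ _ L (f x, param F x₀ (chart F x₀ x + 0)) _
      rw [hc0]
      exact hLx
    have d3 : HasMFDerivAt 𝓘(ℝ, F) 𝓘(ℝ, F) (fun w => L (A (x, w))) 0 _ :=
      HasMFDerivAt.comp (0 : F) hL' ((hasMFDerivAt_const (f x) (0 : F)).prodMk hcm)
    have e3 : tmap F F (fun w => L (A (x, w))) 0 = _ := d3.mfderiv
    have e4 : tmap F F (fun w => L (A (x, w))) 0 (dchart F x₀ x v) =
        (mfderiv (𝓘(ℝ, F').prod 𝓘(ℝ, F)) 𝓘(ℝ, F) L (f x, x) : F' × F →L[ℝ] F)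
          ((0 : F'), tmap F F (fun w => param F x₀ (chart F x₀ x + w)) 0 (dchart F x₀ x v)) :=
      congrArg (fun T : F →L[ℝ] F => T (dchart F x₀ x v)) e3
    have e5 : v = (mfderiv (𝓘(ℝ, F').prod 𝓘(ℝ, F)) 𝓘(ℝ, F) L (f x, x) : F' × F →L[ℝ] F)
        (tmap F F' f x v, v) := congrArg (fun T : F →L[ℝ] F => T v) hid
    rw [e4, hcd, dparam_dchart h3, ← hv]
    exact e5.symm

namespace LieGroupoidExtension

variable {E₀ E₁ E₂ M X Y : Type*}
  [NormedAddCommGroup E₀] [NormedSpace ℝ E₀] [NormedAddCommGroup E₁] [NormedSpace ℝ E₁]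
  [NormedAddCommGroup E₂] [NormedSpace ℝ E₂]
  [TopologicalSpace M] [ChartedSpace E₀ M] [TopologicalSpace X] [ChartedSpace E₁ X]
  [TopologicalSpace Y] [ChartedSpace E₂ Y]
  (𝓔 : LieGroupoidExtension E₀ E₁ E₂ M X Y)

/-- A smooth family `k (r, τ)` in `ker (γ τ)` which starts at the unit `k (0, τ) = e (γ τ)` with
velocity `∂_r k (0, τ) = σ τ`. -/
structure KerFamily (γ : ℝ → M) (σ : ℝ → E₁) (k : ℝ × ℝ → X) : Prop where
  smooth : ContMDiffAt 𝓘(ℝ, ℝ × ℝ) 𝓘(ℝ, E₁) ∞ k (0, 0)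
  mem : ∀ᶠ p in 𝓝 (0 : ℝ × ℝ), k p ∈ 𝓔.ker (γ p.2)
  unit : ∀ᶠ τ in 𝓝 (0 : ℝ), k (0, τ) = 𝓔.e (γ τ)
  vel : ∀ᶠ τ in 𝓝 (0 : ℝ), tmap ℝ E₁ (fun r : ℝ => k (r, τ)) 0 1 = σ τ

variable {𝓔} [IsManifold 𝓘(ℝ, E₀) ∞ M] [IsManifold 𝓘(ℝ, E₁) ∞ X] [IsManifold 𝓘(ℝ, E₂) ∞ Y]

/-- The family is `V (e (γ τ), r w(τ))`, where `w(τ)` are the coordinates of `σ τ`: the units are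
translated vertically along straight lines. Without such families the condition `HasCovDerivAt`
would be vacuous. -/
theorem exists_kerFamily {γ : ℝ → M} (hγ : ContMDiffAt 𝓘(ℝ, ℝ) 𝓘(ℝ, E₀) ∞ γ 0) {σ : ℝ → E₁}
    (hσK : ∀ᶠ τ in 𝓝 0, σ τ ∈ 𝓔.K (γ τ))
    (hσ : ContDiffAt ℝ ∞ (fun τ => dchart E₁ (𝓔.e (γ 0)) (𝓔.e (γ τ)) (σ τ)) 0) :
    ∃ k, 𝓔.KerFamily γ σ k := by
  obtain ⟨V, hV, hφV, hV0, hVd⟩ := 𝓔.isSubmersion_φ.exists_vertical_translation (𝓔.e (γ 0))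
  set w : ℝ → E₁ := fun τ => dchart E₁ (𝓔.e (γ 0)) (𝓔.e (γ τ)) (σ τ) with hw
  have hsnd : ContMDiffAt 𝓘(ℝ, ℝ × ℝ) 𝓘(ℝ, ℝ) ∞ (Prod.snd : ℝ × ℝ → ℝ) (0, 0) :=
    contMDiffAt_iff_contDiffAt.2 contDiffAt_snd
  have heγ0 : ContMDiffAt 𝓘(ℝ, ℝ) 𝓘(ℝ, E₁) ∞ (fun τ => 𝓔.e (γ τ)) 0 :=
    ContMDiffAt.comp (0 : ℝ) (g := 𝓔.e) (𝓔.contMDiff_e _) hγ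
  let A : ℝ × ℝ → X × E₁ := fun p => (𝓔.e (γ p.2), p.1 • w p.2)
  have hA : ContMDiffAt 𝓘(ℝ, ℝ × ℝ) (𝓘(ℝ, E₁).prod 𝓘(ℝ, E₁)) ∞ A (0, 0) := by
    refine ContMDiffAt.prodMk ?_ ?_
    · exact ContMDiffAt.comp ((0 : ℝ), (0 : ℝ)) (g := fun τ => 𝓔.e (γ τ)) heγ0 hsnd
    · refine contMDiffAt_iff_contDiffAt.2 (contDiffAt_fst.smul ?_)
      exact ContDiffAt.comp ((0 : ℝ), (0 : ℝ)) (g := w) hσ contDiffAt_snd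
  have hA0 : ∀ τ, A (0, τ) = (𝓔.e (γ τ), 0) := fun τ => by simp [A]
  have hAt : Filter.Tendsto A (𝓝 (0, 0)) (𝓝 (𝓔.e (γ 0), 0)) := by
    have := hA.continuousAt.tendsto
    rwa [hA0] at this
  have het : Filter.Tendsto (fun τ => 𝓔.e (γ τ)) (𝓝 0) (𝓝 (𝓔.e (γ 0))) := heγ0.continuousAt.tendsto
  refine ⟨fun p => V (A p), ?_, ?_, ?_, ?_⟩
  · refine ContMDiffAt.comp ((0 : ℝ), (0 : ℝ)) (g := V) ?_ hA
    rw [hA0]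
    exact hV
  · filter_upwards [hAt.eventually hφV] with p hp
    change 𝓔.φ _ = _
    rw [hp, 𝓔.φ_one]
  · filter_upwards [het.eventually hV0] with τ h1
    rw [hA0, h1]
  · filter_upwards [het.eventually hVd, hσK] with τ h1 h2
    have h3 := tmap_comp (F := ℝ) (F' := E₁) (F'' := E₁) (g := fun w => V (𝓔.e (γ τ), w))
      (f := fun r : ℝ => r • w τ) (x := 0) (by rw [zero_smul]; exact h1.1)
      (mdifferentiableAt_iff_differentiableAt.2 (differentiableAt_id.smul_const _))
    have h4 : fderiv ℝ (fun r : ℝ => r • w τ) 0 1 = w τ := by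
      have : HasDerivAt (fun r : ℝ => r • w τ) ((1 : ℝ) • w τ) 0 := (hasDerivAt_id 0).smul_const _
      rw [fderiv_apply_one_eq_deriv, this.deriv, one_smul]
    change tmap ℝ E₁ (fun r : ℝ => V (𝓔.e (γ τ), r • w τ)) 0 1 = σ τ
    rw [h3, ContinuousLinearMap.comp_apply, tmap_eq_fderiv, h4, zero_smul]
    exact h1.2 _ h2

theorem KerFamily.contMDiffAt_fst {γ : ℝ → M} {σ : ℝ → E₁} {k : ℝ × ℝ → X}
    (h : 𝓔.KerFamily γ σ k) : ContMDiffAt 𝓘(ℝ, ℝ) 𝓘(ℝ, E₁) ∞ (fun r : ℝ => k (r, 0)) 0 :=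
  ContMDiffAt.comp (0 : ℝ) (g := k) (f := fun r : ℝ => (r, (0 : ℝ))) h.smooth
    (contMDiffAt_iff_contDiffAt.2 (contDiffAt_id.prodMk contDiffAt_const))

/-- Identities for `fund`, `Ad` and the bracket are proved by writing `ξ` as such a velocity, since
these operators are only controlled along curves in the kernel. -/
theorem exists_ker_curve {m : M} {ξ : E₁} (hξ : ξ ∈ 𝓔.K m) : ∃ k : ℝ → X,
    ContMDiffAt 𝓘(ℝ, ℝ) 𝓘(ℝ, E₁) ∞ k 0 ∧ k 0 = 𝓔.e m ∧ (∀ᶠ r in 𝓝 0, k r ∈ 𝓔.ker m) ∧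
      tmap ℝ E₁ k 0 1 = ξ := by
  obtain ⟨k, hk⟩ := exists_kerFamily (𝓔 := 𝓔) (γ := fun _ => m) contMDiffAt_const (σ := fun _ => ξ)
    (Filter.Eventually.of_forall fun _ => hξ) contDiffAt_const
  refine ⟨fun r => k (r, 0), hk.contMDiffAt_fst, hk.unit.self_of_nhds, ?_, hk.vel.self_of_nhds⟩
  have : Filter.Tendsto (fun r : ℝ => (r, (0 : ℝ))) (𝓝 0) (𝓝 0) :=
    (continuous_id.prodMk continuous_const).tendsto' _ _ rfl
  exact this.eventually hk.mem

end LieGroupoidExtension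

/-! ### Forms in coordinates, and their values on two-parameter families. -/

theorem minSmoothness_two_le_infty : minSmoothness ℝ 2 ≤ (∞ : WithTop ℕ∞) := by
  rw [minSmoothness_of_isRCLikeNormedField]
  exact WithTop.coe_le_coe.2 (le_top : (2 : ℕ∞) ≤ ⊤)

theorem contDiffAt_partial_apply {P F : Type*} [NormedAddCommGroup P] [NormedSpace ℝ P]
    [NormedAddCommGroup F] [NormedSpace ℝ F]
    {f : P → F} {p : P} (hf : ContDiffAt ℝ ∞ f p) (v : P) :
    ContDiffAt ℝ ∞ (fun q => fderiv ℝ f q v) p :=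
  (hf.fderiv_right (m := ∞) (by simp)).clm_apply contDiffAt_const

/-- The common term `c` is `a` applied to the mixed second derivative of `f`, which is symmetric.
The difference of the two formulas is therefore the exterior derivative of `a`. -/
theorem hasDerivAt_symmetric_part {E F : Type*} [NormedAddCommGroup E] [NormedSpace ℝ E]
    [NormedAddCommGroup F] [NormedSpace ℝ F] {a : E → E →L[ℝ] F} {f : ℝ × ℝ → E}
    (hf : ContDiffAt ℝ ∞ f (0, 0)) (ha : DifferentiableAt ℝ a (f (0, 0))) :
    ∃ c : F,
      HasDerivAt (fun r : ℝ => a (f (r, 0)) (fderiv ℝ f (r, 0) (0, 1)))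
        (c + fderiv ℝ a (f (0, 0)) (fderiv ℝ f (0, 0) (1, 0)) (fderiv ℝ f (0, 0) (0, 1))) 0 ∧
      HasDerivAt (fun τ : ℝ => a (f (0, τ)) (fderiv ℝ f (0, τ) (1, 0)))
        (c + fderiv ℝ a (f (0, 0)) (fderiv ℝ f (0, 0) (0, 1)) (fderiv ℝ f (0, 0) (1, 0))) 0 := by
  have hsymm : IsSymmSndFDerivAt ℝ f (0, 0) := hf.isSymmSndFDerivAt minSmoothness_two_le_infty
  have hd : HasFDerivAt f (fderiv ℝ f (0, 0)) ((0 : ℝ), (0 : ℝ)) :=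
    (hf.differentiableAt (by simp)).hasFDerivAt
  have hd2 : HasFDerivAt (fderiv ℝ f) (fderiv ℝ (fderiv ℝ f) (0, 0)) ((0 : ℝ), (0 : ℝ)) :=
    ((hf.fderiv_right (m := ∞) (by simp)).differentiableAt (by simp)).hasFDerivAt
  have hl : HasDerivAt (fun r : ℝ => (r, (0 : ℝ))) (1, 0) 0 :=
    (hasDerivAt_id 0).prodMk (hasDerivAt_const _ _)
  have hr : HasDerivAt (fun r : ℝ => ((0 : ℝ), r)) (0, 1) 0 :=
    (hasDerivAt_const _ _).prodMk (hasDerivAt_id 0)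
  have ha' := ha.hasFDerivAt
  refine ⟨a (f (0, 0)) (fderiv ℝ (fderiv ℝ f) (0, 0) (1, 0) (0, 1)), ?_, ?_⟩
  · have e1 : HasDerivAt (fun r : ℝ => a (f (r, 0))) _ 0 :=
      ha'.comp_hasDerivAt (0 : ℝ) (f := fun r : ℝ => f (r, 0))
        (hd.comp_hasDerivAt (0 : ℝ) (f := fun r : ℝ => (r, (0 : ℝ))) hl)
    have e2 : HasDerivAt (fun r : ℝ => fderiv ℝ f (r, 0)) _ 0 :=
      hd2.comp_hasDerivAt (0 : ℝ) (f := fun r : ℝ => (r, (0 : ℝ))) hl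
    convert e1.clm_apply (e2.clm_apply (hasDerivAt_const (0 : ℝ) ((0 : ℝ), (1 : ℝ)))) using 1
    simp [add_comm]
  · have e1 : HasDerivAt (fun r : ℝ => a (f (0, r))) _ 0 :=
      ha'.comp_hasDerivAt (0 : ℝ) (f := fun r : ℝ => f (0, r))
        (hd.comp_hasDerivAt (0 : ℝ) (f := fun r : ℝ => ((0 : ℝ), r)) hr)
    have e2 : HasDerivAt (fun r : ℝ => fderiv ℝ f (0, r)) _ 0 :=
      hd2.comp_hasDerivAt (0 : ℝ) (f := fun r : ℝ => ((0 : ℝ), r)) hr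
    rw [hsymm.eq]
    convert e1.clm_apply (e2.clm_apply (hasDerivAt_const (0 : ℝ) ((1 : ℝ), (0 : ℝ)))) using 1
    simp [add_comm]

theorem tmap_left_curve {F N : Type*} [NormedAddCommGroup F] [NormedSpace ℝ F] [TopologicalSpace N]
    [ChartedSpace F N] {f : ℝ × ℝ → N} {r τ : ℝ}
    (hf : MDifferentiableAt 𝓘(ℝ, ℝ × ℝ) 𝓘(ℝ, F) f (r, τ)) :
    tmap ℝ F (fun r' : ℝ => f (r', τ)) r 1 = tmap (ℝ × ℝ) F f (r, τ) (1, 0) := by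
  have hl : HasDerivAt (fun r : ℝ => (r, τ)) (1, 0) r :=
    (hasDerivAt_id r).prodMk (hasDerivAt_const _ _)
  have := tmap_comp (F := ℝ) (F' := ℝ × ℝ) (F'' := F) (g := f) (f := fun r : ℝ => (r, τ)) (x := r) hf
    (mdifferentiableAt_iff_differentiableAt.2 hl.differentiableAt)
  rw [this, ContinuousLinearMap.comp_apply, tmap_eq_fderiv, fderiv_apply_one_eq_deriv, hl.deriv]

theorem tmap_right_curve {F N : Type*} [NormedAddCommGroup F] [NormedSpace ℝ F] [TopologicalSpace N]
    [ChartedSpace F N] {f : ℝ × ℝ → N} {r τ : ℝ}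
    (hf : MDifferentiableAt 𝓘(ℝ, ℝ × ℝ) 𝓘(ℝ, F) f (r, τ)) :
    tmap ℝ F (fun τ' : ℝ => f (r, τ')) τ 1 = tmap (ℝ × ℝ) F f (r, τ) (0, 1) := by
  have hl : HasDerivAt (fun τ : ℝ => (r, τ)) (0, 1) τ :=
    (hasDerivAt_const _ _).prodMk (hasDerivAt_id τ)
  have := tmap_comp (F := ℝ) (F' := ℝ × ℝ) (F'' := F) (g := f) (f := fun τ : ℝ => (r, τ)) (x := τ) hf
    (mdifferentiableAt_iff_differentiableAt.2 hl.differentiableAt)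
  rw [this, ContinuousLinearMap.comp_apply, tmap_eq_fderiv, fderiv_apply_one_eq_deriv, hl.deriv]

namespace LieGroupoidExtension

variable {E₀ E₁ E₂ M X Y : Type*}
  [NormedAddCommGroup E₀] [NormedSpace ℝ E₀] [NormedAddCommGroup E₁] [NormedSpace ℝ E₁]
  [NormedAddCommGroup E₂] [NormedSpace ℝ E₂]
  [TopologicalSpace M] [ChartedSpace E₀ M] [TopologicalSpace X] [ChartedSpace E₁ X]
  [TopologicalSpace Y] [ChartedSpace E₂ Y]
  {𝓔 : LieGroupoidExtension E₀ E₁ E₂ M X Y}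
  [IsManifold 𝓘(ℝ, E₀) ∞ M] [IsManifold 𝓘(ℝ, E₁) ∞ X] [IsManifold 𝓘(ℝ, E₂) ∞ Y]

theorem tmap_φ_eq_zero {P : Type*} [NormedAddCommGroup P] [NormedSpace ℝ P] {g : P → X} {p : P}
    (hg : MDifferentiableAt 𝓘(ℝ, P) 𝓘(ℝ, E₁) g p) {m : M} (h : ∀ᶠ q in 𝓝 p, g q ∈ 𝓔.ker m) (v : P) :
    tmap E₁ E₂ 𝓔.φ (g p) (tmap P E₁ g p v) = 0 := by
  have h1 := tmap_comp (F := P) (F' := E₁) (F'' := E₂) (g := 𝓔.φ) (f := g) (x := p)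
    ((𝓔.contMDiff_φ _).mdifferentiableAt (by simp)) hg
  have h2 : tmap P E₂ (fun q => 𝓔.φ (g q)) p = tmap P E₂ (fun _ => 𝓔.quot.one m) p := tmap_congr h
  have h3 : tmap P E₂ (fun _ : P => 𝓔.quot.one m) p = 0 := mfderiv_const
  rw [h2, h3] at h1
  exact (congrArg (fun L : P →L[ℝ] E₂ => L v) h1).symm

theorem KerFamily.mem_K {γ : ℝ → M} {σ : ℝ → E₁} {k : ℝ × ℝ → X} (h : 𝓔.KerFamily γ σ k) :
    ∀ᶠ τ in 𝓝 0, σ τ ∈ 𝓔.K (γ τ) := by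
  have h0 : Filter.Tendsto (fun τ : ℝ => ((0 : ℝ), τ)) (𝓝 0) (𝓝 (0, 0)) :=
    (continuous_const.prodMk continuous_id).tendsto' _ _ rfl
  have h1 : ContMDiffAt 𝓘(ℝ, ℝ × ℝ) 𝓘(ℝ, E₁) 1 k (0, 0) := h.smooth.of_le (by simp)
  filter_upwards [h0.eventually ((contMDiffAt_iff_contMDiffAt_nhds (by simp)).1 h1),
    h0.eventually h.mem.eventually_nhds, h.unit, h.vel] with τ h1 h2 h3 h4
  have hk : ContMDiffAt 𝓘(ℝ, ℝ) 𝓘(ℝ, E₁) 1 (fun r : ℝ => k (r, τ)) 0 :=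
    ContMDiffAt.comp (0 : ℝ) (g := k) (f := fun r : ℝ => (r, τ)) h1
      (contMDiffAt_iff_contDiffAt.2 (contDiffAt_id.prodMk contDiffAt_const))
  have h5 : Filter.Tendsto (fun r : ℝ => (r, τ)) (𝓝 0) (𝓝 (0, τ)) :=
    (continuous_id.prodMk continuous_const).tendsto' _ _ rfl
  have := tmap_φ_eq_zero (𝓔 := 𝓔) (m := γ τ) (hk.mdifferentiableAt (by simp)) (h5.eventually h2) 1
  rw [h4, h3] at this
  exact this

theorem KerFamily.contMDiffAt_base {γ : ℝ → M} {σ : ℝ → E₁} {k : ℝ × ℝ → X}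
    (h : 𝓔.KerFamily γ σ k) : ContMDiffAt 𝓘(ℝ, ℝ) 𝓘(ℝ, E₀) ∞ γ 0 := by
  have hk : ContMDiffAt 𝓘(ℝ, ℝ) 𝓘(ℝ, E₀) ∞ (fun τ : ℝ => 𝓔.t (k (0, τ))) 0 :=
    ContMDiffAt.comp (0 : ℝ) (g := 𝓔.t) (𝓔.contMDiff_t _)
      (ContMDiffAt.comp (0 : ℝ) (g := k) (f := fun τ : ℝ => ((0 : ℝ), τ)) h.smooth
      (contMDiffAt_iff_contDiffAt.2 (contDiffAt_const.prodMk contDiffAt_id)))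
  refine hk.congr_of_eventuallyEq ?_
  filter_upwards [h.unit] with τ hτ
  rw [hτ, t_e]

theorem KerFamily.contDiffAt_section {γ : ℝ → M} {σ : ℝ → E₁} {k : ℝ × ℝ → X}
    (h : 𝓔.KerFamily γ σ k) {x₀ : X} (hm : 𝓔.e (γ 0) ∈ dom E₁ x₀) :
    ContDiffAt ℝ ∞ (fun τ => dchart E₁ x₀ (𝓔.e (γ τ)) (σ τ)) 0 := by
  have h00 : k (0, 0) = 𝓔.e (γ 0) := h.unit.self_of_nhds
  have hk : ContDiffAt ℝ ∞ (fun p => chart E₁ x₀ (k p)) (0, 0) :=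
    contMDiffAt_iff_contDiffAt.1 (ContMDiffAt.comp ((0 : ℝ), (0 : ℝ)) (g := chart E₁ x₀)
      (contMDiffAt_chart (by rw [h00]; exact hm)) h.smooth)
  have h1 : ContDiffAt ℝ ∞ (fun τ : ℝ => fderiv ℝ (fun p => chart E₁ x₀ (k p)) (0, τ) (1, 0)) 0 :=
    ContDiffAt.comp (0 : ℝ) (g := fun p => fderiv ℝ (fun p => chart E₁ x₀ (k p)) p (1, 0))
      (f := fun τ : ℝ => ((0 : ℝ), τ)) (contDiffAt_partial_apply hk _)
      (contDiffAt_const.prodMk contDiffAt_id)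
  refine h1.congr_of_eventuallyEq ?_
  have h0 : Filter.Tendsto (fun τ : ℝ => ((0 : ℝ), τ)) (𝓝 0) (𝓝 (0, 0)) :=
    (continuous_const.prodMk continuous_id).tendsto' _ _ rfl
  have h1 : ContMDiffAt 𝓘(ℝ, ℝ × ℝ) 𝓘(ℝ, E₁) 1 k (0, 0) := h.smooth.of_le (by simp)
  have h2 : ∀ᶠ p in 𝓝 ((0 : ℝ), (0 : ℝ)), k p ∈ dom E₁ x₀ :=
    h.smooth.continuousAt.preimage_mem_nhds (by rw [h00]; exact (isOpen_dom x₀).mem_nhds hm)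
  filter_upwards [h0.eventually ((contMDiffAt_iff_contMDiffAt_nhds (by simp)).1 h1),
    h0.eventually h2, h.unit, h.vel] with τ h1 h2 h3 h4
  have h5 := h1.mdifferentiableAt (by simp)
  rw [(hasFDerivAt_chart_comp h5 h2).fderiv, ContinuousLinearMap.comp_apply,
    ← tmap_left_curve h5, h4, h3]

/-- The values of a form, on the model spaces. -/
def Form.valE {F N : Type*} [NormedAddCommGroup F] [NormedSpace ℝ F] [TopologicalSpace N]
    [ChartedSpace F N] [IsManifold 𝓘(ℝ, F) ∞ N] {f : N → M} {k : ℕ} (η : 𝓔.Form F f k) (n : N) :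
    F [⋀^Fin k]→L[ℝ] E₁ := η.val n

/-- The expression of a form in the chart at `n₀` and the chart at `e m₀`. -/
def Form.loc {F N : Type*} [NormedAddCommGroup F] [NormedSpace ℝ F] [TopologicalSpace N]
    [ChartedSpace F N] [IsManifold 𝓘(ℝ, F) ∞ N] {f : N → M} {k : ℕ} (η : 𝓔.Form F f k) (n₀ : N)
    (m₀ : M) (q : F) : F [⋀^Fin k]→L[ℝ] E₁ :=
  (dchart E₁ (𝓔.e m₀) (𝓔.e (f (param F n₀ q)))).compContinuousAlternatingMap
    ((η.valE (param F n₀ q)).compContinuousLinearMap (dparam F n₀ (param F n₀ q)))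

theorem smoothFieldAt_dparam {F N : Type*} [NormedAddCommGroup F] [NormedSpace ℝ F]
    [TopologicalSpace N] [ChartedSpace F N] [IsManifold 𝓘(ℝ, F) ∞ N] {n₀ n : N} (hn : n ∈ dom F n₀)
    (v : F) : SmoothFieldAt (fun n : N => (dparam F n₀ n v : TangentSpace 𝓘(ℝ, F) n)) n := by
  refine (contMDiffAt_tangent_iff (f := fun n : N => n) (v := fun n => dparam F n₀ n v) hn).2
    ⟨contMDiffAt_id, ?_⟩
  refine contMDiffAt_const (c := v) |>.congr_of_eventuallyEq ?_
  filter_upwards [(isOpen_dom n₀).mem_nhds hn] with y hy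
  exact dchart_dparam hy v

theorem Form.contMDiffAt_eval {F N : Type*} [NormedAddCommGroup F] [NormedSpace ℝ F]
    [TopologicalSpace N] [ChartedSpace F N] [IsManifold 𝓘(ℝ, F) ∞ N] {f : N → M} {k : ℕ}
    (η : 𝓔.Form F f k) {n : N} {m₀ : M} (hm : 𝓔.e (f n) ∈ dom E₁ (𝓔.e m₀)) {V : Fin k → N → F}
    (hV : ∀ i, SmoothFieldAt (fun n : N => (V i n : TangentSpace 𝓘(ℝ, F) n)) n) :
    ContMDiffAt 𝓘(ℝ, F) 𝓘(ℝ, E₁) ∞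
      (fun n => dchart E₁ (𝓔.e m₀) (𝓔.e (f n)) (η.valE n fun i => V i n)) n :=
  ((contMDiffAt_tangent_iff (f := fun n => 𝓔.e (f n)) (v := fun n => η.valE n fun i => V i n) hm).1
    (η.smooth n (fun i n => V i n) hV)).2

/-- Smoothness of a form is given on vector fields, and is tested here on the fields with constant
coordinates. -/
theorem Form.contDiffAt_loc [FiniteDimensional ℝ E₁] {F N : Type*} [NormedAddCommGroup F]
    [NormedSpace ℝ F] [FiniteDimensional ℝ F]
    [TopologicalSpace N] [ChartedSpace F N] [IsManifold 𝓘(ℝ, F) ∞ N] {f : N → M} {k : ℕ}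
    (η : 𝓔.Form F f k) {n₀ n : N} {m₀ : M} (hn : n ∈ dom F n₀)
    (hm : 𝓔.e (f n) ∈ dom E₁ (𝓔.e m₀)) : ContDiffAt ℝ ∞ (η.loc n₀ m₀) (chart F n₀ n) := by
  refine contDiffAt_continuousAlternatingMap_of_apply fun v => ?_
  have h1 := η.contMDiffAt_eval hm (V := fun i n => dparam F n₀ n (v i))
    fun i => smoothFieldAt_dparam hn (v i)
  refine contMDiffAt_iff_contDiffAt.1 (ContMDiffAt.comp (chart F n₀ n) (f := param F n₀) (by
    rw [param_chart hn]; exact h1) (contMDiffAt_param hn))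

/-- A 1-form on `X` as a linear map on the model space. -/
def evE (α : 𝓔.ArrowForm 1) (x : X) : E₁ →L[ℝ] E₁ :=
  (ContinuousAlternatingMap.ofSubsingleton ℝ E₁ E₁ (0 : Fin 1)).symm (α.valE x)

/-- The expression of a 1-form on `X` in the charts at `x₀` and `e m₀`. -/
def aloc (α : 𝓔.ArrowForm 1) (x₀ : X) (m₀ : M) (p : E₁) : E₁ →L[ℝ] E₁ :=
  (dchart E₁ (𝓔.e m₀) (𝓔.e (𝓔.t (param E₁ x₀ p)))).comp
    ((evE α (param E₁ x₀ p)).comp (dparam E₁ x₀ (param E₁ x₀ p)))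

theorem contDiffAt_aloc [FiniteDimensional ℝ E₁] (α : 𝓔.ArrowForm 1) {x₀ x : X} {m₀ : M}
    (hx : x ∈ dom E₁ x₀) (hm : 𝓔.e (𝓔.t x) ∈ dom E₁ (𝓔.e m₀)) :
    ContDiffAt ℝ ∞ (aloc α x₀ m₀) (chart E₁ x₀ x) := by
  refine contDiffAt_clm_of_apply fun v => ?_
  have h1 := α.contMDiffAt_eval hm (V := fun _ x => dparam E₁ x₀ x v)
    fun i => smoothFieldAt_dparam hx v
  exact contMDiffAt_iff_contDiffAt.1 (ContMDiffAt.comp (chart E₁ x₀ x) (f := param E₁ x₀) (by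
    rw [param_chart hx]; exact h1) (contMDiffAt_param hx))

theorem aloc_chart (α : 𝓔.ArrowForm 1) {x₀ x : X} (m₀ : M) (hx : x ∈ dom E₁ x₀) (u : E₁) :
    aloc α x₀ m₀ (chart E₁ x₀ x) (dchart E₁ x₀ x u) =
      dchart E₁ (𝓔.e m₀) (𝓔.e (𝓔.t x)) (evE α x u) := by
  simp only [aloc, param_chart hx, ContinuousLinearMap.comp_apply, dparam_dchart hx]

/-- The expression of the exterior derivative of a 1-form on `X` in the charts at `x₀` and
`e m₀`. -/
def daloc (α : 𝓔.ArrowForm 1) (x₀ : X) (m₀ : M) (p u v : E₁) : E₁ :=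
  fderiv ℝ (aloc α x₀ m₀) p u v - fderiv ℝ (aloc α x₀ m₀) p v u

/-- Cartan's formula for the commuting fields `∂_r` and `∂_τ`: `∂_r α(∂_τ f) = ∂_τ α(∂_r f) + dα(∂_r
f, ∂_τ f)`. By `ht` the left side stays in one fibre of the bundle and needs no chart; the
`τ`-derivative on the right moves between fibres and is taken in the chart at `e m₀`. Every later
use of the multiplicativity of `α` at second order passes through this formula. -/
theorem hasDerivAt_evE_family [FiniteDimensional ℝ E₁] (α : 𝓔.ArrowForm 1) {x₀ : X} {m₀ : M}
    {f : ℝ × ℝ → X} (hf : ContMDiffAt 𝓘(ℝ, ℝ × ℝ) 𝓘(ℝ, E₁) ∞ f (0, 0)) (hx : f (0, 0) ∈ dom E₁ x₀)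
    (hm : 𝓔.e (𝓔.t (f (0, 0))) ∈ dom E₁ (𝓔.e m₀))
    (ht : ∀ᶠ r : ℝ in 𝓝 0, 𝓔.t (f (r, 0)) = 𝓔.t (f (0, 0))) :
    HasDerivAt (fun r : ℝ => evE α (f (r, 0)) (tmap ℝ E₁ (fun τ : ℝ => f (r, τ)) 0 1))
      (dparam E₁ (𝓔.e m₀) (𝓔.e (𝓔.t (f (0, 0))))
        (deriv (fun τ : ℝ => dchart E₁ (𝓔.e m₀) (𝓔.e (𝓔.t (f (0, τ))))
            (evE α (f (0, τ)) (tmap ℝ E₁ (fun r : ℝ => f (r, τ)) 0 1))) 0 +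
          daloc α x₀ m₀ (chart E₁ x₀ (f (0, 0)))
            (dchart E₁ x₀ (f (0, 0)) (tmap ℝ E₁ (fun r : ℝ => f (r, 0)) 0 1))
            (dchart E₁ x₀ (f (0, 0)) (tmap ℝ E₁ (fun τ : ℝ => f (0, τ)) 0 1)))) 0 := by
  have hg : ContDiffAt ℝ ∞ (fun p => chart E₁ x₀ (f p)) (0, 0) :=
    contMDiffAt_iff_contDiffAt.1 (ContMDiffAt.comp ((0 : ℝ), (0 : ℝ)) (g := chart E₁ x₀)
      (contMDiffAt_chart hx) hf)
  obtain ⟨c, h1, h2⟩ := hasDerivAt_symmetric_part hg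
    ((contDiffAt_aloc α hx hm).differentiableAt (by simp))
  have hf1 : ContMDiffAt 𝓘(ℝ, ℝ × ℝ) 𝓘(ℝ, E₁) 1 f (0, 0) := hf.of_le (by simp)
  have ev : ∀ᶠ p in 𝓝 ((0 : ℝ), (0 : ℝ)), f p ∈ dom E₁ x₀ ∧
      MDifferentiableAt 𝓘(ℝ, ℝ × ℝ) 𝓘(ℝ, E₁) f p := by
    filter_upwards [(contMDiffAt_iff_contMDiffAt_nhds (by simp)).1 hf1,
      hf.continuousAt.preimage_mem_nhds ((isOpen_dom x₀).mem_nhds hx)] with p hp1 hp2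
    exact ⟨hp2, hp1.mdifferentiableAt (by simp)⟩
  have tr : Filter.Tendsto (fun τ : ℝ => ((0 : ℝ), τ)) (𝓝 0) (𝓝 (0, 0)) :=
    (continuous_const.prodMk continuous_id).tendsto' _ _ rfl
  have tl : Filter.Tendsto (fun r : ℝ => (r, (0 : ℝ))) (𝓝 0) (𝓝 (0, 0)) :=
    (continuous_id.prodMk continuous_const).tendsto' _ _ rfl
  have q1 : ∀ r τ : ℝ, f (r, τ) ∈ dom E₁ x₀ → MDifferentiableAt 𝓘(ℝ, ℝ × ℝ) 𝓘(ℝ, E₁) f (r, τ) →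
      fderiv ℝ (fun p => chart E₁ x₀ (f p)) (r, τ) (1, 0) =
        dchart E₁ x₀ (f (r, τ)) (tmap ℝ E₁ (fun r : ℝ => f (r, τ)) r 1) := by
    intro r τ a b
    rw [(hasFDerivAt_chart_comp b a).fderiv, ContinuousLinearMap.comp_apply, ← tmap_left_curve b]
  have q2 : ∀ r τ : ℝ, f (r, τ) ∈ dom E₁ x₀ → MDifferentiableAt 𝓘(ℝ, ℝ × ℝ) 𝓘(ℝ, E₁) f (r, τ) →
      fderiv ℝ (fun p => chart E₁ x₀ (f p)) (r, τ) (0, 1) =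
        dchart E₁ x₀ (f (r, τ)) (tmap ℝ E₁ (fun τ : ℝ => f (r, τ)) τ 1) := by
    intro r τ a b
    rw [(hasFDerivAt_chart_comp b a).fderiv, ContinuousLinearMap.comp_apply, ← tmap_right_curve b]
  have e0 := ev.self_of_nhds
  have h2' := h2.congr_of_eventuallyEq (f₁ := fun τ : ℝ =>
      dchart E₁ (𝓔.e m₀) (𝓔.e (𝓔.t (f (0, τ))))
      (evE α (f (0, τ)) (tmap ℝ E₁ (fun r : ℝ => f (r, τ)) 0 1))) (by
    filter_upwards [tr.eventually ev] with τ hτ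
    rw [q1 _ _ hτ.1 hτ.2, aloc_chart _ _ hτ.1])
  have h1' := h1.congr_of_eventuallyEq (f₁ := fun r : ℝ =>
      dchart E₁ (𝓔.e m₀) (𝓔.e (𝓔.t (f (0, 0))))
      (evE α (f (r, 0)) (tmap ℝ E₁ (fun τ : ℝ => f (r, τ)) 0 1))) (by
    filter_upwards [tl.eventually ev, ht] with r hr hr2
    rw [q2 _ _ hr.1 hr.2, aloc_chart _ _ hr.1, hr2])
  have h3 := (dparam E₁ (𝓔.e m₀) (𝓔.e (𝓔.t (f (0, 0))))).hasFDerivAt.comp_hasDerivAt (0 : ℝ) h1'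
  have h4 := h3.congr_of_eventuallyEq
    (f₁ := fun r : ℝ => evE α (f (r, 0)) (tmap ℝ E₁ (fun τ : ℝ => f (r, τ)) 0 1))
    (Filter.Eventually.of_forall fun r => (dparam_dchart hm _).symm)
  convert h4 using 1
  rw [h2'.deriv, q1 _ _ e0.1 e0.2, q2 _ _ e0.1 e0.2, daloc]
  congr 1
  abel

end LieGroupoidExtension

theorem exists_curve {F N : Type*} [NormedAddCommGroup F] [NormedSpace ℝ F] [TopologicalSpace N]
    [ChartedSpace F N] [IsManifold 𝓘(ℝ, F) ∞ N] (n : N) (v : F) :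
    ∃ c : ℝ → N, ContMDiffAt 𝓘(ℝ, ℝ) 𝓘(ℝ, F) ∞ c 0 ∧ c 0 = n ∧ tmap ℝ F c 0 1 = v := by
  have hn := mem_dom_self (F := F) n
  have hl : HasDerivAt (fun r : ℝ => chart F n n + r • v) v 0 := by
    simpa using ((hasDerivAt_id (0 : ℝ)).smul_const v).const_add (chart F n n)
  have h0 : chart F n n + (0 : ℝ) • v = chart F n n := by simp
  refine ⟨fun r => param F n (chart F n n + r • v), ?_, by simp only [h0, param_chart hn], ?_⟩
  · refine ContMDiffAt.comp (0 : ℝ) (g := param F n) (I' := 𝓘(ℝ, F))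
      (f := fun r : ℝ => chart F n n + r • v) ?_ ?_
    · rw [h0]; exact contMDiffAt_param hn
    · exact contMDiffAt_iff_contDiffAt.2 (contDiffAt_const.add (contDiffAt_id.smul contDiffAt_const))
  · have := tmap_comp (F := ℝ) (F' := F) (F'' := F) (g := param F n)
      (f := fun r : ℝ => chart F n n + r • v) (x := 0) (by rw [h0]; exact mdiff_param hn)
      (mdifferentiableAt_iff_differentiableAt.2 hl.differentiableAt)
    rw [this, ContinuousLinearMap.comp_apply, tmap_eq_fderiv, fderiv_apply_one_eq_deriv, hl.deriv, h0]
    have h := dparam_self (F := F) n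
    rw [dparam] at h
    rw [h]
    rfl

theorem deriv_chart_comp {F N : Type*} [NormedAddCommGroup F] [NormedSpace ℝ F]
    [TopologicalSpace N] [ChartedSpace F N] [IsManifold 𝓘(ℝ, F) ∞ N] {c : ℝ → N} {r : ℝ} {n₀ : N}
    (hc : MDifferentiableAt 𝓘(ℝ, ℝ) 𝓘(ℝ, F) c r) (hn : c r ∈ dom F n₀) :
    HasDerivAt (fun r => chart F n₀ (c r)) (dchart F n₀ (c r) (tmap ℝ F c r 1)) r := by
  have := (hasFDerivAt_chart_comp hc hn).hasDerivAt
  simpa using this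

/-! ### Connection coefficients of the induced covariant derivative. -/

namespace LieGroupoidExtension

variable {E₀ E₁ E₂ M X Y : Type*}
  [NormedAddCommGroup E₀] [NormedSpace ℝ E₀] [NormedAddCommGroup E₁] [NormedSpace ℝ E₁]
  [NormedAddCommGroup E₂] [NormedSpace ℝ E₂]
  [TopologicalSpace M] [ChartedSpace E₀ M] [TopologicalSpace X] [ChartedSpace E₁ X]
  [TopologicalSpace Y] [ChartedSpace E₂ Y]
  {𝓔 : LieGroupoidExtension E₀ E₁ E₂ M X Y}
  [IsManifold 𝓘(ℝ, E₀) ∞ M] [IsManifold 𝓘(ℝ, E₁) ∞ X] [IsManifold 𝓘(ℝ, E₂) ∞ Y]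

theorem mdiff_t (x : X) : MDifferentiableAt 𝓘(ℝ, E₁) 𝓘(ℝ, E₀) 𝓔.t x :=
  (𝓔.contMDiff_t x).mdifferentiableAt (by simp)

theorem mdiff_s (x : X) : MDifferentiableAt 𝓘(ℝ, E₁) 𝓘(ℝ, E₀) 𝓔.s x :=
  (𝓔.contMDiff_s x).mdifferentiableAt (by simp)

theorem mdiff_e (m : M) : MDifferentiableAt 𝓘(ℝ, E₀) 𝓘(ℝ, E₁) 𝓔.e m :=
  (𝓔.contMDiff_e m).mdifferentiableAt (by simp)

theorem fundE_one {m : M} {ξ : E₁} (hξ : ξ ∈ 𝓔.K m) : 𝓔.fundE (𝓔.e m) ξ = ξ := by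
  obtain ⟨k, hk, h0, hker, rfl⟩ := exists_ker_curve hξ
  rw [← 𝓔.tmap_fund (hk.mdifferentiableAt (by simp)) (𝓔.e m) (by rw [h0, t_e]) (by rwa [t_e])]
  refine congrArg (fun L : ℝ →L[ℝ] E₁ => L 1) (tmap_congr ?_)
  filter_upwards [hker] with r hr
  exact 𝓔.total.one_mul' _ (s_of_mem_ker hr)

/-- Multiplying `x` on the right by an element of the kernel over `t x` does not change its target;
nor does it change its source, as `tmap_s_fundE` uses. -/
theorem tmap_t_fundE {x : X} {ξ : E₁} (hξ : ξ ∈ 𝓔.K (𝓔.t x)) :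
    tmap E₁ E₀ 𝓔.t x (𝓔.fundE x ξ) = 0 := by
  obtain ⟨k, hk, h0, hker, rfl⟩ := exists_ker_curve hξ
  have hk1 := hk.mdifferentiableAt (n := ∞) (by simp)
  rw [← 𝓔.tmap_fund hk1 x h0 hker]
  have hx : 𝓔.total.mul x (k 0) = x := by rw [h0]; exact 𝓔.total.mul_one x
  have hm : ContMDiffAt 𝓘(ℝ, ℝ) 𝓘(ℝ, E₁) ∞ (fun r => 𝓔.total.mul x (k r)) 0 :=
    𝓔.total.contMDiffAt_mul contMDiffAt_const hk (by
      filter_upwards [hker] with r hr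
      exact (s_of_mem_ker hr).symm)
  have h1 := tmap_comp (F := ℝ) (F' := E₁) (F'' := E₀) (g := 𝓔.t) (mdiff_t _)
    (hm.mdifferentiableAt (by simp))
  rw [hx] at h1
  have h2 : tmap ℝ E₀ (fun r => 𝓔.t (𝓔.total.mul x (k r))) (0 : ℝ) =
      tmap ℝ E₀ (fun _ : ℝ => 𝓔.t x) (0 : ℝ) := by
    refine tmap_congr ?_
    filter_upwards [hker] with r hr
    rw [t_mul (s_of_mem_ker hr).symm, t_of_mem_ker hr]
  have h3 : tmap ℝ E₀ (fun _ : ℝ => 𝓔.t x) 0 = 0 := mfderiv_const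
  rw [h2, h3] at h1
  exact (congrArg (fun L : ℝ →L[ℝ] E₀ => L 1) h1).symm

theorem tmap_s_fundE {x : X} {ξ : E₁} (hξ : ξ ∈ 𝓔.K (𝓔.t x)) :
    tmap E₁ E₀ 𝓔.s x (𝓔.fundE x ξ) = 0 := by
  obtain ⟨k, hk, h0, hker, rfl⟩ := exists_ker_curve hξ
  have hk1 := hk.mdifferentiableAt (n := ∞) (by simp)
  rw [← 𝓔.tmap_fund hk1 x h0 hker]
  have hx : 𝓔.total.mul x (k 0) = x := by rw [h0]; exact 𝓔.total.mul_one x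
  have hm : ContMDiffAt 𝓘(ℝ, ℝ) 𝓘(ℝ, E₁) ∞ (fun r => 𝓔.total.mul x (k r)) 0 :=
    𝓔.total.contMDiffAt_mul contMDiffAt_const hk (by
      filter_upwards [hker] with r hr
      exact (s_of_mem_ker hr).symm)
  have h1 := tmap_comp (F := ℝ) (F' := E₁) (F'' := E₀) (g := 𝓔.s) (mdiff_s _)
    (hm.mdifferentiableAt (by simp))
  rw [hx] at h1
  have h2 : tmap ℝ E₀ (fun r => 𝓔.s (𝓔.total.mul x (k r))) (0 : ℝ) =
      tmap ℝ E₀ (fun _ : ℝ => 𝓔.s x) (0 : ℝ) := by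
    refine tmap_congr ?_
    filter_upwards [hker] with r hr
    rw [s_mul (s_of_mem_ker hr).symm]
  have h3 : tmap ℝ E₀ (fun _ : ℝ => 𝓔.s x) 0 = 0 := mfderiv_const
  rw [h2, h3] at h1
  exact (congrArg (fun L : ℝ →L[ℝ] E₀ => L 1) h1).symm

theorem adI_one {m : M} {ξ : E₁} (hξ : ξ ∈ 𝓔.K m) : 𝓔.adI (𝓔.e m) ξ = ξ := by
  obtain ⟨k, hk, h0, hker, rfl⟩ := exists_ker_curve hξ
  rw [← 𝓔.tmap_inv_conj (hk.mdifferentiableAt (by simp)) (𝓔.e m) (by rw [h0, s_e]) (by rwa [s_e])]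
  refine congrArg (fun L : ℝ →L[ℝ] E₁ => L 1) (tmap_congr ?_)
  filter_upwards [hker] with r hr
  have h1 : 𝓔.total.mul (𝓔.total.inv (𝓔.e m)) (k r) = k r := by
    rw [𝓔.total.inv_one]; exact 𝓔.total.one_mul' _ (s_of_mem_ker hr)
  rw [h1]
  exact 𝓔.total.mul_one' _ (t_of_mem_ker hr)

variable {α : 𝓔.ArrowForm 1}

theorem evE_mem (α : 𝓔.ArrowForm 1) (x : X) (u : E₁) : evE α x u ∈ 𝓔.K (𝓔.t x) := α.mem x _

theorem evE_fundE (hα : IsRightConnection α) {x : X} {ξ : E₁} (hξ : ξ ∈ 𝓔.K (𝓔.t x)) :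
    evE α x (𝓔.fundE x ξ) = ξ := hα.fund x ξ hξ

theorem evE_of_mem_K (hα : IsRightConnection α) {m : M} {ξ : E₁} (hξ : ξ ∈ 𝓔.K m) :
    evE α (𝓔.e m) ξ = ξ := by
  have := evE_fundE hα (x := 𝓔.e m) (ξ := ξ) (by rwa [t_e])
  rwa [fundE_one hξ] at this

theorem evE_mul (hα : IsRightConnection α) {Q P : Type*} [NormedAddCommGroup Q]
    [NormedSpace ℝ Q] [TopologicalSpace P] [ChartedSpace Q P]
    {f g : P → X} {p : P} (hf : MDifferentiableAt 𝓘(ℝ, Q) 𝓘(ℝ, E₁) f p)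
    (hg : MDifferentiableAt 𝓘(ℝ, Q) 𝓘(ℝ, E₁) g p)
    (h : ∀ᶠ q in 𝓝 p, 𝓔.t (f q) = 𝓔.s (g q)) (v : Q) :
    evE α (𝓔.total.mul (f p) (g p)) (tmap Q E₁ (fun q => 𝓔.total.mul (f q) (g q)) p v) =
      evE α (g p) (tmap Q E₁ g p v) + 𝓔.adI (g p) (evE α (f p) (tmap Q E₁ f p v)) := by
  rw [𝓔.tmap_mul hf hg h]
  refine hα.delta (f p) (g p) h.self_of_nhds _ _ ?_
  have h1 := tmap_comp (F := Q) (F' := E₁) (F'' := E₀) (g := 𝓔.t) (mdiff_t _) hf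
  have h2 := tmap_comp (F := Q) (F' := E₁) (F'' := E₀) (g := 𝓔.s) (mdiff_s _) hg
  have h3 : tmap Q E₀ (fun q => 𝓔.t (f q)) p = tmap Q E₀ (fun q => 𝓔.s (g q)) p := tmap_congr h
  rw [h1, h2] at h3
  exact congrArg (fun L : Q →L[ℝ] E₀ => L v) h3

/-- Units are idempotent and act trivially, so multiplicativity reads `α = α + α` on vectors tangent
to the units: these are horizontal. -/
theorem evE_one (hα : IsRightConnection α) (m : M) (v : E₀) :
    evE α (𝓔.e m) (tmap E₀ E₁ 𝓔.e m v) = 0 := by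
  have h1 := evE_mul hα (mdiff_e m) (mdiff_e m)
    (Filter.Eventually.of_forall fun q => (t_e q).trans (s_e q).symm) v
  have h2 : (fun q => 𝓔.total.mul (𝓔.e q) (𝓔.e q)) = 𝓔.e :=
    funext fun q => 𝓔.total.one_mul' _ (s_e q)
  rw [h2, show 𝓔.total.mul (𝓔.e m) (𝓔.e m) = 𝓔.e m from congrFun h2 m, left_eq_add,
    adI_one] at h1
  · exact h1
  · have := evE_mem α (𝓔.e m) (tmap E₀ E₁ 𝓔.e m v)
    rwa [t_e] at this

/-- The connection coefficients, in the charts at `m₀` and `e m₀`, of the covariant derivative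
induced by a connection. -/
def Gam (α : 𝓔.ArrowForm 1) (m₀ : M) (q : E₀) : E₀ →L[ℝ] E₁ →L[ℝ] E₁ :=
  ((fderiv ℝ (aloc α (𝓔.e m₀) m₀) (chart E₁ (𝓔.e m₀) (𝓔.e (param E₀ m₀ q)))).flip -
    fderiv ℝ (aloc α (𝓔.e m₀) m₀) (chart E₁ (𝓔.e m₀) (𝓔.e (param E₀ m₀ q)))).comp
      (fderiv ℝ (fun q => chart E₁ (𝓔.e m₀) (𝓔.e (param E₀ m₀ q))) q)

theorem Gam_apply (α : 𝓔.ArrowForm 1) (m₀ : M) (q v : E₀) (ξ : E₁) :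
    Gam α m₀ q v ξ = daloc α (𝓔.e m₀) m₀ (chart E₁ (𝓔.e m₀) (𝓔.e (param E₀ m₀ q))) ξ
      (fderiv ℝ (fun q => chart E₁ (𝓔.e m₀) (𝓔.e (param E₀ m₀ q))) q v) := rfl

/-- The covariant derivative along a curve, in the charts at `m₀` and `e m₀`. -/
def covCurve (α : 𝓔.ArrowForm 1) (m₀ : M) (γ : ℝ → M) (σ : ℝ → E₁) : E₁ :=
  deriv (fun τ => dchart E₁ (𝓔.e m₀) (𝓔.e (γ τ)) (σ τ)) 0 +
    Gam α m₀ (chart E₀ m₀ (γ 0)) (dchart E₀ m₀ (γ 0) (tmap ℝ E₀ γ 0 1))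
      (dchart E₁ (𝓔.e m₀) (𝓔.e (γ 0)) (σ 0))

theorem hasFDerivAt_unit_chart {m₀ m : M} (hm : m ∈ dom E₀ m₀)
    (he : 𝓔.e m ∈ dom E₁ (𝓔.e m₀)) (v : E₀) :
    fderiv ℝ (fun q => chart E₁ (𝓔.e m₀) (𝓔.e (param E₀ m₀ q))) (chart E₀ m₀ m) (dchart E₀ m₀ m v) =
      dchart E₁ (𝓔.e m₀) (𝓔.e m) (tmap E₀ E₁ 𝓔.e m v) := by
  have h1 := tmap_comp (F := E₀) (F' := E₀) (F'' := E₁) (g := 𝓔.e) (f := param E₀ m₀)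
    (x := chart E₀ m₀ m) (mdiff_e _) (mdiff_param hm)
  have h2 : MDifferentiableAt 𝓘(ℝ, E₀) 𝓘(ℝ, E₁) (fun q => 𝓔.e (param E₀ m₀ q)) (chart E₀ m₀ m) :=
    MDifferentiableAt.comp (chart E₀ m₀ m) (g := 𝓔.e) (mdiff_e _) (mdiff_param hm)
  have h3 := hasFDerivAt_chart_comp (x₀ := 𝓔.e m₀) h2 (by rwa [param_chart hm])
  rw [h3.fderiv, h1, param_chart hm]
  simp only [ContinuousLinearMap.comp_apply]
  congr 2
  exact dparam_dchart hm v

theorem mem_of_hasDerivAt {E F : Type*} [NormedAddCommGroup E] [NormedSpace ℝ E]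
    [NormedAddCommGroup F] [NormedSpace ℝ F] {L : E →L[ℝ] F} {f : ℝ → E} {f' : E}
    (hf : HasDerivAt f f' 0) (h : ∀ᶠ r in 𝓝 0, L (f r) = 0) : L f' = 0 := by
  have h1 := L.hasFDerivAt.comp_hasDerivAt (0 : ℝ) hf
  have h2 : HasDerivAt (L ∘ f) 0 0 := (hasDerivAt_const (0 : ℝ) (0 : F)).congr_of_eventuallyEq h
  exact h1.unique h2

section

variable [FiniteDimensional ℝ E₁]

/-- Cartan's formula for `f = k`. Along the units `α(∂_r k) = σ` and `∂_τ k = e_* γ'`, so the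
exterior derivative is a value of `Gam`. In particular the derivative that defines `∇` depends on
`γ` and `σ` only, not on the choice of `k`. -/
theorem KerFamily.hasDerivAt_evE (hα : IsRightConnection α) {γ : ℝ → M} {σ : ℝ → E₁}
    {k : ℝ × ℝ → X} (h : 𝓔.KerFamily γ σ k) {m₀ : M} (hm : γ 0 ∈ dom E₀ m₀)
    (he : 𝓔.e (γ 0) ∈ dom E₁ (𝓔.e m₀)) :
    HasDerivAt (fun r : ℝ => evE α (k (r, 0)) (tmap ℝ E₁ (fun τ : ℝ => k (r, τ)) 0 1))
      (dparam E₁ (𝓔.e m₀) (𝓔.e (γ 0)) (covCurve α m₀ γ σ)) 0 := by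
  have h00 : k (0, 0) = 𝓔.e (γ 0) := h.unit.self_of_nhds
  have hv0 : tmap ℝ E₁ (fun r : ℝ => k (r, 0)) 0 1 = σ 0 := h.vel.self_of_nhds
  have tl : Filter.Tendsto (fun r : ℝ => (r, (0 : ℝ))) (𝓝 0) (𝓝 (0, 0)) :=
    (continuous_id.prodMk continuous_const).tendsto' _ _ rfl
  have key := hasDerivAt_evE_family α (x₀ := 𝓔.e m₀) (m₀ := m₀) h.smooth (by rwa [h00])
    (by rwa [h00, t_e]) (by
      filter_upwards [tl.eventually h.mem] with r hr
      rw [h00, t_e, t_of_mem_ker hr])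
  rw [h00, t_e, hv0] at key
  convert key using 2
  rw [covCurve]
  congr 1
  · refine Filter.EventuallyEq.deriv_eq ?_
    filter_upwards [h.unit, h.vel, h.mem_K] with τ h1 h2 h3
    rw [h2, h1, t_e, evE_of_mem_K hα h3]
  · rw [Gam_apply, param_chart hm, hasFDerivAt_unit_chart hm he]
    congr 2
    have h1 : tmap ℝ E₁ (fun τ : ℝ => k (0, τ)) 0 = tmap ℝ E₁ (fun τ => 𝓔.e (γ τ)) 0 :=
      tmap_congr h.unit
    rw [h1, tmap_comp (F := ℝ) (F' := E₀) (F'' := E₁) (g := 𝓔.e) (mdiff_e _)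
      (h.contMDiffAt_base.mdifferentiableAt (by simp))]
    rfl

theorem KerFamily.dparam_covCurve_mem (hα : IsRightConnection α) {γ : ℝ → M} {σ : ℝ → E₁}
    {k : ℝ × ℝ → X} (h : 𝓔.KerFamily γ σ k) {m₀ : M} (hm : γ 0 ∈ dom E₀ m₀)
    (he : 𝓔.e (γ 0) ∈ dom E₁ (𝓔.e m₀)) :
    dparam E₁ (𝓔.e m₀) (𝓔.e (γ 0)) (covCurve α m₀ γ σ) ∈ 𝓔.K (γ 0) := by
  have tl : Filter.Tendsto (fun r : ℝ => (r, (0 : ℝ))) (𝓝 0) (𝓝 (0, 0)) :=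
    (continuous_id.prodMk continuous_const).tendsto' _ _ rfl
  refine mem_of_hasDerivAt (L := tmap E₁ E₂ 𝓔.φ (𝓔.e (γ 0))) (h.hasDerivAt_evE hα hm he) ?_
  filter_upwards [tl.eventually h.mem] with r hr
  have := evE_mem α (k (r, 0)) (tmap ℝ E₁ (fun τ : ℝ => k (r, τ)) 0 1)
  rw [t_of_mem_ker hr] at this
  exact this

/-- At the units `α` is a projection onto the bundle of Lie algebras, so applying it to a field with
constant coordinates extends `ξ` to a smooth section along `γ`. -/
theorem exists_kerFamily_through (hα : IsRightConnection α) {γ : ℝ → M}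
    (hγ : ContMDiffAt 𝓘(ℝ, ℝ) 𝓘(ℝ, E₀) ∞ γ 0) {ξ : E₁} (hξ : ξ ∈ 𝓔.K (γ 0)) :
    ∃ σ k, σ 0 = ξ ∧ 𝓔.KerFamily γ σ k := by
  let σ : ℝ → E₁ := fun τ => evE α (𝓔.e (γ τ)) (dparam E₁ (𝓔.e (γ 0)) (𝓔.e (γ τ)) ξ)
  have h1 := α.contMDiffAt_eval (n := 𝓔.e (γ 0)) (m₀ := γ 0) (by rw [t_e]; exact mem_dom_self _)
    (V := fun _ x => dparam E₁ (𝓔.e (γ 0)) x ξ)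
    fun i => smoothFieldAt_dparam (mem_dom_self _) ξ
  have h2 : ContMDiffAt 𝓘(ℝ, ℝ) 𝓘(ℝ, E₁) ∞ (fun τ => 𝓔.e (γ τ)) 0 :=
    ContMDiffAt.comp (0 : ℝ) (g := 𝓔.e) (𝓔.contMDiff_e _) hγ
  have h3 := contMDiffAt_iff_contDiffAt.1 (ContMDiffAt.comp (0 : ℝ) h1 h2)
  obtain ⟨k, hk⟩ := exists_kerFamily (𝓔 := 𝓔) hγ (σ := σ) (Filter.Eventually.of_forall fun τ => by
      have := evE_mem α (𝓔.e (γ τ)) (dparam E₁ (𝓔.e (γ 0)) (𝓔.e (γ τ)) ξ)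
      rwa [t_e] at this) (h3.congr_of_eventuallyEq (Filter.Eventually.of_forall fun τ => by
        simp only [Function.comp, t_e]; rfl))
  refine ⟨σ, k, ?_, hk⟩
  simp only [σ, dparam_self]
  exact evE_of_mem_K hα hξ

/-- The exterior derivative of a connection vanishes on a vertical and a horizontal vector, up to
the connection coefficients. -/
theorem daloc_fundE (hα : IsRightConnection α) {x₀ x : X} {m₀ : M} (hx : x ∈ dom E₁ x₀)
    (hm : 𝓔.t x ∈ dom E₀ m₀) (he : 𝓔.e (𝓔.t x) ∈ dom E₁ (𝓔.e m₀)) {u ξ : E₁}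
    (hu : evE α x u = 0) (hξ : ξ ∈ 𝓔.K (𝓔.t x)) :
    daloc α x₀ m₀ (chart E₁ x₀ x) (dchart E₁ x₀ x (𝓔.fundE x ξ)) (dchart E₁ x₀ x u) =
      Gam α m₀ (chart E₀ m₀ (𝓔.t x)) (dchart E₀ m₀ (𝓔.t x) (tmap E₁ E₀ 𝓔.t x u))
        (dchart E₁ (𝓔.e m₀) (𝓔.e (𝓔.t x)) ξ) := by
  obtain ⟨c, hc, rfl, rfl⟩ := exists_curve x u
  have hγ : ContMDiffAt 𝓘(ℝ, ℝ) 𝓘(ℝ, E₀) ∞ (fun τ => 𝓔.t (c τ)) 0 :=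
    ContMDiffAt.comp (0 : ℝ) (g := 𝓔.t) (𝓔.contMDiff_t _) hc
  obtain ⟨σ, k, rfl, hk⟩ := exists_kerFamily_through hα (γ := fun τ => 𝓔.t (c τ)) hγ hξ
  have h00 : k (0, 0) = 𝓔.e (𝓔.t (c 0)) := hk.unit.self_of_nhds
  have hv0 : tmap ℝ E₁ (fun r : ℝ => k (r, 0)) 0 1 = σ 0 := hk.vel.self_of_nhds
  have tl : Filter.Tendsto (fun r : ℝ => (r, (0 : ℝ))) (𝓝 0) (𝓝 (0, 0)) :=
    (continuous_id.prodMk continuous_const).tendsto' _ _ rfl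
  have tr : Filter.Tendsto (fun r : ℝ => ((0 : ℝ), r)) (𝓝 0) (𝓝 (0, 0)) :=
    (continuous_const.prodMk continuous_id).tendsto' _ _ rfl
  have hk1 : ∀ᶠ p in 𝓝 ((0 : ℝ), (0 : ℝ)), MDifferentiableAt 𝓘(ℝ, ℝ × ℝ) 𝓘(ℝ, E₁) k p := by
    have : ContMDiffAt 𝓘(ℝ, ℝ × ℝ) 𝓘(ℝ, E₁) 1 k (0, 0) := hk.smooth.of_le (by simp)
    filter_upwards [(contMDiffAt_iff_contMDiffAt_nhds (by simp)).1 this] with p hp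
    exact hp.mdifferentiableAt (by simp)
  -- The families `f = c k` and `k` are compared. On `τ = 0` they have the same `α(∂_τ)`, by
  -- multiplicativity and because `c'(0) = u` is horizontal; on `r = 0` both have `α(∂_r) = σ`.
  -- Cartan's formula for each then leaves the equality of their exterior derivative terms, which is
  -- the claim.
  let f : ℝ × ℝ → X := fun p => 𝓔.total.mul (c p.2) (k p)
  have hsnd : ContMDiffAt 𝓘(ℝ, ℝ × ℝ) 𝓘(ℝ, ℝ) ∞ (Prod.snd : ℝ × ℝ → ℝ) (0, 0) :=
    contMDiffAt_iff_contDiffAt.2 contDiffAt_snd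
  have hf : ContMDiffAt 𝓘(ℝ, ℝ × ℝ) 𝓘(ℝ, E₁) ∞ f (0, 0) := by
    refine 𝓔.total.contMDiffAt_mul ?_ hk.smooth ?_
    · exact ContMDiffAt.comp ((0 : ℝ), (0 : ℝ)) (g := c) (f := Prod.snd) hc hsnd
    · filter_upwards [hk.mem] with p hp
      exact (s_of_mem_ker hp).symm
  have hf0 : ∀ᶠ τ in 𝓝 0, f (0, τ) = c τ := by
    filter_upwards [hk.unit] with τ hτ
    simp only [f, hτ]
    exact 𝓔.total.mul_one _
  have hf00 : f (0, 0) = c 0 := hf0.self_of_nhds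
  have htf : ∀ᶠ r : ℝ in 𝓝 0, 𝓔.t (f (r, 0)) = 𝓔.t (f (0, 0)) := by
    filter_upwards [tl.eventually hk.mem] with r hr
    rw [hf00]
    exact (t_mul (s_of_mem_ker hr).symm).trans (t_of_mem_ker hr)
  have hlin : ∀ r τ : ℝ, MDifferentiableAt 𝓘(ℝ, ℝ × ℝ) 𝓘(ℝ, E₁) k (r, τ) →
      MDifferentiableAt 𝓘(ℝ, ℝ) 𝓘(ℝ, E₁) (fun r => k (r, τ)) r ∧
      MDifferentiableAt 𝓘(ℝ, ℝ) 𝓘(ℝ, E₁) (fun τ => k (r, τ)) τ := by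
    intro r τ h
    exact ⟨MDifferentiableAt.comp r (g := k) (f := fun r : ℝ => (r, τ)) h
        (mdifferentiableAt_iff_differentiableAt.2 (by fun_prop)),
      MDifferentiableAt.comp τ (g := k) (f := fun τ : ℝ => (r, τ)) h
        (mdifferentiableAt_iff_differentiableAt.2 (by fun_prop))⟩
  have hfund : ∀ᶠ τ in 𝓝 0, tmap ℝ E₁ (fun r : ℝ => f (r, τ)) 0 1 = 𝓔.fundE (c τ) (σ τ) := by
    filter_upwards [hk.unit, hk.vel, tr.eventually hk1, tr.eventually hk.mem.eventually_nhds]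
      with τ h1 h2 h3 h4
    have t5 : Filter.Tendsto (fun r : ℝ => (r, τ)) (𝓝 0) (𝓝 (0, τ)) :=
      (continuous_id.prodMk continuous_const).tendsto' _ _ rfl
    rw [← h2]
    exact 𝓔.tmap_fund (hlin 0 τ h3).1 (c τ) h1 (t5.eventually h4) 1
  have key := hasDerivAt_evE_family α (x₀ := x₀) (m₀ := m₀) hf (by rwa [hf00]) (by rwa [hf00]) htf
  have key2 := hk.hasDerivAt_evE hα (m₀ := m₀) hm he
  have hder : deriv (fun τ : ℝ => dchart E₁ (𝓔.e m₀) (𝓔.e (𝓔.t (f (0, τ))))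
      (evE α (f (0, τ)) (tmap ℝ E₁ (fun r : ℝ => f (r, τ)) 0 1))) 0 =
      deriv (fun τ => dchart E₁ (𝓔.e m₀) (𝓔.e (𝓔.t (c τ))) (σ τ)) 0 := by
    refine Filter.EventuallyEq.deriv_eq ?_
    filter_upwards [hf0, hfund, hk.mem_K] with τ h1 h2 h3
    rw [h1, h2, evE_fundE hα h3]
  have hev : ∀ᶠ r in 𝓝 (0 : ℝ), evE α (f (r, 0)) (tmap ℝ E₁ (fun τ : ℝ => f (r, τ)) 0 1) =
      evE α (k (r, 0)) (tmap ℝ E₁ (fun τ : ℝ => k (r, τ)) 0 1) := by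
    filter_upwards [tl.eventually hk1, tl.eventually hk.mem.eventually_nhds] with r h3 h4
    have t5 : Filter.Tendsto (fun τ : ℝ => (r, τ)) (𝓝 0) (𝓝 (r, 0)) :=
      (continuous_const.prodMk continuous_id).tendsto' _ _ rfl
    have := evE_mul hα (hc.mdifferentiableAt (by simp)) (hlin r 0 h3).2 (by
      filter_upwards [t5.eventually h4] with τ hτ
      exact (s_of_mem_ker hτ).symm) 1
    rw [hu, map_zero, add_zero] at this
    exact this
  have key3 := key2.unique (key.congr_of_eventuallyEq (hev.mono fun r hr => hr.symm))
  have hfc : tmap ℝ E₁ (fun τ : ℝ => f (0, τ)) 0 = tmap ℝ E₁ c 0 := tmap_congr hf0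
  rw [hf00, hder, hfc, hfund.self_of_nhds] at key3
  have key4 := (Function.LeftInverse.injective (f := dparam E₁ (𝓔.e m₀) (𝓔.e (𝓔.t (c 0))))
    (dchart_dparam he)) key3
  rw [covCurve, add_right_inj] at key4
  rw [← key4]
  congr 3
  exact congrArg (fun L : ℝ →L[ℝ] E₀ => L 1) (tmap_comp (F := ℝ) (F' := E₁) (F'' := E₀) (g := 𝓔.t)
    (mdiff_t _) (hc.mdifferentiableAt (by simp)))

end

end LieGroupoidExtension

theorem eventually_mdifferentiableAt {F N P : Type*} [NormedAddCommGroup F] [NormedSpace ℝ F]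
    [TopologicalSpace N] [ChartedSpace F N] [IsManifold 𝓘(ℝ, F) ∞ N]
    [NormedAddCommGroup P] [NormedSpace ℝ P] {f : P → N} {p : P}
    (hf : ContMDiffAt 𝓘(ℝ, P) 𝓘(ℝ, F) ∞ f p) :
    ∀ᶠ q in 𝓝 p, MDifferentiableAt 𝓘(ℝ, P) 𝓘(ℝ, F) f q := by
  have : ContMDiffAt 𝓘(ℝ, P) 𝓘(ℝ, F) 1 f p := hf.of_le (by simp)
  filter_upwards [(contMDiffAt_iff_contMDiffAt_nhds (by simp)).1 this] with p hp
  exact hp.mdifferentiableAt (by simp)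

theorem mdiff_left_curve {F N : Type*} [NormedAddCommGroup F] [NormedSpace ℝ F]
    [TopologicalSpace N] [ChartedSpace F N] {f : ℝ × ℝ → N} {r τ : ℝ}
    (h : MDifferentiableAt 𝓘(ℝ, ℝ × ℝ) 𝓘(ℝ, F) f (r, τ)) :
    MDifferentiableAt 𝓘(ℝ, ℝ) 𝓘(ℝ, F) (fun r => f (r, τ)) r :=
  MDifferentiableAt.comp r (g := f) (f := fun r : ℝ => (r, τ)) h
    (mdifferentiableAt_iff_differentiableAt.2 (by fun_prop))

theorem mdiff_right_curve {F N : Type*} [NormedAddCommGroup F] [NormedSpace ℝ F]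
    [TopologicalSpace N] [ChartedSpace F N] {f : ℝ × ℝ → N} {r τ : ℝ}
    (h : MDifferentiableAt 𝓘(ℝ, ℝ × ℝ) 𝓘(ℝ, F) f (r, τ)) :
    MDifferentiableAt 𝓘(ℝ, ℝ) 𝓘(ℝ, F) (fun τ => f (r, τ)) τ :=
  MDifferentiableAt.comp τ (g := f) (f := fun τ : ℝ => (r, τ)) h
    (mdifferentiableAt_iff_differentiableAt.2 (by fun_prop))

theorem tendsto_left_line (r τ : ℝ) : Filter.Tendsto (fun r : ℝ => (r, τ)) (𝓝 r) (𝓝 (r, τ)) :=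
  (continuous_id.prodMk continuous_const).tendsto' _ _ rfl

theorem tendsto_right_line (r τ : ℝ) : Filter.Tendsto (fun τ : ℝ => (r, τ)) (𝓝 τ) (𝓝 (r, τ)) :=
  (continuous_const.prodMk continuous_id).tendsto' _ _ rfl

/-! ### Conjugation along curves, and the covariant derivative of sections. -/

namespace LieGroupoidExtension

variable {E₀ E₁ E₂ M X Y : Type*}
  [NormedAddCommGroup E₀] [NormedSpace ℝ E₀] [NormedAddCommGroup E₁] [NormedSpace ℝ E₁]
  [NormedAddCommGroup E₂] [NormedSpace ℝ E₂]
  [TopologicalSpace M] [ChartedSpace E₀ M] [TopologicalSpace X] [ChartedSpace E₁ X]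
  [TopologicalSpace Y] [ChartedSpace E₂ Y]
  {𝓔 : LieGroupoidExtension E₀ E₁ E₂ M X Y}
  [IsManifold 𝓘(ℝ, E₀) ∞ M] [IsManifold 𝓘(ℝ, E₁) ∞ X] [IsManifold 𝓘(ℝ, E₂) ∞ Y]

theorem KerFamily.conj {x : ℝ → X} (hx : ContMDiffAt 𝓘(ℝ, ℝ) 𝓘(ℝ, E₁) ∞ x 0) {ζ : ℝ → E₁}
    {k : ℝ × ℝ → X} (hk : 𝓔.KerFamily (fun τ => 𝓔.s (x τ)) ζ k) :
    𝓔.KerFamily (fun τ => 𝓔.t (x τ)) (fun τ => 𝓔.adI (x τ) (ζ τ))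
      fun p => 𝓔.total.mul (𝓔.total.mul (𝓔.total.inv (x p.2)) (k p)) (x p.2) := by
  have hsnd : ContMDiffAt 𝓘(ℝ, ℝ × ℝ) 𝓘(ℝ, ℝ) ∞ (Prod.snd : ℝ × ℝ → ℝ) (0, 0) :=
    contMDiffAt_iff_contDiffAt.2 contDiffAt_snd
  have hx2 : ContMDiffAt 𝓘(ℝ, ℝ × ℝ) 𝓘(ℝ, E₁) ∞ (fun p : ℝ × ℝ => x p.2) (0, 0) :=
    ContMDiffAt.comp ((0 : ℝ), (0 : ℝ)) (g := x) (f := Prod.snd) hx hsnd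
  refine ⟨?_, ?_, ?_, ?_⟩
  · refine 𝓔.total.contMDiffAt_mul (𝓔.total.contMDiffAt_mul ?_ hk.smooth ?_) hx2 ?_
    · exact ContMDiffAt.comp ((0 : ℝ), (0 : ℝ)) (g := 𝓔.total.inv) (𝓔.total.contMDiff_inv _) hx2
    · filter_upwards [hk.mem] with p hp
      exact (t_inv _).trans (s_of_mem_ker hp).symm
    · filter_upwards [hk.mem] with p hp
      exact (t_mul ((t_inv _).trans (s_of_mem_ker hp).symm)).trans (t_of_mem_ker hp)
  · filter_upwards [hk.mem] with p hp
    exact inv_conj_mem_ker hp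
  · filter_upwards [hk.unit] with τ hτ
    simp only [hτ]
    rw [𝓔.total.mul_one' _ (t_inv _), 𝓔.total.inv_mul]
  · filter_upwards [hk.unit, hk.vel,
      (tendsto_right_line 0 0).eventually (eventually_mdifferentiableAt hk.smooth),
      (tendsto_right_line 0 0).eventually hk.mem.eventually_nhds] with τ h1 h2 h3 h4
    rw [← h2]
    exact 𝓔.tmap_inv_conj (mdiff_left_curve h3) (x τ) h1
      ((tendsto_left_line 0 τ).eventually h4) 1

variable {α : 𝓔.ArrowForm 1}

theorem contDiffAt_unit_chart {m₀ m : M} (hm : m ∈ dom E₀ m₀) (he : 𝓔.e m ∈ dom E₁ (𝓔.e m₀)) :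
    ContDiffAt ℝ ∞ (fun q => chart E₁ (𝓔.e m₀) (𝓔.e (param E₀ m₀ q))) (chart E₀ m₀ m) := by
  refine contMDiffAt_iff_contDiffAt.1 ?_
  refine ContMDiffAt.comp (chart E₀ m₀ m) (I' := 𝓘(ℝ, E₁)) (g := chart E₁ (𝓔.e m₀))
    (f := fun q => 𝓔.e (param E₀ m₀ q)) (contMDiffAt_chart (by rwa [param_chart hm])) ?_
  exact ContMDiffAt.comp (chart E₀ m₀ m) (I' := 𝓘(ℝ, E₀)) (g := 𝓔.e) (f := param E₀ m₀)
    (𝓔.contMDiff_e _) (contMDiffAt_param hm)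

section

variable [FiniteDimensional ℝ E₁]

/-- Conjugation by the inverses of the points of a horizontal curve commutes with the covariant
derivative. -/
theorem KerFamily.covCurve_adI (hα : IsRightConnection α) {x : ℝ → X}
    (hx : ContMDiffAt 𝓘(ℝ, ℝ) 𝓘(ℝ, E₁) ∞ x 0) (hor : evE α (x 0) (tmap ℝ E₁ x 0 1) = 0) {ζ : ℝ → E₁}
    {k : ℝ × ℝ → X} (hk : 𝓔.KerFamily (fun τ => 𝓔.s (x τ)) ζ k) {m₀ n₀ : M}
    (hm : 𝓔.t (x 0) ∈ dom E₀ m₀) (hem : 𝓔.e (𝓔.t (x 0)) ∈ dom E₁ (𝓔.e m₀))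
    (hn : 𝓔.s (x 0) ∈ dom E₀ n₀) (hen : 𝓔.e (𝓔.s (x 0)) ∈ dom E₁ (𝓔.e n₀)) :
    dparam E₁ (𝓔.e m₀) (𝓔.e (𝓔.t (x 0)))
        (covCurve α m₀ (fun τ => 𝓔.t (x τ)) fun τ => 𝓔.adI (x τ) (ζ τ)) =
      𝓔.adI (x 0) (dparam E₁ (𝓔.e n₀) (𝓔.e (𝓔.s (x 0)))
        (covCurve α n₀ (fun τ => 𝓔.s (x τ)) ζ)) := by
  have hk' := hk.conj hx
  have h1 := hk'.hasDerivAt_evE hα (m₀ := m₀) hm hem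
  have h2 := hk.hasDerivAt_evE hα (m₀ := n₀) hn hen
  have h3 := (𝓔.adI (x 0)).hasFDerivAt.comp_hasDerivAt (0 : ℝ) h2
  refine h1.unique (h3.congr_of_eventuallyEq ?_)
  have hx1 := hx.mdifferentiableAt (n := ∞) (by simp)
  filter_upwards [(tendsto_left_line 0 0).eventually (eventually_mdifferentiableAt hk.smooth),
    (tendsto_left_line 0 0).eventually (eventually_mdifferentiableAt hk'.smooth),
    (tendsto_left_line 0 0).eventually hk.mem.eventually_nhds,
    (tendsto_left_line 0 0).eventually hk'.mem.eventually_nhds] with r h4 h5 h6 h7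
  have h6' := (tendsto_right_line r 0).eventually h6
  have h7' := (tendsto_right_line r 0).eventually h7
  have e1 := evE_mul hα hx1 (mdiff_right_curve h5) (by
    filter_upwards [h7'] with τ hτ
    exact (s_of_mem_ker hτ).symm) 1
  have e2 := evE_mul hα (mdiff_right_curve h4) hx1 (by
    filter_upwards [h6'] with τ hτ
    exact t_of_mem_ker hτ) 1
  -- Multiplicativity of `α` is applied to both sides of `x (x⁻¹ k x) = k x`. The terms with `α(x')`
  -- vanish at `τ = 0`, which leaves `α(∂_τ (x⁻¹ k x)) = Ad_{x⁻¹} α(∂_τ k)` for every small `r`.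
  have e3 : ∀ᶠ τ in 𝓝 (0 : ℝ), 𝓔.total.mul (x τ)
      (𝓔.total.mul (𝓔.total.mul (𝓔.total.inv (x τ)) (k (r, τ))) (x τ)) =
      𝓔.total.mul (k (r, τ)) (x τ) := by
    filter_upwards [h6'] with τ hτ
    have a1 : 𝓔.s (k (r, τ)) = 𝓔.s (x τ) := s_of_mem_ker hτ
    have a2 : 𝓔.t (k (r, τ)) = 𝓔.s (x τ) := t_of_mem_ker hτ
    rw [𝓔.total.mul_assoc _ _ _ ((t_inv _).trans a1.symm) a2]
    exact 𝓔.total.mul_inv_cancel_left _ _ ((s_mul a2).trans a1).symm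
  rw [tmap_congr e3, e3.self_of_nhds, e2, hor, map_zero, add_zero, zero_add] at e1
  exact e1.symm

theorem contDiffAt_Gam (α : 𝓔.ArrowForm 1) {m₀ m : M} (hm : m ∈ dom E₀ m₀)
    (he : 𝓔.e m ∈ dom E₁ (𝓔.e m₀)) : ContDiffAt ℝ ∞ (Gam α m₀) (chart E₀ m₀ m) := by
  have h1 := contDiffAt_unit_chart (𝓔 := 𝓔) hm he
  have h2 : ContDiffAt ℝ ∞ (fderiv ℝ (aloc α (𝓔.e m₀) m₀))
      (chart E₁ (𝓔.e m₀) (𝓔.e (param E₀ m₀ (chart E₀ m₀ m)))) := by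
    rw [param_chart hm]
    exact (contDiffAt_aloc α he (by rwa [t_e])).fderiv_right (m := ∞) (by simp)
  have h3 := h2.comp (chart E₀ m₀ m) h1
  refine ContDiffAt.clm_comp (ContDiffAt.sub ?_ h3) (h1.fderiv_right (m := ∞) (by simp))
  exact (ContinuousLinearMap.flipₗᵢ ℝ E₁ E₁ E₁).toContinuousLinearEquiv.toContinuousLinearMap.contDiff.contDiffAt.comp
    (chart E₀ m₀ m) h3

/-- A section of the bundle of Lie algebras, in the charts at `m₀` and `e m₀`. -/
def secLoc (𝓔 : LieGroupoidExtension E₀ E₁ E₂ M X Y) (m₀ : M) (σ : M → E₁) (q : E₀) : E₁ :=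
  dchart E₁ (𝓔.e m₀) (𝓔.e (param E₀ m₀ q)) (σ (param E₀ m₀ q))

/-- Smooth sections near `m` of the bundle of Lie algebras. -/
structure SmoothSectionAt (𝓔 : LieGroupoidExtension E₀ E₁ E₂ M X Y) (σ : M → E₁) (m : M) : Prop where
  smooth : ContMDiffAt 𝓘(ℝ, E₀) 𝓘(ℝ, E₁).tangent ∞
    (fun m => (⟨𝓔.e m, σ m⟩ : TangentBundle 𝓘(ℝ, E₁) X)) m
  mem : ∀ᶠ m' in 𝓝 m, σ m' ∈ 𝓔.K m'

theorem SmoothSectionAt.contDiffAt_secLoc {σ : M → E₁} {m m₀ : M} (hσ : 𝓔.SmoothSectionAt σ m)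
    (hm : m ∈ dom E₀ m₀) (he : 𝓔.e m ∈ dom E₁ (𝓔.e m₀)) :
    ContDiffAt ℝ ∞ (𝓔.secLoc m₀ σ) (chart E₀ m₀ m) := by
  have h1 := ((contMDiffAt_tangent_iff (f := fun n => 𝓔.e n) (v := σ) he).1 hσ.smooth).2
  exact contMDiffAt_iff_contDiffAt.1 (ContMDiffAt.comp (chart E₀ m₀ m) (f := param E₀ m₀) (by
    rw [param_chart hm]; exact h1) (contMDiffAt_param hm))

theorem SmoothSectionAt.exists_kerFamily {σ : M → E₁} {γ : ℝ → M} (hσ : 𝓔.SmoothSectionAt σ (γ 0))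
    (hγ : ContMDiffAt 𝓘(ℝ, ℝ) 𝓘(ℝ, E₀) ∞ γ 0) :
    ∃ k, 𝓔.KerFamily γ (fun τ => σ (γ τ)) k := by
  refine LieGroupoidExtension.exists_kerFamily hγ (hγ.continuousAt.eventually hσ.mem) ?_
  have h1 := ((contMDiffAt_tangent_iff (f := fun n => 𝓔.e n) (v := σ)
    (mem_dom_self (F := E₁) (𝓔.e (γ 0)))).1 hσ.smooth).2
  exact contMDiffAt_iff_contDiffAt.1 (ContMDiffAt.comp (0 : ℝ) h1 hγ)

/-- The covariant derivative at `m` in the charts at `m₀` and `e m₀`. -/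
def covLoc (α : 𝓔.ArrowForm 1) (m₀ : M) (s : E₀ → E₁) (q v : E₀) : E₁ :=
  fderiv ℝ s q v + Gam α m₀ q v (s q)

theorem SmoothSectionAt.covCurve_eq {σ : M → E₁} {γ : ℝ → M} (hσ : 𝓔.SmoothSectionAt σ (γ 0))
    (hγ : ContMDiffAt 𝓘(ℝ, ℝ) 𝓘(ℝ, E₀) ∞ γ 0) {m₀ : M} (hm : γ 0 ∈ dom E₀ m₀)
    (he : 𝓔.e (γ 0) ∈ dom E₁ (𝓔.e m₀)) :
    covCurve α m₀ γ (fun τ => σ (γ τ)) =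
      covLoc α m₀ (𝓔.secLoc m₀ σ) (chart E₀ m₀ (γ 0)) (dchart E₀ m₀ (γ 0) (tmap ℝ E₀ γ 0 1)) := by
  have h1 := deriv_chart_comp (hγ.mdifferentiableAt (by simp)) hm
  have h2 := ((hσ.contDiffAt_secLoc hm he).differentiableAt (by simp)).hasFDerivAt.comp_hasDerivAt
    (0 : ℝ) h1
  have h3 : ∀ᶠ τ in 𝓝 (0 : ℝ), dchart E₁ (𝓔.e m₀) (𝓔.e (γ τ)) (σ (γ τ)) =
      𝓔.secLoc m₀ σ (chart E₀ m₀ (γ τ)) := by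
    filter_upwards [hγ.continuousAt.preimage_mem_nhds ((isOpen_dom m₀).mem_nhds hm)] with τ hτ
    rw [secLoc, param_chart hτ]
  rw [covCurve, covLoc, (h2.congr_of_eventuallyEq h3).deriv, h3.self_of_nhds]

/-- `covDeriv` is a choice among the values allowed by `HasCovDerivAt`. The coordinate formula is
one of them, and as at least one pair `(γ, k)` exists, uniqueness of derivatives makes it the only
one. -/
theorem SmoothSectionAt.covDeriv_eq (hα : IsRightConnection α) {σ : M → E₁} {m m₀ : M}
    (hσ : 𝓔.SmoothSectionAt σ m) (hm : m ∈ dom E₀ m₀) (he : 𝓔.e m ∈ dom E₁ (𝓔.e m₀)) (v : E₀) :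
    (α.covDeriv σ m v : E₁) = dparam E₁ (𝓔.e m₀) (𝓔.e m)
      (covLoc α m₀ (𝓔.secLoc m₀ σ) (chart E₀ m₀ m) (dchart E₀ m₀ m v)) := by
  have key : α.HasCovDerivAt σ m v (dparam E₁ (𝓔.e m₀) (𝓔.e m)
      (covLoc α m₀ (𝓔.secLoc m₀ σ) (chart E₀ m₀ m) (dchart E₀ m₀ m v))) := by
    intro γ k hγ hv hk hker hvel
    obtain rfl : γ 0 = m := congrArg (fun p : TangentBundle 𝓘(ℝ, E₀) M => p.1) hv
    have hv : tmap ℝ E₀ γ 0 1 = v :=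
      congrArg (fun p : TangentBundle 𝓘(ℝ, E₀) M => (p.2 : E₀)) hv
    have hK : 𝓔.KerFamily γ (fun τ => σ (γ τ)) k :=
      ⟨hk, hker, hvel.mono fun τ h => congrArg (fun p : TangentBundle 𝓘(ℝ, E₁) X => p.1) h,
        hvel.mono fun τ h => congrArg (fun p : TangentBundle 𝓘(ℝ, E₁) X => (p.2 : E₁)) h⟩
    have := hK.hasDerivAt_evE hα hm he
    rw [hσ.covCurve_eq hγ hm he, hv] at this
    exact this
  have hex : ∃ w, α.HasCovDerivAt σ m v w := ⟨_, key⟩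
  have h1 : α.covDeriv σ m v = hex.choose := dif_pos hex
  have h2 := hex.choose_spec
  rw [h1]
  obtain ⟨γ, hγ, rfl, rfl⟩ := exists_curve m v
  obtain ⟨k, hk⟩ := hσ.exists_kerFamily hγ
  have h3 : ∀ᶠ τ in 𝓝 (0 : ℝ),
      (⟨k (0, τ), mfderiv 𝓘(ℝ, ℝ) 𝓘(ℝ, E₁) (fun r : ℝ => k (r, τ)) 0 (1 : ℝ)⟩ :
        TangentBundle 𝓘(ℝ, E₁) X) = ⟨𝓔.e (γ τ), σ (γ τ)⟩ := by
    filter_upwards [hk.unit, hk.vel] with τ a b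
    change (⟨k (0, τ), tmap ℝ E₁ (fun r : ℝ => k (r, τ)) 0 1⟩ : TangentBundle 𝓘(ℝ, E₁) X) = _
    rw [b, a]
  exact (h2 γ k hγ rfl hk.smooth hk.mem h3).unique (key γ k hγ rfl hk.smooth hk.mem h3)

theorem SmoothSectionAt.covLoc_mem (hα : IsRightConnection α) {σ : M → E₁} {m m₀ : M}
    (hσ : 𝓔.SmoothSectionAt σ m) (hm : m ∈ dom E₀ m₀) (he : 𝓔.e m ∈ dom E₁ (𝓔.e m₀)) (v : E₀) :
    dparam E₁ (𝓔.e m₀) (𝓔.e m)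
      (covLoc α m₀ (𝓔.secLoc m₀ σ) (chart E₀ m₀ m) (dchart E₀ m₀ m v)) ∈ 𝓔.K m := by
  obtain ⟨γ, hγ, rfl, rfl⟩ := exists_curve m v
  obtain ⟨k, hk⟩ := hσ.exists_kerFamily hγ
  have := hk.dparam_covCurve_mem hα hm he
  rwa [hσ.covCurve_eq hγ hm he] at this

end

end LieGroupoidExtension

/-! ### The exterior covariant derivative on a vector space. -/

section Flat

variable {E F : Type*} [NormedAddCommGroup E] [NormedSpace ℝ E] [NormedAddCommGroup F]
  [NormedSpace ℝ F]

theorem ContDiffAt.continuousAlternatingMap_apply [CompleteSpace F] {P : Type*} [NormedAddCommGroup P]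
    [NormedSpace ℝ P] {k : ℕ} {f : P → E [⋀^Fin k]→L[ℝ] F} {v : P → Fin k → E} {p : P}
    {n : WithTop ℕ∞} (hf : ContDiffAt ℝ n f p) (hv : ContDiffAt ℝ n v p) :
    ContDiffAt ℝ n (fun q => f q (v q)) p := by
  have h := ((ContinuousAlternatingMap.toContinuousMultilinearMapCLM ℝ :
    (E [⋀^Fin k]→L[ℝ] F) →L[ℝ] _).analyticAt_uncurry_of_multilinear (x := (f p, v p))).contDiffAt
      (n := n)
  exact h.comp p (hf.prodMk hv)

/-- The product of an endomorphism-valued 1-form and a `k`-form, before alternation. -/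
def connMul {k : ℕ} (Γ : E →L[ℝ] F →L[ℝ] F) (η : E [⋀^Fin k]→L[ℝ] F) : E →L[ℝ] E [⋀^Fin k]→L[ℝ] F :=
  ((ContinuousLinearMap.compContinuousAlternatingMapCLM ℝ E F F (Fin k)).flip η).comp Γ

@[simp] theorem connMul_apply {k : ℕ} (Γ : E →L[ℝ] F →L[ℝ] F) (η : E [⋀^Fin k]→L[ℝ] F) (v : E)
    (w : Fin k → E) : connMul Γ η v w = Γ v (η w) := rfl

/-- The exterior covariant derivative of a `k`-form on a vector space, for the connection with the
coefficients `Γ`. -/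
def covExt {k : ℕ} (Γ : E → E →L[ℝ] F →L[ℝ] F) (η : E → E [⋀^Fin k]→L[ℝ] F) (q : E) :
    E [⋀^Fin (k + 1)]→L[ℝ] F :=
  .alternatizeUncurryFin (fderiv ℝ η q + connMul (Γ q) (η q))

theorem negOne_pow_zsmul (n : ℕ) (x : F) : ((-1 : ℤ) ^ n) • x = ((-1 : ℝ) ^ n) • x := by
  rw [← Int.cast_smul_eq_zsmul ℝ]
  push_cast
  rfl

theorem covExt_apply {k : ℕ} (Γ : E → E →L[ℝ] F →L[ℝ] F) (η : E → E [⋀^Fin k]→L[ℝ] F) (q : E)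
    (v : Fin (k + 1) → E) :
    covExt Γ η q v = ∑ i : Fin (k + 1), (-1 : ℝ) ^ (i : ℕ) •
      (fderiv ℝ η q (v i) (i.removeNth v) + Γ q (v i) (η q (i.removeNth v))) := by
  simp only [covExt, ContinuousAlternatingMap.alternatizeUncurryFin_apply, negOne_pow_zsmul]
  rfl

/-- The terms with `Γ` are pointwise in the vectors, so the derivatives of the fields and their
brackets enter only through the ordinary exterior derivative. -/
theorem covExt_apply_vectorField {k : ℕ} {Γ : E → E →L[ℝ] F →L[ℝ] F}
    {η : E → E [⋀^Fin (k + 1)]→L[ℝ] F} {q : E} {V : Fin (k + 2) → E → E}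
    (hη : DifferentiableAt ℝ η q) (hV : ∀ i, DifferentiableAt ℝ (V i) q) :
    covExt Γ η q (fun i => V i q) =
      (∑ i : Fin (k + 2), (-1 : ℝ) ^ (i : ℕ) •
        (fderiv ℝ (fun x => η x (i.removeNth fun l => V l x)) q (V i q) +
        Γ q (V i q) (η q (i.removeNth fun l => V l q)))) -
      ∑ i : Fin (k + 1), ∑ j ∈ Finset.Ici i, (-1 : ℝ) ^ (i + j : ℕ) •
        η q (Matrix.vecCons (lieBracket ℝ (V i.castSucc) (V j.succ) q)
          (j.removeNth (i.castSucc.removeNth fun l => V l q))) := by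
  have h1 := extDeriv_apply_vectorField hη hV
  have h2 : covExt Γ η q (fun i => V i q) = extDeriv η q (fun i => V i q) +
      ∑ i : Fin (k + 2), (-1 : ℝ) ^ (i : ℕ) • Γ q (V i q) (η q (i.removeNth fun l => V l q)) := by
    rw [covExt_apply, extDeriv, ContinuousAlternatingMap.alternatizeUncurryFin_apply]
    simp only [negOne_pow_zsmul, smul_add, Finset.sum_add_distrib]
  rw [h2, h1]
  simp only [negOne_pow_zsmul, smul_add, Finset.sum_add_distrib]
  abel

theorem ContDiffAt.covExt {k : ℕ} {Γ : E → E →L[ℝ] F →L[ℝ] F} {η : E → E [⋀^Fin k]→L[ℝ] F} {q : E}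
    (hΓ : ContDiffAt ℝ ∞ Γ q) (hη : ContDiffAt ℝ ∞ η q) : ContDiffAt ℝ ∞ (covExt Γ η) q := by
  refine (ContinuousLinearMap.contDiff (𝕜 := ℝ) (E := E →L[ℝ] E [⋀^Fin k]→L[ℝ] F)
    (F := E [⋀^Fin (k + 1)]→L[ℝ] F) (n := ∞)
    (ContinuousAlternatingMap.alternatizeUncurryFinCLM ℝ E F)).contDiffAt.comp q ?_
  refine (hη.fderiv_right (m := ∞) (by simp)).add (ContDiffAt.clm_comp ?_ hΓ)
  exact (ContinuousLinearMap.contDiff _).contDiffAt.comp q hη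

end Flat

/-! ### Vector fields and their brackets in coordinates. -/

section Bracket

open LieGroupoidExtension

variable {F N : Type*} [NormedAddCommGroup F] [NormedSpace ℝ F] [TopologicalSpace N]
  [ChartedSpace F N] [IsManifold 𝓘(ℝ, F) ∞ N]

/-- A vector field in the chart at `n₀`. -/
def fieldLoc (n₀ : N) (U : N → F) (q : F) : F := dchart F n₀ (param F n₀ q) (U (param F n₀ q))

theorem contDiffAt_fieldLoc {n₀ n : N} (hn : n ∈ dom F n₀) {U : N → F}
    (hU : SmoothFieldAt (fun n : N => (U n : TangentSpace 𝓘(ℝ, F) n)) n) :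
    ContDiffAt ℝ ∞ (fieldLoc n₀ U) (chart F n₀ n) := by
  have h1 := ((contMDiffAt_tangent_iff (f := fun n : N => n) (v := U) hn).1 hU).2
  exact contMDiffAt_iff_contDiffAt.1 (ContMDiffAt.comp (chart F n₀ n) (f := param F n₀) (by
    rw [param_chart hn]; exact h1) (contMDiffAt_param hn))

/-- Naturality of the bracket under pullback by `param`. Differentiability at the point suffices,
which allows the application to horizontal lifts that are only checked to be of class `C¹`. -/
theorem lieBracket_fieldLoc [CompleteSpace F] {n₀ n : N} (hn : n ∈ dom F n₀) {U W : N → F}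
    (hU : MDifferentiableAt 𝓘(ℝ, F) 𝓘(ℝ, F).tangent
      (fun n => (⟨n, U n⟩ : TangentBundle 𝓘(ℝ, F) N)) n)
    (hW : MDifferentiableAt 𝓘(ℝ, F) 𝓘(ℝ, F).tangent
      (fun n => (⟨n, W n⟩ : TangentBundle 𝓘(ℝ, F) N)) n) :
    dparam F n₀ n (lieBracket ℝ (fieldLoc n₀ U) (fieldLoc n₀ W) (chart F n₀ n)) =
      (mlieBracket 𝓘(ℝ, F) (fun n : N => (U n : TangentSpace 𝓘(ℝ, F) n)) (fun n => W n) n : F) := by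
  have : IsManifold 𝓘(ℝ, F) (minSmoothness ℝ 2) N := IsManifold.of_le minSmoothness_two_le_infty
  have hinv : ∀ᶠ q in 𝓝 (chart F n₀ n), (mfderiv 𝓘(ℝ, F) 𝓘(ℝ, F) (param F n₀) q).inverse =
      dchart F n₀ (param F n₀ q) := by
    filter_upwards [param_mem_dom_eventually hn, chart_param_eventually hn] with q h1 h2
    have h3 : mfderiv 𝓘(ℝ, F) 𝓘(ℝ, F) (param F n₀) q = dparam F n₀ (param F n₀ q) := by
      rw [dparam, h2]
      rfl
    rw [h3]
    refine ContinuousLinearMap.inverse_eq ?_ ?_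
    · exact ContinuousLinearMap.ext fun v => dparam_dchart h1 v
    · exact ContinuousLinearMap.ext fun v => dchart_dparam h1 v
  have key := mpullback_mlieBracket (I := 𝓘(ℝ, F)) (I' := 𝓘(ℝ, F)) (f := param F n₀)
    (V := fun n => U n) (W := fun n => W n)
    (x₀ := chart F n₀ n) (by rwa [param_chart hn]) (by rwa [param_chart hn]) (contMDiffAt_param hn)
    minSmoothness_two_le_infty
  have hpb : ∀ U : N → F, mpullback 𝓘(ℝ, F) 𝓘(ℝ, F) (param F n₀)
      (fun n : N => (U n : TangentSpace 𝓘(ℝ, F) n)) =ᶠ[𝓝 (chart F n₀ n)] fieldLoc n₀ U := by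
    intro U
    filter_upwards [hinv] with q hq
    exact congrArg (fun L : F →L[ℝ] F => L (U (param F n₀ q))) hq
  have hflat : ∀ (U W : ∀ q : F, TangentSpace 𝓘(ℝ, F) q) (q : F),
      mlieBracket 𝓘(ℝ, F) U W q = lieBracket ℝ (E := F) U W q := by
    intro U W q
    rw [← mlieBracketWithin_univ, mlieBracketWithin_eq_lieBracketWithin]
    exact congrFun (lieBracketWithin_univ (𝕜 := ℝ) (E := F)) q
  rw [(hpb U).mlieBracket_vectorField_eq (hpb W), mpullback_apply, hinv.self_of_nhds,
    param_chart hn] at key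
  have key' := congrArg (dparam F n₀ n) (key.trans (hflat _ _ _))
  rw [← key']
  exact dparam_dchart hn _

end Bracket

/-! ### The exterior covariant derivative on `M`. -/

namespace LieGroupoidExtension

variable {E₀ E₁ E₂ M X Y : Type*}
  [NormedAddCommGroup E₀] [NormedSpace ℝ E₀] [NormedAddCommGroup E₁] [NormedSpace ℝ E₁]
  [NormedAddCommGroup E₂] [NormedSpace ℝ E₂]
  [TopologicalSpace M] [ChartedSpace E₀ M] [TopologicalSpace X] [ChartedSpace E₁ X]
  [TopologicalSpace Y] [ChartedSpace E₂ Y]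
  {𝓔 : LieGroupoidExtension E₀ E₁ E₂ M X Y}
  [IsManifold 𝓘(ℝ, E₀) ∞ M] [IsManifold 𝓘(ℝ, E₁) ∞ X] [IsManifold 𝓘(ℝ, E₂) ∞ Y]
  [FiniteDimensional ℝ E₀] [FiniteDimensional ℝ E₁]
  {α : 𝓔.ArrowForm 1}

/-- The value at `m` of the exterior covariant derivative of `η`, in the charts at `m₀` and
`e m₀`. -/
def extLoc (α : 𝓔.ArrowForm 1) {k : ℕ} (η : 𝓔.BaseForm k) (m₀ m : M) :
    E₀ [⋀^Fin (k + 1)]→L[ℝ] E₁ :=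
  (dparam E₁ (𝓔.e m₀) (𝓔.e m)).compContinuousAlternatingMap
    ((covExt (Gam α m₀) (η.loc m₀ m₀) (chart E₀ m₀ m)).compContinuousLinearMap (dchart E₀ m₀ m))

theorem smoothSectionAt_eval {k : ℕ} (η : 𝓔.BaseForm k) {m : M} {V : Fin k → M → E₀}
    (hV : ∀ i, SmoothFieldAt (fun m : M => (V i m : TangentSpace 𝓘(ℝ, E₀) m)) m) :
    𝓔.SmoothSectionAt (fun m => η.valE m fun i => V i m) m :=
  ⟨η.smooth m (fun i m => V i m) hV, Filter.Eventually.of_forall fun m => η.mem m _⟩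

theorem secLoc_eval {k : ℕ} (η : 𝓔.BaseForm k) {m₀ m : M} (hm : m ∈ dom E₀ m₀)
    (V : Fin k → M → E₀) :
    𝓔.secLoc m₀ (fun m => η.valE m fun i => V i m) =ᶠ[𝓝 (chart E₀ m₀ m)]
      fun q => η.loc m₀ m₀ q fun i => fieldLoc m₀ (V i) q := by
  filter_upwards [param_mem_dom_eventually hm] with q hq
  simp only [secLoc, Form.loc, fieldLoc]
  change _ = dchart E₁ _ _ (η.valE (param E₀ m₀ q) fun i => dparam E₀ m₀ (param E₀ m₀ q) _)
  simp only [dparam_dchart hq]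

/-- The covariant derivative on the model spaces. -/
def covE (α : 𝓔.ArrowForm 1) (σ : M → E₁) (m : M) (v : E₀) : E₁ := α.covDeriv σ m v

/-- The right side mentions no chart. So the coordinate expression satisfies the defining formula of
`IsExtCovDeriv`, and is independent of `m₀`. -/
theorem extLoc_eq (hα : IsRightConnection α) {k : ℕ} (η : 𝓔.BaseForm (k + 1)) {m₀ m : M}
    (hm : m ∈ dom E₀ m₀) (he : 𝓔.e m ∈ dom E₁ (𝓔.e m₀)) {V : Fin (k + 2) → M → E₀}
    (hV : ∀ i, SmoothFieldAt (fun m : M => (V i m : TangentSpace 𝓘(ℝ, E₀) m)) m) :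
    extLoc α η m₀ m (fun i => V i m) =
      (∑ i : Fin (k + 2), (-1 : ℝ) ^ (i : ℕ) •
        covE α (fun m' => η.valE m' (i.removeNth (fun l => V l m'))) m (V i m)) -
      ∑ i : Fin (k + 1), ∑ j ∈ Finset.Ici i, (-1 : ℝ) ^ (i + j : ℕ) •
        η.valE m (Matrix.vecCons (mlieBracket 𝓘(ℝ, E₀)
            (fun m : M => (V i.castSucc m : TangentSpace 𝓘(ℝ, E₀) m)) (fun m => V j.succ m) m : E₀)
          (j.removeNth (i.castSucc.removeNth (fun l => V l m)))) := by
  have hV0 : (fun i => dchart E₀ m₀ m (V i m)) = fun i => fieldLoc m₀ (V i) (chart E₀ m₀ m) := by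
    simp only [fieldLoc, param_chart hm]
  have hη := (η.contDiffAt_loc (n₀ := m₀) (m₀ := m₀) hm he).differentiableAt (by simp)
  have hVd : ∀ i, DifferentiableAt ℝ (fieldLoc m₀ (V i)) (chart E₀ m₀ m) :=
    fun i => (contDiffAt_fieldLoc hm (hV i)).differentiableAt (by simp)
  change dparam E₁ (𝓔.e m₀) (𝓔.e m) (covExt (Gam α m₀) (η.loc m₀ m₀) (chart E₀ m₀ m)
    fun i => dchart E₀ m₀ m (V i m)) = _
  rw [hV0, covExt_apply_vectorField hη hVd]
  simp only [map_sub, map_sum, map_smul]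
  congr 1
  · refine Finset.sum_congr rfl fun i _ => congrArg _ ?_
    have h1 := (smoothSectionAt_eval η (V := i.removeNth V) (m := m) fun j => hV _).covDeriv_eq hα
      hm he (V i m)
    have h2 := secLoc_eval η hm (i.removeNth V)
    refine Eq.trans ?_ h1.symm
    rw [covLoc, h2.fderiv_eq, h2.self_of_nhds]
    simp only [fieldLoc, param_chart hm]
    rfl
  · refine Finset.sum_congr rfl fun i _ => Finset.sum_congr rfl fun j _ => congrArg _ ?_
    simp only [Form.loc, param_chart hm]
    change dparam E₁ _ _ (dchart E₁ _ _ (η.valE m fun l => dparam E₀ m₀ m _)) = _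
    rw [dparam_dchart he]
    congr 1
    funext l
    refine Fin.cases ?_ (fun l => ?_) l
    · exact lieBracket_fieldLoc hm (ContMDiffAt.mdifferentiableAt (n := ∞) (hV _) (by simp))
        (ContMDiffAt.mdifferentiableAt (n := ∞) (hV _) (by simp))
    · simp only [Matrix.cons_val_succ, Fin.removeNth, fieldLoc, param_chart hm, dparam_dchart hm]
      rfl

end LieGroupoidExtension

namespace LieGroupoidExtension

variable {E₀ E₁ E₂ M X Y : Type*}
  [NormedAddCommGroup E₀] [NormedSpace ℝ E₀] [NormedAddCommGroup E₁] [NormedSpace ℝ E₁]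
  [NormedAddCommGroup E₂] [NormedSpace ℝ E₂]
  [TopologicalSpace M] [ChartedSpace E₀ M] [TopologicalSpace X] [ChartedSpace E₁ X]
  [TopologicalSpace Y] [ChartedSpace E₂ Y]
  {𝓔 : LieGroupoidExtension E₀ E₁ E₂ M X Y}
  [IsManifold 𝓘(ℝ, E₀) ∞ M] [IsManifold 𝓘(ℝ, E₁) ∞ X] [IsManifold 𝓘(ℝ, E₂) ∞ Y]
  [FiniteDimensional ℝ E₀] [FiniteDimensional ℝ E₁]
  {α : 𝓔.ArrowForm 1}

theorem unit_mem_dom_eventually {m₀ m : M} (he : 𝓔.e m ∈ dom E₁ (𝓔.e m₀)) :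
    ∀ᶠ m' in 𝓝 m, 𝓔.e m' ∈ dom E₁ (𝓔.e m₀) :=
  (𝓔.contMDiff_e m).continuousAt.preimage_mem_nhds ((isOpen_dom _).mem_nhds he)

theorem extLoc_mem (hα : IsRightConnection α) {k : ℕ} (η : 𝓔.BaseForm (k + 1)) (m : M)
    (v : Fin (k + 2) → E₀) : extLoc α η m m v ∈ 𝓔.K m := by
  have h := extLoc_eq hα η (mem_dom_self m) (mem_dom_self (𝓔.e m))
    (V := fun i m' => dparam E₀ m m' (v i)) fun i => smoothFieldAt_dparam (mem_dom_self m) (v i)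
  simp only [dparam_self] at h
  change extLoc α η m m v = _ at h
  rw [h]
  refine sub_mem (sum_mem fun i _ => Submodule.smul_mem _ _ ?_)
    (sum_mem fun i _ => sum_mem fun j _ => Submodule.smul_mem _ _ (η.mem m _))
  have h1 := smoothSectionAt_eval η (m := m) (V := i.removeNth fun i m' => dparam E₀ m m' (v i))
    fun j => smoothFieldAt_dparam (mem_dom_self m) _
  have h2 := h1.covLoc_mem hα (mem_dom_self m) (mem_dom_self (𝓔.e m)) (v i)
  rw [← h1.covDeriv_eq hα (mem_dom_self m) (mem_dom_self (𝓔.e m)) (v i)] at h2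
  exact h2

theorem extLoc_congr (hα : IsRightConnection α) {k : ℕ} (η : 𝓔.BaseForm (k + 1)) {m₀ m : M}
    (hm : m ∈ dom E₀ m₀) (he : 𝓔.e m ∈ dom E₁ (𝓔.e m₀)) : extLoc α η m m = extLoc α η m₀ m := by
  ext v
  have hV : ∀ i : Fin (k + 2),
      SmoothFieldAt (fun m' : M => (dparam E₀ m m' (v i) : TangentSpace 𝓘(ℝ, E₀) m')) m :=
    fun i => smoothFieldAt_dparam (mem_dom_self m) (v i)
  have h := (extLoc_eq hα η (mem_dom_self m) (mem_dom_self (𝓔.e m)) hV).trans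
    (extLoc_eq hα η hm he hV).symm
  simp only [dparam_self] at h
  exact h

/-- The exterior covariant derivative of a form on `M`. -/
def extForm (hα : IsRightConnection α) {k : ℕ} (η : 𝓔.BaseForm (k + 1)) : 𝓔.BaseForm (k + 2) where
  val m := extLoc α η m m
  mem m v := extLoc_mem hα η m v
  smooth m₀ V hV := by
    refine (contMDiffAt_tangent_iff (f := fun m => 𝓔.e m)
      (v := fun m => extLoc α η m m fun i => V i m) (mem_dom_self (𝓔.e m₀))).2 ⟨𝓔.contMDiff_e m₀, ?_⟩
    have hm := mem_dom_self (F := E₀) m₀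
    have he := mem_dom_self (F := E₁) (𝓔.e m₀)
    have h1 : ContDiffAt ℝ ∞ (fun q => covExt (Gam α m₀) (η.loc m₀ m₀) q
        fun i => fieldLoc m₀ (V i) q) (chart E₀ m₀ m₀) := by
      refine ContDiffAt.continuousAlternatingMap_apply ?_ ?_
      · exact ContDiffAt.covExt (contDiffAt_Gam α hm he) (η.contDiffAt_loc hm he)
      · exact contDiffAt_pi.2 fun i => contDiffAt_fieldLoc hm (hV i)
    refine (ContMDiffAt.comp m₀ h1.contMDiffAt (contMDiffAt_chart hm)).congr_of_eventuallyEq ?_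
    filter_upwards [(isOpen_dom m₀).mem_nhds hm, unit_mem_dom_eventually he] with m h2 h3
    -- The value at `m` is defined by the chart at the moving point `m`; smoothness is visible only
    -- in the fixed chart at `m₀`.
    rw [extLoc_congr hα η h2 h3]
    let W : Fin (k + 2) → M → E₀ := fun i m => V i m
    change dchart E₁ (𝓔.e m₀) (𝓔.e m) (dparam E₁ (𝓔.e m₀) (𝓔.e m) _) =
      covExt (Gam α m₀) (η.loc m₀ m₀) (chart E₀ m₀ m) fun i => fieldLoc m₀ (W i) (chart E₀ m₀ m)
    simp only [fieldLoc, param_chart h2]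
    exact dchart_dparam h3 _

theorem isExtCovDeriv_extForm (hα : IsRightConnection α) {k : ℕ} (η : 𝓔.BaseForm (k + 1)) :
    α.IsExtCovDeriv η fun m v => (extForm hα η).val m v :=
  fun m _ hV => extLoc_eq hα η (mem_dom_self m) (mem_dom_self (𝓔.e m)) hV

/-- Any tuple of tangent vectors extends to smooth fields, with constant coordinates, so the formula
on fields determines the form. -/
theorem IsExtCovDeriv.eq_extLoc (hα : IsRightConnection α) {k : ℕ} {η : 𝓔.BaseForm (k + 1)}
    {θ : 𝓔.BaseForm (k + 2)} (h : α.IsExtCovDeriv η fun m v => θ.val m v) (m : M) :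
    θ.valE m = extLoc α η m m := by
  ext v
  have hV : ∀ i : Fin (k + 2),
      SmoothFieldAt (fun m' : M => (dparam E₀ m m' (v i) : TangentSpace 𝓘(ℝ, E₀) m')) m :=
    fun i => smoothFieldAt_dparam (mem_dom_self m) (v i)
  have h := (h m (fun i m' => dparam E₀ m m' (v i)) hV).trans
    (extLoc_eq hα η (mem_dom_self m) (mem_dom_self (𝓔.e m)) hV).symm
  simp only [dparam_self] at h
  exact h

theorem Form.ext_val {k : ℕ} {η θ : 𝓔.BaseForm k} (h : ∀ m, η.valE m = θ.valE m) : η = θ := by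
  obtain ⟨a, _, _⟩ := η
  obtain ⟨b, _, _⟩ := θ
  obtain rfl : a = b := funext h
  rfl

theorem existsUnique_isExtCovDeriv (hα : IsRightConnection α) {k : ℕ} (η : 𝓔.BaseForm (k + 1)) :
    ∃! θ : 𝓔.BaseForm (k + 2), α.IsExtCovDeriv η fun m v => θ.val m v :=
  ⟨extForm hα η, isExtCovDeriv_extForm hα η, fun _ h =>
    Form.ext_val fun m => IsExtCovDeriv.eq_extLoc hα h m⟩

/-- Equality is needed on a neighbourhood because the exterior derivative is to be differentiated
once more. -/
theorem IsExtCovDeriv.loc_eventuallyEq (hα : IsRightConnection α) {k : ℕ} {η : 𝓔.BaseForm (k + 1)}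
    {θ : 𝓔.BaseForm (k + 2)} (h : α.IsExtCovDeriv η fun m v => θ.val m v) {m₀ m : M}
    (hm : m ∈ dom E₀ m₀) (he : 𝓔.e m ∈ dom E₁ (𝓔.e m₀)) :
    θ.loc m₀ m₀ =ᶠ[𝓝 (chart E₀ m₀ m)] covExt (Gam α m₀) (η.loc m₀ m₀) := by
  filter_upwards [param_mem_dom_eventually hm, chart_param_eventually hm,
    (tendsto_param hm).eventually (unit_mem_dom_eventually he)] with q h1 h2 h3
  ext v
  rw [Form.loc, IsExtCovDeriv.eq_extLoc hα h, extLoc_congr hα η h1 h3, extLoc, h2]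
  change dchart E₁ _ _ (dparam E₁ _ _ (covExt _ _ q fun i => dchart E₀ _ _ (dparam E₀ _ _ (v i)))) = _
  simp only [dchart_dparam h3, dchart_dparam h1]

theorem isExtCovDeriv_zero (hα : IsRightConnection α) {k : ℕ} {η : 𝓔.BaseForm (k + 1)}
    (h : ∀ m, covExt (Gam α m) (η.loc m m) (chart E₀ m m) = 0) :
    α.IsExtCovDeriv η fun _ _ => 0 := by
  intro m V hV
  refine Eq.trans ?_ (extLoc_eq hα η (mem_dom_self m) (mem_dom_self (𝓔.e m)) hV)
  rw [extLoc, h m]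
  exact (map_zero (dparam E₁ (𝓔.e m) (𝓔.e m))).symm

end LieGroupoidExtension

/-! ### Curvature and Bianchi identities on a vector space. -/

section FlatForms

variable {E F : Type*} [NormedAddCommGroup E] [NormedSpace ℝ E] [NormedAddCommGroup F]
  [NormedSpace ℝ F]

theorem covExt_two_apply {Γ : E → E →L[ℝ] F →L[ℝ] F} {η : E → E [⋀^Fin 2]→L[ℝ] F} {q : E}
    (u v w : E) :
    covExt Γ η q ![u, v, w] =
      (fderiv ℝ η q u ![v, w] + Γ q u (η q ![v, w])) -
      (fderiv ℝ η q v ![u, w] + Γ q v (η q ![u, w])) +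
      (fderiv ℝ η q w ![u, v] + Γ q w (η q ![u, v])) := by
  have h0 : (0 : Fin 3).removeNth ![u, v, w] = ![v, w] := by ext i; fin_cases i <;> rfl
  have h1 : (1 : Fin 3).removeNth ![u, v, w] = ![u, w] := by ext i; fin_cases i <;> rfl
  have h2 : (2 : Fin 3).removeNth ![u, v, w] = ![u, v] := by ext i; fin_cases i <;> rfl
  rw [covExt_apply, Fin.sum_univ_three, h0, h1, h2]
  simp
  abel

theorem covExt_three_apply {Γ : E → E →L[ℝ] F →L[ℝ] F} {η : E → E [⋀^Fin 3]→L[ℝ] F} {q : E}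
    (u v w z : E) :
    covExt Γ η q ![u, v, w, z] =
      (fderiv ℝ η q u ![v, w, z] + Γ q u (η q ![v, w, z])) -
      (fderiv ℝ η q v ![u, w, z] + Γ q v (η q ![u, w, z])) +
      (fderiv ℝ η q w ![u, v, z] + Γ q w (η q ![u, v, z])) -
      (fderiv ℝ η q z ![u, v, w] + Γ q z (η q ![u, v, w])) := by
  have h0 : (0 : Fin 4).removeNth ![u, v, w, z] = ![v, w, z] := by ext i; fin_cases i <;> rfl
  have h1 : (1 : Fin 4).removeNth ![u, v, w, z] = ![u, w, z] := by ext i; fin_cases i <;> rfl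
  have h2 : (2 : Fin 4).removeNth ![u, v, w, z] = ![u, v, z] := by ext i; fin_cases i <;> rfl
  have h3 : (3 : Fin 4).removeNth ![u, v, w, z] = ![u, v, w] := by ext i; fin_cases i <;> rfl
  rw [covExt_apply, Fin.sum_univ_four, h0, h1, h2, h3]
  simp [pow_succ]
  abel

/-- The curvature of the connection with the coefficients `Γ`. -/
def connCurv (Γ : E → E →L[ℝ] F →L[ℝ] F) (q u v : E) (ξ : F) : F :=
  fderiv ℝ Γ q u v ξ - fderiv ℝ Γ q v u ξ + (Γ q u (Γ q v ξ) - Γ q v (Γ q u ξ))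

theorem fderiv_alternating_apply {k : ℕ} {η : E → E [⋀^Fin k]→L[ℝ] F} {q : E}
    (h : DifferentiableAt ℝ η q) (w : Fin k → E) (u : E) :
    fderiv ℝ (fun q => η q w) q u = fderiv ℝ η q u w := by
  have := (ContinuousAlternatingMap.apply ℝ E F w).hasFDerivAt.comp q h.hasFDerivAt
  exact congrArg (fun L : E →L[ℝ] F => L u) this.fderiv

/-- The square of the exterior covariant derivative is the wedge product with the curvature: second
derivatives of `η` cancel by symmetry, and first derivatives cancel between the two places where `Γ`
occurs. -/
theorem covExt_covExt_two {Γ : E → E →L[ℝ] F →L[ℝ] F} {η : E → E [⋀^Fin 2]→L[ℝ] F} {q : E}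
    (hΓ : ContDiffAt ℝ ∞ Γ q) (hη : ContDiffAt ℝ ∞ η q) (a b c d : E) :
    covExt Γ (covExt Γ η) q ![a, b, c, d] =
      connCurv Γ q a b (η q ![c, d]) - connCurv Γ q a c (η q ![b, d]) +
      connCurv Γ q a d (η q ![b, c]) + connCurv Γ q b c (η q ![a, d]) -
      connCurv Γ q b d (η q ![a, c]) + connCurv Γ q c d (η q ![a, b]) := by
  have hD : ∀ u x y z : E, fderiv ℝ (covExt Γ η) q u ![x, y, z] =
      (fderiv ℝ (fderiv ℝ η) q u x ![y, z] + fderiv ℝ Γ q u x (η q ![y, z]) +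
        Γ q x (fderiv ℝ η q u ![y, z])) -
      (fderiv ℝ (fderiv ℝ η) q u y ![x, z] + fderiv ℝ Γ q u y (η q ![x, z]) +
        Γ q y (fderiv ℝ η q u ![x, z])) +
      (fderiv ℝ (fderiv ℝ η) q u z ![x, y] + fderiv ℝ Γ q u z (η q ![x, y]) +
        Γ q z (fderiv ℝ η q u ![x, y])) := by
    intro u x y z
    rw [← fderiv_alternating_apply ((hΓ.covExt hη).differentiableAt (by simp))]
    simp only [covExt_two_apply]
    have hη' := (hη.differentiableAt (by simp)).hasFDerivAt
    have hη2 := ((hη.fderiv_right (m := ∞) (by simp)).differentiableAt (by simp)).hasFDerivAt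
    have hΓ' := (hΓ.differentiableAt (by simp)).hasFDerivAt
    have e1 : ∀ x y z : E,
        HasFDerivAt (fun q => fderiv ℝ η q x ![y, z] + Γ q x (η q ![y, z])) _ q := fun x y z =>
      ((ContinuousAlternatingMap.apply ℝ E F ![y, z]).hasFDerivAt.comp q
        (hη2.clm_apply (hasFDerivAt_const x q))).add
      ((hΓ'.clm_apply (hasFDerivAt_const x q)).clm_apply
        ((ContinuousAlternatingMap.apply ℝ E F ![y, z]).hasFDerivAt.comp q hη'))
    refine (congrArg (fun L : E →L[ℝ] F => L u)
      (((e1 x y z).sub (e1 y x z)).add (e1 z x y)).fderiv).trans ?_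
    simp
    abel
  have hs : ∀ u v w, fderiv ℝ (fderiv ℝ η) q u v w = fderiv ℝ (fderiv ℝ η) q v u w := by
    intro u v w
    rw [(hη.isSymmSndFDerivAt minSmoothness_two_le_infty).eq]
  rw [covExt_three_apply]
  simp only [hD, covExt_two_apply, map_add, map_sub, connCurv]
  rw [hs b a, hs c a, hs d a, hs c b, hs d b, hs d c]
  abel

theorem covExt_apply_extDeriv {k : ℕ} (Γ : E → E →L[ℝ] F →L[ℝ] F) (η : E → E [⋀^Fin k]→L[ℝ] F) (q : E)
    (v : Fin (k + 1) → E) :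
    covExt Γ η q v = extDeriv η q v + ∑ i : Fin (k + 1), (-1 : ℝ) ^ (i : ℕ) • Γ q (v i) (η q (i.removeNth v)) := by
  rw [covExt_apply, extDeriv, ContinuousAlternatingMap.alternatizeUncurryFin_apply]
  simp only [negOne_pow_zsmul, smul_add, Finset.sum_add_distrib]

theorem covExt_pullback {E' : Type*} [NormedAddCommGroup E'] [NormedSpace ℝ E'] {k : ℕ}
    {Γ : E' → E' →L[ℝ] F →L[ℝ] F} {η : E' → E' [⋀^Fin k]→L[ℝ] F} {f : E → E'} {q : E}
    (hη : DifferentiableAt ℝ η (f q)) (hf : ContDiffAt ℝ ∞ f q) (v : Fin (k + 1) → E) :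
    covExt (fun q => (Γ (f q)).comp (fderiv ℝ f q))
      (fun q => (η (f q)).compContinuousLinearMap (fderiv ℝ f q)) q v =
      covExt Γ η (f q) fun i => fderiv ℝ f q (v i) := by
  rw [covExt_apply_extDeriv, covExt_apply_extDeriv,
    extDeriv_pullback hη hf minSmoothness_two_le_infty]
  rfl

/-- The Leibniz rule, arranged so that derivatives of `A` appear only in the combinations `D_u A +
G_u A`. For the adjoint action these are what `fderiv_adI_operator` evaluates in horizontal
directions. -/
theorem covExt_endomorphism_two {G : E → E →L[ℝ] F →L[ℝ] F} {A : E → F →L[ℝ] F}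
    {σ : E → E [⋀^Fin 2]→L[ℝ] F} {q : E} (hA : DifferentiableAt ℝ A q)
    (hσ : DifferentiableAt ℝ σ q) (u v w : E) :
    covExt G (fun q => (A q).compContinuousAlternatingMap (σ q)) q ![u, v, w] =
      A q (extDeriv σ q ![u, v, w]) +
      ((fderiv ℝ A q u (σ q ![v, w]) + G q u (A q (σ q ![v, w]))) -
        (fderiv ℝ A q v (σ q ![u, w]) + G q v (A q (σ q ![u, w]))) +
        (fderiv ℝ A q w (σ q ![u, v]) + G q w (A q (σ q ![u, v])))) := by
  have h1 : extDeriv σ q = covExt (fun _ => (0 : E →L[ℝ] F →L[ℝ] F)) σ q := by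
    ext v
    rw [covExt_apply_extDeriv]
    simp
  have h2 : ∀ x y z, fderiv ℝ (fun q => (A q).compContinuousAlternatingMap (σ q)) q x ![y, z] =
      fderiv ℝ A q x (σ q ![y, z]) + A q (fderiv ℝ σ q x ![y, z]) := by
    intro x y z
    let J : (F →L[ℝ] F) →L[ℝ] (E [⋀^Fin 2]→L[ℝ] F) →L[ℝ] E [⋀^Fin 2]→L[ℝ] F :=
      ContinuousLinearMap.compContinuousAlternatingMapCLM ℝ E F F (Fin 2)
    have hJ : HasFDerivAt (fun L : F →L[ℝ] F => J L) J (A q) :=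
      ContinuousLinearMap.hasFDerivAt (𝕜 := ℝ) (E := F →L[ℝ] F)
        (F := (E [⋀^Fin 2]→L[ℝ] F) →L[ℝ] E [⋀^Fin 2]→L[ℝ] F) J
    have h3 := HasFDerivAt.comp (𝕜 := ℝ) (F := F →L[ℝ] F)
      (G := (E [⋀^Fin 2]→L[ℝ] F) →L[ℝ] E [⋀^Fin 2]→L[ℝ] F) (g := fun L => J L) (g' := J) q hJ
      hA.hasFDerivAt
    have h4 := h3.clm_apply hσ.hasFDerivAt
    refine (congrArg (fun L : E →L[ℝ] E [⋀^Fin 2]→L[ℝ] F => L x ![y, z]) h4.fderiv).trans ?_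
    simp
    exact add_comm _ _
  rw [h1]
  simp only [covExt_two_apply, h2, map_add, map_sub, zero_apply, add_zero,
    ContinuousLinearMap.compContinuousAlternatingMap_coe, Function.comp_apply]
  abel

/-- The Bianchi identity for a form with values in a trivial bundle which is decomposed along its
kernel. -/
theorem covExt_curvature {a : E → E →L[ℝ] F} {G : E → E →L[ℝ] F →L[ℝ] F} {Q : E → F →L[ℝ] F →L[ℝ] F}
    {κ : E → E [⋀^Fin 2]→L[ℝ] F} {q : E} (ha : ContDiffAt ℝ ∞ a q) (hG : DifferentiableAt ℝ G q)
    (hQ : DifferentiableAt ℝ Q q) (hκ : DifferentiableAt ℝ κ q)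
    (h : ∀ᶠ p in 𝓝 q, ∀ u v, fderiv ℝ a p u v - fderiv ℝ a p v u =
      κ p ![u, v] + G p v (a p u) - G p u (a p v) + Q p (a p u) (a p v))
    {u v : E} (hu : a q u = 0) (hv : a q v = 0) (w : E) :
    covExt G κ q ![u, v, w] =
      connCurv G q u v (a q w) - Q q (fderiv ℝ a q u v - fderiv ℝ a q v u) (a q w) := by
  have ha' := (ha.differentiableAt (by simp)).hasFDerivAt
  have ha2 := ((ha.fderiv_right (m := ∞) (by simp)).differentiableAt (by simp)).hasFDerivAt
  have hG' := hG.hasFDerivAt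
  have hQ' := hQ.hasFDerivAt
  have hκ' := hκ.hasFDerivAt
  have hs : ∀ u v w, fderiv ℝ (fderiv ℝ a) q u v w = fderiv ℝ (fderiv ℝ a) q v u w := by
    intro u v w
    rw [(ha.isSymmSndFDerivAt minSmoothness_two_le_infty).eq]
  -- The structure equation is solved for `κ` and differentiated. In the alternating sum the second
  -- derivatives of `a` cancel by symmetry, and `a u = a v = 0` removes most other terms.
  have hD : ∀ x y z : E, fderiv ℝ κ q x ![y, z] =
      fderiv ℝ (fderiv ℝ a) q x y z - fderiv ℝ (fderiv ℝ a) q x z y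
      - (fderiv ℝ G q x z (a q y) + G q z (fderiv ℝ a q x y))
      + (fderiv ℝ G q x y (a q z) + G q y (fderiv ℝ a q x z))
      - (fderiv ℝ Q q x (a q y) (a q z) + Q q (fderiv ℝ a q x y) (a q z)
        + Q q (a q y) (fderiv ℝ a q x z)) := by
    intro x y z
    have c : ∀ y : E, HasFDerivAt (fun _ : E => y) (0 : E →L[ℝ] E) q := fun y => hasFDerivAt_const y q
    have e1 : ∀ y z : E, HasFDerivAt (fun q => fderiv ℝ a q y z) _ q := fun y z =>
      (ha2.clm_apply (c y)).clm_apply (c z)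
    have e2 : ∀ y z : E, HasFDerivAt (fun q => G q z (a q y)) _ q := fun y z =>
      (hG'.clm_apply (c z)).clm_apply (ha'.clm_apply (c y))
    have e3 : HasFDerivAt (fun q => Q q (a q y) (a q z)) _ q :=
      (hQ'.clm_apply (ha'.clm_apply (c y))).clm_apply (ha'.clm_apply (c z))
    have e4 : HasFDerivAt (fun q => κ q ![y, z]) _ q :=
      (ContinuousAlternatingMap.apply ℝ E F ![y, z]).hasFDerivAt.comp q hκ'
    have e5 := ((((e1 y z).sub (e1 z y)).sub (e2 y z)).add (e2 z y)).sub e3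
    have e6 := e4.unique (e5.congr_of_eventuallyEq (by
      filter_upwards [h] with p hp
      have := hp y z
      simp only [Pi.sub_apply, Pi.add_apply]
      rw [this]
      abel))
    have e7 := congrArg (fun L : E →L[ℝ] F => L x) e6
    simp at e7
    rw [e7]
    abel
  have h0 := h.self_of_nhds
  have b1 : κ q ![u, v] = fderiv ℝ a q u v - fderiv ℝ a q v u := by
    rw [h0 u v, hu, hv]; simp
  have b2 : κ q ![v, w] = fderiv ℝ a q v w - fderiv ℝ a q w v + G q v (a q w) := by
    rw [h0 v w, hv]; simp
  have b3 : κ q ![u, w] = fderiv ℝ a q u w - fderiv ℝ a q w u + G q u (a q w) := by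
    rw [h0 u w, hu]; simp
  rw [covExt_two_apply, b1, b2, b3]
  simp only [hD, hu, hv, map_zero, map_add, map_sub, zero_apply, connCurv,
    sub_apply]
  rw [hs v u, hs w u, hs w v]
  abel

end FlatForms

/-! ### Smooth operators extending fundamental vectors and the adjoint action. -/

namespace LieGroupoidExtension

variable {E₀ E₁ E₂ M X Y : Type*}
  [NormedAddCommGroup E₀] [NormedSpace ℝ E₀] [NormedAddCommGroup E₁] [NormedSpace ℝ E₁]
  [NormedAddCommGroup E₂] [NormedSpace ℝ E₂]
  [TopologicalSpace M] [ChartedSpace E₀ M] [TopologicalSpace X] [ChartedSpace E₁ X]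
  [TopologicalSpace Y] [ChartedSpace E₂ Y]
  {𝓔 : LieGroupoidExtension E₀ E₁ E₂ M X Y}
  [IsManifold 𝓘(ℝ, E₀) ∞ M] [IsManifold 𝓘(ℝ, E₁) ∞ X] [IsManifold 𝓘(ℝ, E₂) ∞ Y]

/-- A family of linear maps on the bundle of Lie algebras, given by the derivatives at the units of
a smooth family of maps on the kernels, extends to a smooth family of operators in charts. -/
theorem exists_smooth_operator {b : X → M} (hb : ContMDiff 𝓘(ℝ, E₁) 𝓘(ℝ, E₀) ∞ b) {Ψ : X → X → X}
    (hΨ : ∀ (f g : E₁ × E₁ → X) (p : E₁ × E₁), ContMDiffAt 𝓘(ℝ, E₁ × E₁) 𝓘(ℝ, E₁) ∞ f p →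
      ContMDiffAt 𝓘(ℝ, E₁ × E₁) 𝓘(ℝ, E₁) ∞ g p → (∀ᶠ q in 𝓝 p, g q ∈ 𝓔.ker (b (f q))) →
      ContMDiffAt 𝓘(ℝ, E₁ × E₁) 𝓘(ℝ, E₁) ∞ (fun q => Ψ (f q) (g q)) p)
    {D : X → E₁ →L[ℝ] E₁}
    (hD : ∀ (x : X) (k : ℝ → X), MDifferentiableAt 𝓘(ℝ, ℝ) 𝓘(ℝ, E₁) k 0 → k 0 = 𝓔.e (b x) →
      (∀ᶠ r in 𝓝 0, k r ∈ 𝓔.ker (b x)) → tmap ℝ E₁ (fun r => Ψ x (k r)) 0 1 = D x (tmap ℝ E₁ k 0 1))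
    {x₁ y₀ : X} (hy : Ψ x₁ (𝓔.e (b x₁)) ∈ dom E₁ y₀) :
    ∃ A : E₁ → E₁ →L[ℝ] E₁, ContDiffAt ℝ ∞ A (chart E₁ x₁ x₁) ∧
      ∀ᶠ x in 𝓝 x₁, ∀ ξ ∈ 𝓔.K (b x),
        A (chart E₁ x₁ x) (dchart E₁ (𝓔.e (b x₁)) (𝓔.e (b x)) ξ) =
          dchart E₁ y₀ (Ψ x (𝓔.e (b x))) (D x ξ) := by
  obtain ⟨V, hV, hφV, hV0, hVd⟩ := 𝓔.isSubmersion_φ.exists_vertical_translation (𝓔.e (b x₁))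
  have hx₁ := mem_dom_self (F := E₁) x₁
  let f : E₁ × E₁ → X := fun p => param E₁ x₁ p.1
  let g : E₁ × E₁ → X := fun p => V (𝓔.e (b (param E₁ x₁ p.1)), p.2)
  let p₀ : E₁ × E₁ := (chart E₁ x₁ x₁, 0)
  have hf0 : f p₀ = x₁ := param_chart hx₁
  have hf : ContMDiffAt 𝓘(ℝ, E₁ × E₁) 𝓘(ℝ, E₁) ∞ f p₀ :=
    ContMDiffAt.comp p₀ (I' := 𝓘(ℝ, E₁)) (g := param E₁ x₁) (f := Prod.fst) (contMDiffAt_param hx₁)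
      (contMDiffAt_iff_contDiffAt.2 contDiffAt_fst)
  have hebf : ContMDiffAt 𝓘(ℝ, E₁ × E₁) 𝓘(ℝ, E₁) ∞ (fun p => 𝓔.e (b (f p))) p₀ :=
    ContMDiffAt.comp p₀ (I' := 𝓘(ℝ, E₀)) (g := 𝓔.e) (f := fun p => b (f p)) (𝓔.contMDiff_e _)
      (ContMDiffAt.comp p₀ (I' := 𝓘(ℝ, E₁)) (g := b) (f := f) (hb _) hf)
  have hA : ContMDiffAt 𝓘(ℝ, E₁ × E₁) (𝓘(ℝ, E₁).prod 𝓘(ℝ, E₁)) ∞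
      (fun p : E₁ × E₁ => (𝓔.e (b (f p)), p.2)) p₀ :=
    hebf.prodMk (contMDiffAt_iff_contDiffAt.2 contDiffAt_snd)
  have hA0 : (𝓔.e (b (f p₀)), p₀.2) = (𝓔.e (b x₁), (0 : E₁)) := by rw [hf0]
  have hg : ContMDiffAt 𝓘(ℝ, E₁ × E₁) 𝓘(ℝ, E₁) ∞ g p₀ :=
    ContMDiffAt.comp p₀ (I' := 𝓘(ℝ, E₁).prod 𝓘(ℝ, E₁)) (g := V)
      (f := fun p : E₁ × E₁ => (𝓔.e (b (f p)), p.2)) (by rw [hA0]; exact hV) hA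
  have hker : ∀ᶠ q in 𝓝 p₀, g q ∈ 𝓔.ker (b (f q)) := by
    have := hA.continuousAt.tendsto
    rw [hA0] at this
    filter_upwards [this.eventually hφV] with q hq
    exact hq.trans (𝓔.φ_one _)
  have hgp : g p₀ = 𝓔.e (b x₁) := by
    have := hV0.self_of_nhds
    simp only [g, p₀, param_chart hx₁, this]
  -- The operator `A q` is the derivative of `G (q, ·)` at `0`. The vertical translation defines it
  -- on every vector `w`, although `D` is meaningful on the Lie algebra only.
  let G : E₁ × E₁ → E₁ := fun p => chart E₁ y₀ (Ψ (f p) (g p))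
  have hΨp : Ψ (f p₀) (g p₀) ∈ dom E₁ y₀ := by rw [hf0, hgp]; exact hy
  have hΨs := hΨ f g p₀ hf hg hker
  have hG : ContDiffAt ℝ ∞ G p₀ :=
    contMDiffAt_iff_contDiffAt.1 (ContMDiffAt.comp p₀ (I' := 𝓘(ℝ, E₁)) (g := chart E₁ y₀)
      (f := fun p => Ψ (f p) (g p)) (contMDiffAt_chart hΨp) hΨs)
  have hGd : ∀ᶠ p in 𝓝 p₀, DifferentiableAt ℝ G p := by
    have h1 : ContDiffAt ℝ 1 G p₀ := hG.of_le (by simp)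
    filter_upwards [h1.eventually (by simp)] with p hp
    exact hp.differentiableAt (by simp)
  have hdom : ∀ᶠ p in 𝓝 p₀, Ψ (f p) (g p) ∈ dom E₁ y₀ :=
    hΨs.continuousAt.preimage_mem_nhds ((isOpen_dom y₀).mem_nhds hΨp)
  have tq : Filter.Tendsto (fun x => (chart E₁ x₁ x, (0 : E₁))) (𝓝 x₁) (𝓝 p₀) :=
    (tendsto_chart hx₁).prodMk_nhds tendsto_const_nhds
  have tb : Filter.Tendsto (fun x => 𝓔.e (b x)) (𝓝 x₁) (𝓝 (𝓔.e (b x₁))) :=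
    ((𝓔.contMDiff_e _).continuousAt.comp (hb x₁).continuousAt).tendsto
  refine ⟨fun q => (fderiv ℝ G (q, 0)).comp (ContinuousLinearMap.inr ℝ E₁ E₁), ?_, ?_⟩
  · refine ContDiffAt.clm_comp ?_ contDiffAt_const
    exact (hG.fderiv_right (m := ∞) (by simp)).comp (chart E₁ x₁ x₁)
      (contDiffAt_id.prodMk contDiffAt_const)
  · filter_upwards [(isOpen_dom x₁).mem_nhds hx₁, tq.eventually hGd, tq.eventually hdom,
      tq.eventually hdom.eventually_nhds, tq.eventually hker.eventually_nhds,
      tb.eventually hV0, tb.eventually hVd] with x h1 h2 h3 h4 h5 h6 h7 ξ hξ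
    have hfx : ∀ w, f (chart E₁ x₁ x, w) = x := fun w => param_chart h1
    have hgx : ∀ w, g (chart E₁ x₁ x, w) = V (𝓔.e (b x), w) := fun w => by
      simp only [g, param_chart h1]
    obtain ⟨w, hw⟩ : ∃ w, w = dchart E₁ (𝓔.e (b x₁)) (𝓔.e (b x)) ξ := ⟨_, rfl⟩
    rw [← hw]
    let k : ℝ → X := fun r => V (𝓔.e (b x), r • w)
    have hl : HasDerivAt (fun r : ℝ => r • w) w 0 := by
      simpa using (hasDerivAt_id (0 : ℝ)).smul_const w
    have hl2 : HasDerivAt (fun r : ℝ => (chart E₁ x₁ x, r • w)) (0, w) 0 :=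
      (hasDerivAt_const _ _).prodMk hl
    have hl0 : (0 : ℝ) • w = 0 := zero_smul _ _
    have tl : Filter.Tendsto (fun r : ℝ => (chart E₁ x₁ x, r • w)) (𝓝 0)
        (𝓝 (chart E₁ x₁ x, 0)) := by
      have := hl2.continuousAt.tendsto
      rwa [hl0] at this
    have hk : MDifferentiableAt 𝓘(ℝ, ℝ) 𝓘(ℝ, E₁) k 0 :=
      MDifferentiableAt.comp (0 : ℝ) (I' := 𝓘(ℝ, E₁)) (g := fun w => V (𝓔.e (b x), w))
        (f := fun r : ℝ => r • w) (by rw [hl0]; exact h7.1)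
        (mdifferentiableAt_iff_differentiableAt.2 hl.differentiableAt)
    have hkv : tmap ℝ E₁ k 0 1 = ξ := by
      have := tmap_comp (F := ℝ) (F' := E₁) (F'' := E₁) (g := fun w => V (𝓔.e (b x), w))
        (f := fun r : ℝ => r • w) (x := 0) (by rw [hl0]; exact h7.1)
        (mdifferentiableAt_iff_differentiableAt.2 hl.differentiableAt)
      rw [hl0] at this
      refine (congrArg (fun L : ℝ →L[ℝ] E₁ => L 1) this).trans ?_
      rw [ContinuousLinearMap.comp_apply, tmap_eq_fderiv, fderiv_apply_one_eq_deriv, hl.deriv, hw]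
      exact h7.2 ξ hξ
    have hk0 : k 0 = 𝓔.e (b x) := by simp only [k, hl0]; exact h6
    have hkk : ∀ᶠ r in 𝓝 0, k r ∈ 𝓔.ker (b x) := by
      filter_upwards [tl.eventually h5] with r hr
      rwa [hfx, hgx] at hr
    have hGl : HasDerivAt (fun r : ℝ => G (chart E₁ x₁ x, r • w))
        (fderiv ℝ G (chart E₁ x₁ x, 0) (0, w)) 0 :=
      HasFDerivAt.comp_hasDerivAt (0 : ℝ) (l := G) (l' := fderiv ℝ G (chart E₁ x₁ x, 0))
        (f := fun r : ℝ => (chart E₁ x₁ x, r • w)) (by rw [hl0]; exact h2.hasFDerivAt) hl2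
    have hΨd : ∀ᶠ r in 𝓝 (0 : ℝ), Ψ x (k r) ∈ dom E₁ y₀ := by
      filter_upwards [tl.eventually h4] with r hr
      rwa [hfx, hgx] at hr
    have hΨ0 := hΨd.self_of_nhds
    have hmd : MDifferentiableAt 𝓘(ℝ, ℝ) 𝓘(ℝ, E₁) (fun r => Ψ x (k r)) 0 := by
      have h8 : MDifferentiableAt 𝓘(ℝ, ℝ) 𝓘(ℝ, E₁)
          (fun r : ℝ => param E₁ y₀ (G (chart E₁ x₁ x, r • w))) 0 := by
        refine MDifferentiableAt.comp (0 : ℝ) (I' := 𝓘(ℝ, E₁)) (g := param E₁ y₀)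
          (f := fun r : ℝ => G (chart E₁ x₁ x, r • w)) ?_
          (mdifferentiableAt_iff_differentiableAt.2 hGl.differentiableAt)
        simp only [G, hfx, hgx]
        exact mdiff_param hΨ0
      refine h8.congr_of_eventuallyEq ?_
      filter_upwards [hΨd] with r hr
      simp only [G, hfx, hgx]
      exact (param_chart hr).symm
    have h9 := deriv_chart_comp hmd hΨ0
    rw [hD x k hk hk0 hkk, hkv, hk0] at h9
    have h10 : (fun r => chart E₁ y₀ (Ψ x (k r))) = fun r : ℝ => G (chart E₁ x₁ x, r • w) := by
      funext r
      simp only [G, hfx, hgx, k]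
    rw [h10] at h9
    exact hGl.unique h9

/-- `fundE x` is meaningful only on `K (t x)`, a subspace that moves with `x`, and so cannot be
differentiated as an operator. `A` is a smooth substitute on the whole model space;
`exists_adI_operator` provides the same for `adI`. -/
theorem exists_fund_operator (x₁ : X) :
    ∃ A : E₁ → E₁ →L[ℝ] E₁, ContDiffAt ℝ ∞ A (chart E₁ x₁ x₁) ∧
      ∀ᶠ x in 𝓝 x₁, ∀ ξ ∈ 𝓔.K (𝓔.t x),
        A (chart E₁ x₁ x) (dchart E₁ (𝓔.e (𝓔.t x₁)) (𝓔.e (𝓔.t x)) ξ) =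
          dchart E₁ x₁ x (𝓔.fundE x ξ) := by
  obtain ⟨A, hA, h⟩ := exists_smooth_operator (𝓔 := 𝓔) (b := 𝓔.t) 𝓔.contMDiff_t
    (Ψ := fun x k => 𝓔.total.mul x k) (D := fun x => 𝓔.fundE x) (x₁ := x₁) (y₀ := x₁)
    (fun f g p hf hg h => 𝓔.total.contMDiffAt_mul hf hg (h.mono fun q hq => (s_of_mem_ker hq).symm))
    (fun x k hk h0 h => 𝓔.tmap_fund hk x h0 h 1)
    (by rw [𝓔.total.mul_one x₁]; exact mem_dom_self x₁)
  refine ⟨A, hA, h.mono fun x hx ξ hξ => ?_⟩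
  rw [hx ξ hξ, 𝓔.total.mul_one x]

theorem exists_adI_operator (x₁ : X) :
    ∃ A : E₁ → E₁ →L[ℝ] E₁, ContDiffAt ℝ ∞ A (chart E₁ x₁ x₁) ∧
      ∀ᶠ x in 𝓝 x₁, ∀ ξ ∈ 𝓔.K (𝓔.s x),
        A (chart E₁ x₁ x) (dchart E₁ (𝓔.e (𝓔.s x₁)) (𝓔.e (𝓔.s x)) ξ) =
          dchart E₁ (𝓔.e (𝓔.t x₁)) (𝓔.e (𝓔.t x)) (𝓔.adI x ξ) := by
  have h1 : ∀ x : X, 𝓔.total.mul (𝓔.total.mul (𝓔.total.inv x) (𝓔.e (𝓔.s x))) x = 𝓔.e (𝓔.t x) := by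
    intro x
    rw [𝓔.total.mul_one' _ (t_inv x), 𝓔.total.inv_mul]
  obtain ⟨A, hA, h⟩ := exists_smooth_operator (𝓔 := 𝓔) (b := 𝓔.s) 𝓔.contMDiff_s
    (Ψ := fun x k => 𝓔.total.mul (𝓔.total.mul (𝓔.total.inv x) k) x) (D := fun x => 𝓔.adI x)
    (x₁ := x₁) (y₀ := 𝓔.e (𝓔.t x₁))
    (fun f g p hf hg h => by
      refine 𝓔.total.contMDiffAt_mul (𝓔.total.contMDiffAt_mul ?_ hg ?_) hf ?_
      · exact ContMDiffAt.comp p (g := 𝓔.total.inv) (𝓔.total.contMDiff_inv _) hf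
      · exact h.mono fun q hq => (t_inv _).trans (s_of_mem_ker hq).symm
      · exact h.mono fun q hq =>
          (t_mul ((t_inv _).trans (s_of_mem_ker hq).symm)).trans (t_of_mem_ker hq))
    (fun x k hk h0 h => 𝓔.tmap_inv_conj hk x h0 h 1)
    (by rw [h1]; exact mem_dom_self _)
  refine ⟨A, hA, h.mono fun x hx ξ hξ => ?_⟩
  rw [hx ξ hξ, h1]

end LieGroupoidExtension

/-! ### Maps between manifolds in coordinates. -/

section MapLoc

variable {F N F' N' : Type*}
  [NormedAddCommGroup F] [NormedSpace ℝ F] [TopologicalSpace N] [ChartedSpace F N]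
  [NormedAddCommGroup F'] [NormedSpace ℝ F'] [TopologicalSpace N'] [ChartedSpace F' N']
  [IsManifold 𝓘(ℝ, F) ∞ N] [IsManifold 𝓘(ℝ, F') ∞ N']

/-- A map in the charts at `x₀` and `y₀`. -/
def mapLoc (F F' : Type*) {N N' : Type*}
    [NormedAddCommGroup F] [NormedSpace ℝ F] [TopologicalSpace N] [ChartedSpace F N]
    [NormedAddCommGroup F'] [NormedSpace ℝ F'] [TopologicalSpace N'] [ChartedSpace F' N']
    (x₀ : N) (y₀ : N') (f : N → N') (q : F) : F' := chart F' y₀ (f (param F x₀ q))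

theorem mapLoc_chart {x₀ x : N} (y₀ : N') (f : N → N') (hx : x ∈ dom F x₀) :
    mapLoc F F' x₀ y₀ f (chart F x₀ x) = chart F' y₀ (f x) := by
  rw [mapLoc, param_chart hx]

theorem contDiffAt_mapLoc {x₀ x : N} {y₀ : N'} {f : N → N'} (hx : x ∈ dom F x₀)
    (hy : f x ∈ dom F' y₀) (hf : ContMDiffAt 𝓘(ℝ, F) 𝓘(ℝ, F') ∞ f x) :
    ContDiffAt ℝ ∞ (mapLoc F F' x₀ y₀ f) (chart F x₀ x) := by
  refine contMDiffAt_iff_contDiffAt.1 ?_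
  refine ContMDiffAt.comp (chart F x₀ x) (I' := 𝓘(ℝ, F')) (g := chart F' y₀)
    (f := fun q => f (param F x₀ q)) (contMDiffAt_chart (by rwa [param_chart hx])) ?_
  exact ContMDiffAt.comp (chart F x₀ x) (I' := 𝓘(ℝ, F)) (g := f) (f := param F x₀)
    (by rwa [param_chart hx]) (contMDiffAt_param hx)

theorem fderiv_mapLoc {x₀ x : N} {y₀ : N'} {f : N → N'} (hx : x ∈ dom F x₀)
    (hy : f x ∈ dom F' y₀) (hf : MDifferentiableAt 𝓘(ℝ, F) 𝓘(ℝ, F') f x) (v : F) :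
    fderiv ℝ (mapLoc F F' x₀ y₀ f) (chart F x₀ x) (dchart F x₀ x v) =
      dchart F' y₀ (f x) (tmap F F' f x v) := by
  have h1 := tmap_comp (F := F) (F' := F) (F'' := F') (g := f) (f := param F x₀)
    (x := chart F x₀ x) (by rwa [param_chart hx]) (mdiff_param hx)
  have h2 : MDifferentiableAt 𝓘(ℝ, F) 𝓘(ℝ, F') (fun q => f (param F x₀ q)) (chart F x₀ x) :=
    MDifferentiableAt.comp (chart F x₀ x) (g := f) (by rwa [param_chart hx]) (mdiff_param hx)
  have h3 := hasFDerivAt_chart_comp (x₀ := y₀) h2 (by rwa [param_chart hx])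
  change fderiv ℝ (fun q => chart F' y₀ (f (param F x₀ q))) _ _ = _
  rw [h3.fderiv, h1, param_chart hx]
  simp only [ContinuousLinearMap.comp_apply]
  congr 2
  exact dparam_dchart hx v

end MapLoc

/-! ### The structure equation, and the covariant derivative of the adjoint action. -/

namespace LieGroupoidExtension

variable {E₀ E₁ E₂ M X Y : Type*}
  [NormedAddCommGroup E₀] [NormedSpace ℝ E₀] [NormedAddCommGroup E₁] [NormedSpace ℝ E₁]
  [NormedAddCommGroup E₂] [NormedSpace ℝ E₂]
  [TopologicalSpace M] [ChartedSpace E₀ M] [TopologicalSpace X] [ChartedSpace E₁ X]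
  [TopologicalSpace Y] [ChartedSpace E₂ Y]
  {𝓔 : LieGroupoidExtension E₀ E₁ E₂ M X Y}
  [IsManifold 𝓘(ℝ, E₀) ∞ M] [IsManifold 𝓘(ℝ, E₁) ∞ X] [IsManifold 𝓘(ℝ, E₂) ∞ Y]
  [FiniteDimensional ℝ E₀] [FiniteDimensional ℝ E₁]
  {α : 𝓔.ArrowForm 1} {B : 𝓔.BaseForm 2}

/-- The coboundary of a form on the model spaces. -/
def deltaE {k : ℕ} (η : 𝓔.BaseForm k) (x : X) (v : Fin k → E₁) : E₁ :=
  η.valE (𝓔.t x) (fun i => tmap E₁ E₀ 𝓔.t x (v i)) -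
    𝓔.adI x (η.valE (𝓔.s x) fun i => tmap E₁ E₀ 𝓔.s x (v i))

theorem valE_mem {k : ℕ} (η : 𝓔.BaseForm k) (m : M) (v : Fin k → E₀) : η.valE m v ∈ 𝓔.K m :=
  η.mem m v

theorem loc_dchart {k : ℕ} (η : 𝓔.BaseForm k) {m₀ m : M} (hm : m ∈ dom E₀ m₀) (v : Fin k → E₀) :
    η.loc m₀ m₀ (chart E₀ m₀ m) (fun i => dchart E₀ m₀ m (v i)) =
      dchart E₁ (𝓔.e m₀) (𝓔.e m) (η.valE m v) := by
  rw [Form.loc, param_chart hm]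
  change dchart E₁ _ _ (η.valE m fun i => dparam E₀ m₀ m (dchart E₀ m₀ m (v i))) = _
  simp only [dparam_dchart hm]

theorem deltaE_loc {k : ℕ} (η : 𝓔.BaseForm k) {x₁ x : X} {m₀ n₀ : M} (hx : x ∈ dom E₁ x₁)
    (hm : 𝓔.t x ∈ dom E₀ m₀) (hn : 𝓔.s x ∈ dom E₀ n₀) {L : E₁ →L[ℝ] E₁}
    (hL : ∀ ξ ∈ 𝓔.K (𝓔.s x), L (dchart E₁ (𝓔.e n₀) (𝓔.e (𝓔.s x)) ξ) =
      dchart E₁ (𝓔.e m₀) (𝓔.e (𝓔.t x)) (𝓔.adI x ξ)) (v : Fin k → E₁) :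
    dchart E₁ (𝓔.e m₀) (𝓔.e (𝓔.t x)) (deltaE η x v) =
      η.loc m₀ m₀ (mapLoc E₁ E₀ x₁ m₀ 𝓔.t (chart E₁ x₁ x)) (fun i =>
        fderiv ℝ (mapLoc E₁ E₀ x₁ m₀ 𝓔.t) (chart E₁ x₁ x) (dchart E₁ x₁ x (v i))) -
      L (η.loc n₀ n₀ (mapLoc E₁ E₀ x₁ n₀ 𝓔.s (chart E₁ x₁ x)) fun i =>
        fderiv ℝ (mapLoc E₁ E₀ x₁ n₀ 𝓔.s) (chart E₁ x₁ x) (dchart E₁ x₁ x (v i))) := by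
  simp only [fderiv_mapLoc hx hm (mdiff_t x), fderiv_mapLoc hx hn (mdiff_s x), mapLoc_chart _ _ hx,
    loc_dchart η hm, loc_dchart η hn, hL _ (valE_mem η _ _), deltaE, map_sub]

/-- The Ehresmann curvature in charts. -/
theorem deltaE_eq_daloc (hα : IsRightConnection α) (hB : α.IsCurving B) {x₁ x : X} {m₀ : M}
    (hx : x ∈ dom E₁ x₁) (he : 𝓔.e (𝓔.t x) ∈ dom E₁ (𝓔.e m₀)) {A : E₁ → E₁ →L[ℝ] E₁}
    (hA : ContDiffAt ℝ 1 A (chart E₁ x₁ x))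
    (hAf : ∀ᶠ y in 𝓝 x, ∀ ξ ∈ 𝓔.K (𝓔.t y), A (chart E₁ x₁ y)
      (dchart E₁ (𝓔.e m₀) (𝓔.e (𝓔.t y)) ξ) = dchart E₁ x₁ y (𝓔.fundE y ξ)) (u v : E₁) :
    dchart E₁ (𝓔.e m₀) (𝓔.e (𝓔.t x)) (deltaE B x ![dparam E₁ x₁ x u, dparam E₁ x₁ x v]) =
      daloc α x₁ m₀ (chart E₁ x₁ x)
        (u - A (chart E₁ x₁ x) (aloc α x₁ m₀ (chart E₁ x₁ x) u))
        (v - A (chart E₁ x₁ x) (aloc α x₁ m₀ (chart E₁ x₁ x) v)) := by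
  have ha : ContDiffAt ℝ 1 (aloc α x₁ m₀) (chart E₁ x₁ x) := (contDiffAt_aloc α hx he).of_le (by simp)
  -- Coordinates of the horizontal part of the field with constant coordinates `u`; hence `aloc`
  -- kills it near the point.
  let h : E₁ → E₁ → E₁ := fun u q => u - A q (aloc α x₁ m₀ q u)
  let H : E₁ → X → E₁ := fun u y =>
    dparam E₁ x₁ y u - 𝓔.fundE y (evE α y (dparam E₁ x₁ y u))
  have hh : ∀ u, ContDiffAt ℝ 1 (h u) (chart E₁ x₁ x) := fun u =>
    contDiffAt_const.sub (hA.clm_apply (ha.clm_apply contDiffAt_const))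
  have hxn : ∀ᶠ y in 𝓝 x, y ∈ dom E₁ x₁ := (isOpen_dom x₁).mem_nhds hx
  have key : ∀ᶠ y in 𝓝 x, ∀ u, dchart E₁ x₁ y (H u y) = h u (chart E₁ x₁ y) := by
    filter_upwards [hAf, hxn] with y h1 h2 u
    have h3 := aloc_chart α m₀ h2 (dparam E₁ x₁ y u)
    rw [dchart_dparam h2] at h3
    simp only [H, h, map_sub, dchart_dparam h2, h3, h1 _ (evE_mem α y _)]
  have hak : ∀ᶠ y in 𝓝 x, ∀ u, aloc α x₁ m₀ (chart E₁ x₁ y) (h u (chart E₁ x₁ y)) = 0 := by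
    filter_upwards [key, hxn] with y h1 h2 u
    rw [← h1 u, aloc_chart α m₀ h2]
    simp only [H, map_sub, evE_fundE hα (evE_mem α y _), sub_self, map_zero]
  have hHs : ∀ u, MDifferentiableAt 𝓘(ℝ, E₁) 𝓘(ℝ, E₁).tangent
      (fun y => (⟨y, H u y⟩ : TangentBundle 𝓘(ℝ, E₁) X)) x := by
    intro u
    have h1 : ContMDiffAt 𝓘(ℝ, E₁) 𝓘(ℝ, E₁) 1 (fun y => h u (chart E₁ x₁ y)) x :=
      ContMDiffAt.comp x (g := h u) (I' := 𝓘(ℝ, E₁)) (hh u).contMDiffAt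
        ((contMDiffAt_chart hx).of_le (by simp))
    refine ContMDiffAt.mdifferentiableAt (n := 1) ?_ (by simp)
    refine (contMDiffAt_tangent_iff_of_le (f := fun y : X => y) (v := H u) ?_ hx).2
      ⟨contMDiffAt_id, h1.congr_of_eventuallyEq (key.mono fun y hy => hy u)⟩
    exact WithTop.coe_le_coe.2 (le_top : (2 : ℕ∞) ≤ ⊤)
  have hloc : ∀ u, fieldLoc x₁ (H u) =ᶠ[𝓝 (chart E₁ x₁ x)] h u := by
    intro u
    filter_upwards [(tendsto_param hx).eventually key, chart_param_eventually hx] with q h1 h2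
    rw [fieldLoc, h1 u, h2]
  have hbr := lieBracket_fieldLoc hx (hHs u) (hHs v)
  rw [(hloc u).lieBracket_vectorField_eq (hloc v)] at hbr
  have hω : deltaE B x ![dparam E₁ x₁ x u, dparam E₁ x₁ x v] =
      - evE α x (dparam E₁ x₁ x (lieBracket ℝ (h u) (h v) (chart E₁ x₁ x))) := by
    rw [hbr]
    exact hB x (fun y => dparam E₁ x₁ y u) (fun y => dparam E₁ x₁ y v) (smoothFieldAt_dparam hx u)
      (smoothFieldAt_dparam hx v)
  -- Differentiating `a (h u) = 0` trades `a (D_w (h u))` for `-(D_w a) (h u)`. This turns `-α` of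
  -- the bracket of two horizontal fields into the exterior derivative of `α`.
  have hDa : ∀ u w, fderiv ℝ (aloc α x₁ m₀) (chart E₁ x₁ x) w (h u (chart E₁ x₁ x)) +
      aloc α x₁ m₀ (chart E₁ x₁ x) (fderiv ℝ (h u) (chart E₁ x₁ x) w) = 0 := by
    intro u w
    have h1 := (ha.differentiableAt (by simp)).hasFDerivAt.clm_apply
      ((hh u).differentiableAt (by simp)).hasFDerivAt
    have h2 : HasFDerivAt (fun q => aloc α x₁ m₀ q (h u q)) (0 : E₁ →L[ℝ] E₁) (chart E₁ x₁ x) := by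
      refine (hasFDerivAt_const (0 : E₁) _).congr_of_eventuallyEq ?_
      filter_upwards [(tendsto_param hx).eventually hak, chart_param_eventually hx] with q h1 h2
      rw [← h2]
      exact h1 u
    have h3 := congrArg (fun L : E₁ →L[ℝ] E₁ => L w) (h1.unique h2)
    rw [add_comm]
    exact h3
  have h1 := hDa u (h v (chart E₁ x₁ x))
  have h2 := hDa v (h u (chart E₁ x₁ x))
  rw [hω, map_neg, ← aloc_chart α m₀ hx, dchart_dparam hx, lieBracket, map_sub, daloc]
  change _ = fderiv ℝ (aloc α x₁ m₀) (chart E₁ x₁ x) (h u (chart E₁ x₁ x)) (h v (chart E₁ x₁ x)) -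
    fderiv ℝ (aloc α x₁ m₀) (chart E₁ x₁ x) (h v (chart E₁ x₁ x)) (h u (chart E₁ x₁ x))
  rw [eq_neg_of_add_eq_zero_left h1, eq_neg_of_add_eq_zero_left h2]
  abel

/-- The exterior derivative of a connection, decomposed along the horizontal spaces. -/
theorem daloc_eq (hα : IsRightConnection α) (hB : α.IsCurving B) {x₁ x : X} {m₀ : M}
    (hx : x ∈ dom E₁ x₁) (hm : 𝓔.t x ∈ dom E₀ m₀) (he : 𝓔.e (𝓔.t x) ∈ dom E₁ (𝓔.e m₀))
    {A : E₁ → E₁ →L[ℝ] E₁} (hA : ContDiffAt ℝ 1 A (chart E₁ x₁ x))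
    (hAf : ∀ᶠ y in 𝓝 x, ∀ ξ ∈ 𝓔.K (𝓔.t y), A (chart E₁ x₁ y)
      (dchart E₁ (𝓔.e m₀) (𝓔.e (𝓔.t y)) ξ) = dchart E₁ x₁ y (𝓔.fundE y ξ)) (u v : E₁) :
    daloc α x₁ m₀ (chart E₁ x₁ x) u v =
      dchart E₁ (𝓔.e m₀) (𝓔.e (𝓔.t x)) (deltaE B x ![dparam E₁ x₁ x u, dparam E₁ x₁ x v]) +
      Gam α m₀ (mapLoc E₁ E₀ x₁ m₀ 𝓔.t (chart E₁ x₁ x))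
        (fderiv ℝ (mapLoc E₁ E₀ x₁ m₀ 𝓔.t) (chart E₁ x₁ x) v) (aloc α x₁ m₀ (chart E₁ x₁ x) u) -
      Gam α m₀ (mapLoc E₁ E₀ x₁ m₀ 𝓔.t (chart E₁ x₁ x))
        (fderiv ℝ (mapLoc E₁ E₀ x₁ m₀ 𝓔.t) (chart E₁ x₁ x) u) (aloc α x₁ m₀ (chart E₁ x₁ x) v) +
      daloc α x₁ m₀ (chart E₁ x₁ x)
        (A (chart E₁ x₁ x) (aloc α x₁ m₀ (chart E₁ x₁ x) u))
        (A (chart E₁ x₁ x) (aloc α x₁ m₀ (chart E₁ x₁ x) v)) := by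
  set q := chart E₁ x₁ x with hq
  have hver : ∀ u, A q (aloc α x₁ m₀ q u) = dchart E₁ x₁ x (𝓔.fundE x (evE α x (dparam E₁ x₁ x u))) := by
    intro u
    have h3 := aloc_chart α m₀ hx (dparam E₁ x₁ x u)
    rw [dchart_dparam hx] at h3
    rw [h3, hAf.self_of_nhds _ (evE_mem α x _)]
  -- Both vectors are split into vertical and horizontal parts. The horizontal pair gives the
  -- curvature, the mixed pairs give `Gam` by `daloc_fundE`, and the vertical pair is left as it is.
  have key : ∀ u v, daloc α x₁ m₀ q (A q (aloc α x₁ m₀ q u)) (v - A q (aloc α x₁ m₀ q v)) =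
      Gam α m₀ (mapLoc E₁ E₀ x₁ m₀ 𝓔.t q) (fderiv ℝ (mapLoc E₁ E₀ x₁ m₀ 𝓔.t) q v)
        (aloc α x₁ m₀ q u) := by
    intro u v
    have h0 : v - A q (aloc α x₁ m₀ q v) =
        dchart E₁ x₁ x (dparam E₁ x₁ x v - 𝓔.fundE x (evE α x (dparam E₁ x₁ x v))) := by
      rw [hver, map_sub, dchart_dparam hx]
    have h1 : evE α x (dparam E₁ x₁ x v - 𝓔.fundE x (evE α x (dparam E₁ x₁ x v))) = 0 := by
      rw [map_sub, evE_fundE hα (evE_mem α x _), sub_self]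
    have h2 := daloc_fundE hα hx hm he h1 (evE_mem α x (dparam E₁ x₁ x u))
    have ht : tmap E₁ E₀ 𝓔.t x (dparam E₁ x₁ x v - 𝓔.fundE x (evE α x (dparam E₁ x₁ x v))) =
        tmap E₁ E₀ 𝓔.t x (dparam E₁ x₁ x v) := by
      rw [map_sub, tmap_t_fundE (evE_mem α x _), sub_zero]
    rw [ht, ← fderiv_mapLoc hx hm (mdiff_t x), dchart_dparam hx, ← aloc_chart α m₀ hx,
      dchart_dparam hx] at h2
    rw [h0, hver u, h2, hq, mapLoc_chart m₀ 𝓔.t hx]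
  have hanti : ∀ u v, daloc α x₁ m₀ q u v = - daloc α x₁ m₀ q v u := fun u v => by
    simp only [daloc]; abel
  rw [deltaE_eq_daloc hα hB hx he hA hAf u v, ← hq, ← key u v, ← key v u,
    hanti (A q (aloc α x₁ m₀ q v))]
  simp only [daloc, map_sub, sub_apply]
  abel

theorem covCurve_of_hasDerivAt {γ : ℝ → M} {σ : ℝ → E₁} {d : E₁}
    (h : HasDerivAt (fun τ => dchart E₁ (𝓔.e (γ 0)) (𝓔.e (γ τ)) (σ τ)) d 0) :
    covCurve α (γ 0) γ σ =
      d + Gam α (γ 0) (chart E₀ (γ 0) (γ 0)) (tmap ℝ E₀ γ 0 1) (σ 0) := by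
  rw [covCurve, h.deriv, dchart_self, dchart_self]
  rfl

theorem operator_self {b b' : X → M} {x₁ : X} {A : E₁ → E₁ →L[ℝ] E₁} {D : X → E₁ →L[ℝ] E₁}
    (hAf : ∀ᶠ x in 𝓝 x₁, ∀ ξ ∈ 𝓔.K (b x),
      A (chart E₁ x₁ x) (dchart E₁ (𝓔.e (b x₁)) (𝓔.e (b x)) ξ) =
        dchart E₁ (𝓔.e (b' x₁)) (𝓔.e (b' x)) (D x ξ)) {ξ : E₁} (hξ : ξ ∈ 𝓔.K (b x₁)) :
    A (chart E₁ x₁ x₁) ξ = D x₁ ξ := by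
  have := hAf.self_of_nhds ξ hξ
  rwa [dchart_self, dchart_self] at this

/-- The covariant derivative of the adjoint representation vanishes in horizontal directions. -/
theorem fderiv_adI_operator (hα : IsRightConnection α) {x₁ : X} {A : E₁ → E₁ →L[ℝ] E₁}
    (hA : DifferentiableAt ℝ A (chart E₁ x₁ x₁))
    (hAf : ∀ᶠ x in 𝓝 x₁, ∀ ξ ∈ 𝓔.K (𝓔.s x),
        A (chart E₁ x₁ x) (dchart E₁ (𝓔.e (𝓔.s x₁)) (𝓔.e (𝓔.s x)) ξ) =
          dchart E₁ (𝓔.e (𝓔.t x₁)) (𝓔.e (𝓔.t x)) (𝓔.adI x ξ))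
    {u ζ : E₁} (hu : evE α x₁ u = 0) (hζ : ζ ∈ 𝓔.K (𝓔.s x₁)) :
    fderiv ℝ A (chart E₁ x₁ x₁) u ζ + Gam α (𝓔.t x₁) (chart E₀ (𝓔.t x₁) (𝓔.t x₁))
        (tmap E₁ E₀ 𝓔.t x₁ u) (A (chart E₁ x₁ x₁) ζ) =
      A (chart E₁ x₁ x₁) (Gam α (𝓔.s x₁) (chart E₀ (𝓔.s x₁) (𝓔.s x₁)) (tmap E₁ E₀ 𝓔.s x₁ u) ζ) := by
  obtain ⟨c, hc, rfl, rfl⟩ := exists_curve x₁ u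
  have hγ : ContMDiffAt 𝓘(ℝ, ℝ) 𝓘(ℝ, E₀) ∞ (fun τ => 𝓔.s (c τ)) 0 :=
    ContMDiffAt.comp (0 : ℝ) (g := 𝓔.s) (𝓔.contMDiff_s _) hc
  obtain ⟨σ, k, rfl, hk⟩ := exists_kerFamily_through hα (γ := fun τ => 𝓔.s (c τ)) hγ hζ
  have hd := mem_dom_self (F := E₁) (c 0)
  have h1 := hk.covCurve_adI hα hc hu (m₀ := 𝓔.t (c 0)) (n₀ := 𝓔.s (c 0)) (mem_dom_self _)
    (mem_dom_self _) (mem_dom_self _) (mem_dom_self _)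
  -- `A` agrees with `adI` only on the Lie algebra, so the covariant derivative has to lie there
  -- before `adI` can be replaced by `A`.
  have h2 := hk.dparam_covCurve_mem hα (m₀ := 𝓔.s (c 0)) (mem_dom_self _) (mem_dom_self _)
  have hA0 : ∀ ξ ∈ 𝓔.K (𝓔.s (c 0)), A (chart E₁ (c 0) (c 0)) ξ = 𝓔.adI (c 0) ξ :=
    fun ξ hξ => operator_self hAf hξ
  have id1 : ∀ (x : X) (w : E₁), dparam E₁ x x w = w := fun x w => by rw [dparam_self]; rfl
  have id2 : ∀ (x : X) (w : E₁), dchart E₁ x x w = w := fun x w => by rw [dchart_self]; rfl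
  rw [id1] at h1 h2
  rw [id1, ← hA0 _ h2] at h1
  have hcc := deriv_chart_comp (hc.mdifferentiableAt (by simp)) hd
  rw [id2] at hcc
  have hσ := ((hk.contDiffAt_section (x₀ := 𝓔.e (𝓔.s (c 0))) (mem_dom_self _)).differentiableAt
    (by simp)).hasDerivAt
  generalize deriv (fun τ => dchart E₁ (𝓔.e (𝓔.s (c 0))) (𝓔.e (𝓔.s (c τ))) (σ τ)) 0 = σ' at hσ
  have hAc : HasDerivAt (fun τ => A (chart E₁ (c 0) (c τ)))
      (fderiv ℝ A (chart E₁ (c 0) (c 0)) (tmap ℝ E₁ c 0 1)) 0 :=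
    hA.hasFDerivAt.comp_hasDerivAt (0 : ℝ) hcc
  have h3 := hAc.clm_apply hσ
  rw [id2] at h3
  have h4 : ∀ᶠ τ in 𝓝 (0 : ℝ), dchart E₁ (𝓔.e (𝓔.t (c 0))) (𝓔.e (𝓔.t (c τ))) (𝓔.adI (c τ) (σ τ)) =
      A (chart E₁ (c 0) (c τ)) (dchart E₁ (𝓔.e (𝓔.s (c 0))) (𝓔.e (𝓔.s (c τ))) (σ τ)) := by
    filter_upwards [hc.continuousAt.eventually hAf, hk.mem_K] with τ a b
    exact (a _ b).symm
  have ht : tmap ℝ E₀ (fun τ => 𝓔.t (c τ)) 0 1 = tmap E₁ E₀ 𝓔.t (c 0) (tmap ℝ E₁ c 0 1) :=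
    congrArg (fun L : ℝ →L[ℝ] E₀ => L 1) (tmap_comp (g := 𝓔.t) (f := c) (x := 0) (mdiff_t _)
      (hc.mdifferentiableAt (by simp)))
  have hs : tmap ℝ E₀ (fun τ => 𝓔.s (c τ)) 0 1 = tmap E₁ E₀ 𝓔.s (c 0) (tmap ℝ E₁ c 0 1) :=
    congrArg (fun L : ℝ →L[ℝ] E₀ => L 1) (tmap_comp (g := 𝓔.s) (f := c) (x := 0) (mdiff_s _)
      (hc.mdifferentiableAt (by simp)))
  have h5 := covCurve_of_hasDerivAt (α := α) (γ := fun τ => 𝓔.t (c τ))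
    (h3.congr_of_eventuallyEq h4)
  have h6 := covCurve_of_hasDerivAt (α := α) (γ := fun τ => 𝓔.s (c τ)) hσ
  -- In coordinates this is `A' σ + A σ' + Γ (A σ) = A (σ' + Γ σ)`; the derivative `σ'` of the
  -- auxiliary section cancels.
  have h7 := h5.symm.trans (h1.trans (congrArg (A (chart E₁ (c 0) (c 0))) h6))
  rw [ht, hs, map_add, ← hA0 _ hζ] at h7
  generalize fderiv ℝ A (chart E₁ (c 0) (c 0)) (tmap ℝ E₁ c 0 1) (σ 0) = a1 at h7 ⊢
  refine add_left_cancel (a := A (chart E₁ (c 0) (c 0)) σ') (Eq.trans ?_ h7)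
  abel

end LieGroupoidExtension

/-! ### Pullbacks of forms and connections on vector spaces. -/

section Pullback

variable {E E' E'' F : Type*} [NormedAddCommGroup E] [NormedSpace ℝ E] [NormedAddCommGroup E']
  [NormedSpace ℝ E'] [NormedAddCommGroup E''] [NormedSpace ℝ E''] [NormedAddCommGroup F]
  [NormedSpace ℝ F]

/-- The pullback of a form on a vector space. -/
def pullForm {k : ℕ} (f : E → E') (η : E' → E' [⋀^Fin k]→L[ℝ] F) (q : E) : E [⋀^Fin k]→L[ℝ] F :=
  (η (f q)).compContinuousLinearMap (fderiv ℝ f q)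

/-- The pullback of the coefficients of a connection. -/
def pullConn (f : E → E') (Γ : E' → E' →L[ℝ] F →L[ℝ] F) (q : E) : E →L[ℝ] F →L[ℝ] F :=
  (Γ (f q)).comp (fderiv ℝ f q)

theorem pullForm_apply {k : ℕ} (f : E → E') (η : E' → E' [⋀^Fin k]→L[ℝ] F) (q : E) (v : Fin k → E) :
    pullForm f η q v = η (f q) fun i => fderiv ℝ f q (v i) := rfl

theorem pullConn_apply (f : E → E') (Γ : E' → E' →L[ℝ] F →L[ℝ] F) (q v : E) :
    pullConn f Γ q v = Γ (f q) (fderiv ℝ f q v) := rfl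

theorem contDiffAt_pullConn {f : E → E'} {Γ : E' → E' →L[ℝ] F →L[ℝ] F} {q : E}
    (hf : ContDiffAt ℝ ∞ f q) (hΓ : ContDiffAt ℝ ∞ Γ (f q)) : ContDiffAt ℝ ∞ (pullConn f Γ) q :=
  (hΓ.comp q hf).clm_comp (hf.fderiv_right (m := ∞) (by simp))

theorem contDiffAt_pullForm [FiniteDimensional ℝ E] [FiniteDimensional ℝ F] {k : ℕ} {f : E → E'}
    {η : E' → E' [⋀^Fin k]→L[ℝ] F} {q : E}
    (hf : ContDiffAt ℝ ∞ f q) (hη : ContDiffAt ℝ ∞ η (f q)) : ContDiffAt ℝ ∞ (pullForm f η) q := by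
  have : CompleteSpace F := FiniteDimensional.complete ℝ F
  refine contDiffAt_continuousAlternatingMap_of_apply fun v => ?_
  refine ContDiffAt.continuousAlternatingMap_apply (f := fun q => η (f q)) (hη.comp q hf)
    (contDiffAt_pi.2 fun i => ?_)
  exact (hf.fderiv_right (m := ∞) (by simp)).clm_apply contDiffAt_const

/-- The derivative of the pulled back coefficients contains the second derivative of `f`, which is
symmetric and cancels. -/
theorem connCurv_pullConn {f : E → E'} {Γ : E' → E' →L[ℝ] F →L[ℝ] F} {q : E}
    (hf : ContDiffAt ℝ ∞ f q) (hΓ : DifferentiableAt ℝ Γ (f q)) (u v : E) (ξ : F) :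
    connCurv (pullConn f Γ) q u v ξ = connCurv Γ (f q) (fderiv ℝ f q u) (fderiv ℝ f q v) ξ := by
  have hf' := (hf.differentiableAt (by simp)).hasFDerivAt
  have hf2 := ((hf.fderiv_right (m := ∞) (by simp)).differentiableAt (by simp)).hasFDerivAt
  have hd : ∀ u v, fderiv ℝ (pullConn f Γ) q u v =
      fderiv ℝ Γ (f q) (fderiv ℝ f q u) (fderiv ℝ f q v) + Γ (f q) (fderiv ℝ (fderiv ℝ f) q u v) := by
    intro u v
    have h0 : HasFDerivAt (𝕜 := ℝ) (E := E') (F := E' →L[ℝ] F →L[ℝ] F) Γ (fderiv ℝ Γ (f q)) (f q) :=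
      hΓ.hasFDerivAt
    have h1 := HasFDerivAt.comp (𝕜 := ℝ) (F := E') (G := E' →L[ℝ] F →L[ℝ] F) (g := Γ) q h0 hf'
    refine (congrArg (fun L : E →L[ℝ] E →L[ℝ] F →L[ℝ] F => L u v) (h1.clm_comp hf2).fderiv).trans ?_
    simp
    exact add_comm _ _
  have hs : fderiv ℝ (fderiv ℝ f) q u v = fderiv ℝ (fderiv ℝ f) q v u := by
    rw [(hf.isSymmSndFDerivAt minSmoothness_two_le_infty).eq]
  rw [connCurv, connCurv, hd, hd, hs]
  simp only [pullConn_apply, add_apply]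
  abel

theorem covExt_sub {k : ℕ} {Γ : E → E →L[ℝ] F →L[ℝ] F} {η θ : E → E [⋀^Fin k]→L[ℝ] F} {q : E}
    (hη : DifferentiableAt ℝ η q) (hθ : DifferentiableAt ℝ θ q) (v : Fin (k + 1) → E) :
    covExt Γ (fun q => η q - θ q) q v = covExt Γ η q v - covExt Γ θ q v := by
  have h : fderiv ℝ (fun q => η q - θ q) q = fderiv ℝ η q - fderiv ℝ θ q :=
    (hη.hasFDerivAt.sub hθ.hasFDerivAt).fderiv
  simp only [covExt_apply, h, sub_apply, ContinuousAlternatingMap.sub_apply, map_sub]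
  rw [← Finset.sum_sub_distrib]
  refine Finset.sum_congr rfl fun i _ => ?_
  rw [← smul_sub]
  congr 1
  abel

theorem contDiffAt_endomorphism_comp {k : ℕ} {A : E → F →L[ℝ] F} {σ : E → E [⋀^Fin k]→L[ℝ] F} {q : E}
    (hA : ContDiffAt ℝ ∞ A q) (hσ : ContDiffAt ℝ ∞ σ q) :
    ContDiffAt ℝ ∞ (fun q => (A q).compContinuousAlternatingMap (σ q)) q := by
  let J : (F →L[ℝ] F) →L[ℝ] (E [⋀^Fin k]→L[ℝ] F) →L[ℝ] E [⋀^Fin k]→L[ℝ] F :=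
    ContinuousLinearMap.compContinuousAlternatingMapCLM ℝ E F F (Fin k)
  have hJ : ContDiffAt ℝ ∞ (fun L : F →L[ℝ] F => J L) (A q) :=
    (ContinuousLinearMap.contDiff (𝕜 := ℝ) (E := F →L[ℝ] F)
      (F := (E [⋀^Fin k]→L[ℝ] F) →L[ℝ] E [⋀^Fin k]→L[ℝ] F) J).contDiffAt
  have h4 := ContDiffAt.comp (𝕜 := ℝ) (F := F →L[ℝ] F)
    (G := (E [⋀^Fin k]→L[ℝ] F) →L[ℝ] E [⋀^Fin k]→L[ℝ] F) (g := fun L => J L) q hJ hA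
  exact h4.clm_apply hσ

theorem contDiffAt_sub_endomorphism [FiniteDimensional ℝ E] [FiniteDimensional ℝ F] {f : E → E'}
    {g : E → E''} {η : E' → E' [⋀^Fin 2]→L[ℝ] F}
    {θ : E'' → E'' [⋀^Fin 2]→L[ℝ] F} {A : E → F →L[ℝ] F} {q : E}
    (hf : ContDiffAt ℝ ∞ f q) (hg : ContDiffAt ℝ ∞ g q) (hη : ContDiffAt ℝ ∞ η (f q))
    (hθ : ContDiffAt ℝ ∞ θ (g q)) (hA : ContDiffAt ℝ ∞ A q) :
    ContDiffAt ℝ ∞ (fun q => pullForm f η q - (A q).compContinuousAlternatingMap (pullForm g θ q)) q :=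
  (contDiffAt_pullForm hf hη).sub (contDiffAt_endomorphism_comp hA (contDiffAt_pullForm hg hθ))

/-- With `f = t`, `g = s` and `A = Ad_{x⁻¹}` the form is `∂^▷ B`. The part along `t` is natural for
the pulled back connection; the part along `s` keeps an ordinary exterior derivative, as `A` relates
the two connections in horizontal directions only. -/
theorem covExt_sub_endomorphism [FiniteDimensional ℝ E] [FiniteDimensional ℝ F] {f : E → E'}
    {g : E → E''} {Γ : E' → E' →L[ℝ] F →L[ℝ] F} {η : E' → E' [⋀^Fin 2]→L[ℝ] F}
    {θ : E'' → E'' [⋀^Fin 2]→L[ℝ] F} {A : E → F →L[ℝ] F} {q : E}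
    (hf : ContDiffAt ℝ ∞ f q) (hg : ContDiffAt ℝ ∞ g q) (hη : ContDiffAt ℝ ∞ η (f q))
    (hθ : ContDiffAt ℝ ∞ θ (g q)) (hA : ContDiffAt ℝ ∞ A q) (u v w : E) :
    covExt (pullConn f Γ)
        (fun q => pullForm f η q - (A q).compContinuousAlternatingMap (pullForm g θ q)) q ![u, v, w] =
      covExt Γ η (f q) ![fderiv ℝ f q u, fderiv ℝ f q v, fderiv ℝ f q w] -
      (A q (extDeriv θ (g q) ![fderiv ℝ g q u, fderiv ℝ g q v, fderiv ℝ g q w]) +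
        ((fderiv ℝ A q u (θ (g q) ![fderiv ℝ g q v, fderiv ℝ g q w]) +
            Γ (f q) (fderiv ℝ f q u) (A q (θ (g q) ![fderiv ℝ g q v, fderiv ℝ g q w]))) -
          (fderiv ℝ A q v (θ (g q) ![fderiv ℝ g q u, fderiv ℝ g q w]) +
            Γ (f q) (fderiv ℝ f q v) (A q (θ (g q) ![fderiv ℝ g q u, fderiv ℝ g q w]))) +
          (fderiv ℝ A q w (θ (g q) ![fderiv ℝ g q u, fderiv ℝ g q v]) +
            Γ (f q) (fderiv ℝ f q w) (A q (θ (g q) ![fderiv ℝ g q u, fderiv ℝ g q v]))))) := by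
  have h1 : DifferentiableAt ℝ (pullForm f η) q := (contDiffAt_pullForm hf hη).differentiableAt (by simp)
  have h2 : DifferentiableAt ℝ (pullForm g θ) q := (contDiffAt_pullForm hg hθ).differentiableAt (by simp)
  have h3 := (contDiffAt_endomorphism_comp hA (contDiffAt_pullForm hg hθ)).differentiableAt (by simp)
  have e2 : ∀ (h : E → E'') (y z : E), (fun i => fderiv ℝ h q (![y, z] i)) =
      ![fderiv ℝ h q y, fderiv ℝ h q z] := fun h y z => by ext i; fin_cases i <;> rfl
  have e3 : ∀ (h : E → E'') (x y z : E), (fun i => fderiv ℝ h q (![x, y, z] i)) =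
      ![fderiv ℝ h q x, fderiv ℝ h q y, fderiv ℝ h q z] := fun h x y z => by
    ext i; fin_cases i <;> rfl
  have e4 : (fun i => fderiv ℝ f q (![u, v, w] i)) =
      ![fderiv ℝ f q u, fderiv ℝ f q v, fderiv ℝ f q w] := by ext i; fin_cases i <;> rfl
  have h5 := covExt_pullback (Γ := Γ) (hη.differentiableAt (by simp)) hf ![u, v, w]
  have h6 : extDeriv (pullForm g θ) q ![u, v, w] =
      extDeriv θ (g q) ![fderiv ℝ g q u, fderiv ℝ g q v, fderiv ℝ g q w] := by
    rw [← e3]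
    exact congrArg (fun L : E [⋀^Fin 3]→L[ℝ] F => L ![u, v, w])
      (extDeriv_pullback (hθ.differentiableAt (by simp)) hg minSmoothness_two_le_infty)
  rw [covExt_sub h1 h3, covExt_endomorphism_two (hA.differentiableAt (by simp)) h2, h6]
  simp only [pullForm_apply, e2, pullConn_apply]
  rw [e4] at h5
  exact congrArg (· - _) h5

end Pullback

/-! ### The Bianchi identity of the Ehresmann curvature. -/

namespace LieGroupoidExtension

variable {E₀ E₁ E₂ M X Y : Type*}
  [NormedAddCommGroup E₀] [NormedSpace ℝ E₀] [NormedAddCommGroup E₁] [NormedSpace ℝ E₁]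
  [NormedAddCommGroup E₂] [NormedSpace ℝ E₂]
  [TopologicalSpace M] [ChartedSpace E₀ M] [TopologicalSpace X] [ChartedSpace E₁ X]
  [TopologicalSpace Y] [ChartedSpace E₂ Y]
  {𝓔 : LieGroupoidExtension E₀ E₁ E₂ M X Y}
  [IsManifold 𝓘(ℝ, E₀) ∞ M] [IsManifold 𝓘(ℝ, E₁) ∞ X] [IsManifold 𝓘(ℝ, E₂) ∞ Y]
  [FiniteDimensional ℝ E₀] [FiniteDimensional ℝ E₁]
  {α : 𝓔.ArrowForm 1} {B : 𝓔.BaseForm 2}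

/-- The vertical part of `dα` in the structure equation, for `F` the operator of fundamental
vectors. It need not be identified: wherever the Bianchi identity is used, one of its arguments is
zero. -/
theorem exists_smooth_bilinear {a F : E₁ → E₁ →L[ℝ] E₁} {q : E₁} (ha : ContDiffAt ℝ ∞ a q)
    (hF : ContDiffAt ℝ ∞ F q) : ∃ Q : E₁ → E₁ →L[ℝ] E₁ →L[ℝ] E₁, ContDiffAt ℝ ∞ Q q ∧
      ∀ p ξ η, Q p ξ η = fderiv ℝ a p (F p ξ) (F p η) - fderiv ℝ a p (F p η) (F p ξ) := by
  refine ⟨fun p => (fderiv ℝ a p).bilinearComp (F p) (F p) -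
    ((fderiv ℝ a p).bilinearComp (F p) (F p)).flip, ?_, fun p ξ η => rfl⟩
  have ha' : ContDiffAt ℝ ∞ (fderiv ℝ a) q := ha.fderiv_right (m := ∞) (by simp)
  refine contDiffAt_clm_of_apply fun ξ => contDiffAt_clm_of_apply fun η => ?_
  exact ((ha'.clm_apply (hF.clm_apply contDiffAt_const)).clm_apply
    (hF.clm_apply contDiffAt_const)).sub
    ((ha'.clm_apply (hF.clm_apply contDiffAt_const)).clm_apply (hF.clm_apply contDiffAt_const))

/-- The Bianchi identity of the Ehresmann curvature, in horizontal directions. -/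
theorem exists_bianchi (hα : IsRightConnection α) (hB : α.IsCurving B) {x₁ : X}
    {A : E₁ → E₁ →L[ℝ] E₁} (hA : ContDiffAt ℝ ∞ A (chart E₁ x₁ x₁))
    (hAf : ∀ᶠ x in 𝓝 x₁, ∀ ξ ∈ 𝓔.K (𝓔.s x),
        A (chart E₁ x₁ x) (dchart E₁ (𝓔.e (𝓔.s x₁)) (𝓔.e (𝓔.s x)) ξ) =
          dchart E₁ (𝓔.e (𝓔.t x₁)) (𝓔.e (𝓔.t x)) (𝓔.adI x ξ)) :
    ∃ Q : E₁ →L[ℝ] E₁ →L[ℝ] E₁, ∀ u v w, evE α x₁ u = 0 → evE α x₁ v = 0 →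
      covExt (pullConn (mapLoc E₁ E₀ x₁ (𝓔.t x₁) 𝓔.t) (Gam α (𝓔.t x₁)))
        (fun q => pullForm (mapLoc E₁ E₀ x₁ (𝓔.t x₁) 𝓔.t) (B.loc (𝓔.t x₁) (𝓔.t x₁)) q -
          (A q).compContinuousAlternatingMap
            (pullForm (mapLoc E₁ E₀ x₁ (𝓔.s x₁) 𝓔.s) (B.loc (𝓔.s x₁) (𝓔.s x₁)) q))
        (chart E₁ x₁ x₁) ![u, v, w] =
      connCurv (pullConn (mapLoc E₁ E₀ x₁ (𝓔.t x₁) 𝓔.t) (Gam α (𝓔.t x₁))) (chart E₁ x₁ x₁) u v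
        (evE α x₁ w) - Q (deltaE B x₁ ![u, v]) (evE α x₁ w) := by
  obtain ⟨F, hF, hFf⟩ := exists_fund_operator (𝓔 := 𝓔) x₁
  have hx := mem_dom_self (F := E₁) x₁
  have hm := mem_dom_self (F := E₀) (𝓔.t x₁)
  have hn := mem_dom_self (F := E₀) (𝓔.s x₁)
  have he := mem_dom_self (F := E₁) (𝓔.e (𝓔.t x₁))
  have hes := mem_dom_self (F := E₁) (𝓔.e (𝓔.s x₁))
  have ha : ContDiffAt ℝ ∞ (aloc α x₁ (𝓔.t x₁)) (chart E₁ x₁ x₁) := contDiffAt_aloc α hx he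
  obtain ⟨Q, hQ, hQe⟩ := exists_smooth_bilinear ha hF
  have hT : ContDiffAt ℝ ∞ (mapLoc E₁ E₀ x₁ (𝓔.t x₁) 𝓔.t) (chart E₁ x₁ x₁) :=
    contDiffAt_mapLoc hx hm (𝓔.contMDiff_t x₁)
  have hS : ContDiffAt ℝ ∞ (mapLoc E₁ E₀ x₁ (𝓔.s x₁) 𝓔.s) (chart E₁ x₁ x₁) :=
    contDiffAt_mapLoc hx hn (𝓔.contMDiff_s x₁)
  have hT0 := mapLoc_chart (F' := E₀) (𝓔.t x₁) 𝓔.t hx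
  have hS0 := mapLoc_chart (F' := E₀) (𝓔.s x₁) 𝓔.s hx
  have hG := contDiffAt_pullConn hT (by rw [hT0]; exact contDiffAt_Gam α hm he)
  have hκ := contDiffAt_sub_endomorphism (f := mapLoc E₁ E₀ x₁ (𝓔.t x₁) 𝓔.t)
    (g := mapLoc E₁ E₀ x₁ (𝓔.s x₁) 𝓔.s) hT hS (by rw [hT0]; exact B.contDiffAt_loc hm he)
    (by rw [hS0]; exact B.contDiffAt_loc hn hes) hA
  have hF1 : ContDiffAt ℝ 1 F (chart E₁ x₁ x₁) := hF.of_le (by simp)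
  have hnear : ∀ᶠ x in 𝓝 x₁, x ∈ dom E₁ x₁ ∧ 𝓔.t x ∈ dom E₀ (𝓔.t x₁) ∧
      𝓔.s x ∈ dom E₀ (𝓔.s x₁) ∧ 𝓔.e (𝓔.t x) ∈ dom E₁ (𝓔.e (𝓔.t x₁)) ∧
      ContDiffAt ℝ 1 F (chart E₁ x₁ x) := by
    filter_upwards [(isOpen_dom x₁).mem_nhds hx,
      (𝓔.contMDiff_t x₁).continuousAt.preimage_mem_nhds ((isOpen_dom _).mem_nhds hm),
      (𝓔.contMDiff_s x₁).continuousAt.preimage_mem_nhds ((isOpen_dom _).mem_nhds hn),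
      (𝓔.contMDiff_t x₁).continuousAt.eventually (unit_mem_dom_eventually he),
      (tendsto_chart hx).eventually (hF1.eventually (by simp))] with x a b c d e
    exact ⟨a, b, c, d, e⟩
  -- The structure equation is needed at all nearby points in the fixed charts, since it is going to
  -- be differentiated.
  have hd : ∀ᶠ p in 𝓝 (chart E₁ x₁ x₁), ∀ u v,
      fderiv ℝ (aloc α x₁ (𝓔.t x₁)) p u v - fderiv ℝ (aloc α x₁ (𝓔.t x₁)) p v u =
      (pullForm (mapLoc E₁ E₀ x₁ (𝓔.t x₁) 𝓔.t) (B.loc (𝓔.t x₁) (𝓔.t x₁)) p -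
          (A p).compContinuousAlternatingMap (pullForm (mapLoc E₁ E₀ x₁ (𝓔.s x₁) 𝓔.s)
            (B.loc (𝓔.s x₁) (𝓔.s x₁)) p)) ![u, v] +
      pullConn (mapLoc E₁ E₀ x₁ (𝓔.t x₁) 𝓔.t) (Gam α (𝓔.t x₁)) p v
        (aloc α x₁ (𝓔.t x₁) p u) -
      pullConn (mapLoc E₁ E₀ x₁ (𝓔.t x₁) 𝓔.t) (Gam α (𝓔.t x₁)) p u
        (aloc α x₁ (𝓔.t x₁) p v) +
      Q p (aloc α x₁ (𝓔.t x₁) p u)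
        (aloc α x₁ (𝓔.t x₁) p v) := by
    filter_upwards [(tendsto_param hx).eventually hnear, (tendsto_param hx).eventually hAf,
      (tendsto_param hx).eventually hFf.eventually_nhds, chart_param_eventually hx] with p hp h6 h7 h8
    intro u v
    obtain ⟨h1, h2, h3, h4, h5⟩ := hp
    obtain ⟨x, hxp⟩ : ∃ x, x = param E₁ x₁ p := ⟨_, rfl⟩
    rw [← hxp] at h1 h2 h3 h4 h5 h6 h7 h8
    subst h8
    refine (daloc_eq hα hB h1 h2 h4 h5 h7 u v).trans ?_
    rw [deltaE_loc B h1 h2 h3 h6, hQe]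
    have e2 : ∀ L : E₁ →L[ℝ] E₀, (fun i => L (dchart E₁ x₁ x
        (![dparam E₁ x₁ x u, dparam E₁ x₁ x v] i))) = fun i => L (![u, v] i) := by
      intro L
      ext i
      fin_cases i
      · exact congrArg L (dchart_dparam h1 u)
      · exact congrArg L (dchart_dparam h1 v)
    rw [e2, e2]
    rfl
  have hev : ∀ w, aloc α x₁ (𝓔.t x₁) (chart E₁ x₁ x₁) w = evE α x₁ w := by
    intro w
    have h := aloc_chart α (𝓔.t x₁) hx w
    rwa [dchart_self, dchart_self] at h
  refine ⟨Q (chart E₁ x₁ x₁), fun u v w hu hv => ?_⟩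
  have hmain := covExt_curvature ha (hG.differentiableAt (by simp)) (hQ.differentiableAt (by simp))
    (hκ.differentiableAt (by simp)) hd (u := u) (v := v) (by rw [hev, hu]) (by rw [hev, hv]) w
  rw [hmain, hev]
  congr 3
  -- On two horizontal vectors the structure equation reduces to `dα = ∂^▷ B`, which identifies the
  -- first argument of `Q`.
  have h8 := daloc_eq hα hB hx hm he hF1 hFf u v
  rw [hev, hev, hu, hv, dchart_self, dparam_self] at h8
  refine h8.trans ?_
  rw [map_zero, map_zero, map_zero]
  simp [daloc]

end LieGroupoidExtension

theorem covExt_two_eq_extDeriv_add {E F : Type*} [NormedAddCommGroup E] [NormedSpace ℝ E]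
    [NormedAddCommGroup F] [NormedSpace ℝ F] (Γ : E → E →L[ℝ] F →L[ℝ] F)
    (η : E → E [⋀^Fin 2]→L[ℝ] F) (q u v w : E) :
    covExt Γ η q ![u, v, w] = extDeriv η q ![u, v, w] +
      (Γ q u (η q ![v, w]) - Γ q v (η q ![u, w]) + Γ q w (η q ![u, v])) := by
  have h1 : extDeriv η q = covExt (fun _ => (0 : E →L[ℝ] F →L[ℝ] F)) η q := by
    ext v
    rw [covExt_apply_extDeriv]
    simp
  rw [h1, covExt_two_apply, covExt_two_apply]
  simp only [zero_apply, add_zero]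
  abel

theorem fderiv_mapLoc_self {F N F' N' : Type*}
    [NormedAddCommGroup F] [NormedSpace ℝ F] [TopologicalSpace N] [ChartedSpace F N]
    [NormedAddCommGroup F'] [NormedSpace ℝ F'] [TopologicalSpace N'] [ChartedSpace F' N']
    [IsManifold 𝓘(ℝ, F) ∞ N] [IsManifold 𝓘(ℝ, F') ∞ N'] {x : N} {f : N → N'}
    (hf : MDifferentiableAt 𝓘(ℝ, F) 𝓘(ℝ, F') f x) (v : F) :
    fderiv ℝ (mapLoc F F' x (f x) f) (chart F x x) v = tmap F F' f x v := by
  have h := fderiv_mapLoc (mem_dom_self x) (mem_dom_self (f x)) hf v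
  rwa [dchart_self, dchart_self] at h

namespace LieGroupoidExtension

variable {E₀ E₁ E₂ M X Y : Type*}
  [NormedAddCommGroup E₀] [NormedSpace ℝ E₀] [NormedAddCommGroup E₁] [NormedSpace ℝ E₁]
  [NormedAddCommGroup E₂] [NormedSpace ℝ E₂]
  [TopologicalSpace M] [ChartedSpace E₀ M] [TopologicalSpace X] [ChartedSpace E₁ X]
  [TopologicalSpace Y] [ChartedSpace E₂ Y]
  {𝓔 : LieGroupoidExtension E₀ E₁ E₂ M X Y}
  [IsManifold 𝓘(ℝ, E₀) ∞ M] [IsManifold 𝓘(ℝ, E₁) ∞ X] [IsManifold 𝓘(ℝ, E₂) ∞ Y]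
  [FiniteDimensional ℝ E₀] [FiniteDimensional ℝ E₁]
  {α : 𝓔.ArrowForm 1} {B : 𝓔.BaseForm 2}

theorem loc_self {k : ℕ} (η : 𝓔.BaseForm k) (m : M) :
    η.loc m m (chart E₀ m m) = η.valE m := by
  ext v
  have h := loc_dchart η (mem_dom_self m) v
  rwa [dchart_self, dchart_self] at h

theorem extLoc_self {k : ℕ} (η : 𝓔.BaseForm (k + 1)) (m : M) :
    extLoc α η m m = covExt (Gam α m) (η.loc m m) (chart E₀ m m) := by
  ext v
  rw [extLoc, dchart_self, dparam_self]
  rfl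

/-- The Bianchi identity of the Ehresmann curvature, in terms of the curving. -/
theorem exists_bianchi_curving (hα : IsRightConnection α) (hB : α.IsCurving B) {x₁ : X}
    {A : E₁ → E₁ →L[ℝ] E₁} (hA : ContDiffAt ℝ ∞ A (chart E₁ x₁ x₁))
    (hAf : ∀ᶠ x in 𝓝 x₁, ∀ ξ ∈ 𝓔.K (𝓔.s x),
        A (chart E₁ x₁ x) (dchart E₁ (𝓔.e (𝓔.s x₁)) (𝓔.e (𝓔.s x)) ξ) =
          dchart E₁ (𝓔.e (𝓔.t x₁)) (𝓔.e (𝓔.t x)) (𝓔.adI x ξ)) :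
    ∃ Q : E₁ →L[ℝ] E₁ →L[ℝ] E₁, ∀ u v w, evE α x₁ u = 0 → evE α x₁ v = 0 →
      extLoc α B (𝓔.t x₁) (𝓔.t x₁)
          ![tmap E₁ E₀ 𝓔.t x₁ u, tmap E₁ E₀ 𝓔.t x₁ v, tmap E₁ E₀ 𝓔.t x₁ w] -
        A (chart E₁ x₁ x₁) (extLoc α B (𝓔.s x₁) (𝓔.s x₁)
          ![tmap E₁ E₀ 𝓔.s x₁ u, tmap E₁ E₀ 𝓔.s x₁ v, tmap E₁ E₀ 𝓔.s x₁ w]) +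
        (A (chart E₁ x₁ x₁) (Gam α (𝓔.s x₁) (chart E₀ (𝓔.s x₁) (𝓔.s x₁)) (tmap E₁ E₀ 𝓔.s x₁ w)
            (B.valE (𝓔.s x₁) ![tmap E₁ E₀ 𝓔.s x₁ u, tmap E₁ E₀ 𝓔.s x₁ v])) -
          (fderiv ℝ A (chart E₁ x₁ x₁) w
              (B.valE (𝓔.s x₁) ![tmap E₁ E₀ 𝓔.s x₁ u, tmap E₁ E₀ 𝓔.s x₁ v]) +
            Gam α (𝓔.t x₁) (chart E₀ (𝓔.t x₁) (𝓔.t x₁)) (tmap E₁ E₀ 𝓔.t x₁ w)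
              (A (chart E₁ x₁ x₁)
                (B.valE (𝓔.s x₁) ![tmap E₁ E₀ 𝓔.s x₁ u, tmap E₁ E₀ 𝓔.s x₁ v])))) =
      connCurv (Gam α (𝓔.t x₁)) (chart E₀ (𝓔.t x₁) (𝓔.t x₁)) (tmap E₁ E₀ 𝓔.t x₁ u)
        (tmap E₁ E₀ 𝓔.t x₁ v) (evE α x₁ w) - Q (deltaE B x₁ ![u, v]) (evE α x₁ w) := by
  obtain ⟨Q, hQ⟩ := exists_bianchi hα hB hA hAf
  refine ⟨Q, fun u v w hu hv => ?_⟩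
  have hx := mem_dom_self (F := E₁) x₁
  have hm := mem_dom_self (F := E₀) (𝓔.t x₁)
  have hn := mem_dom_self (F := E₀) (𝓔.s x₁)
  have he := mem_dom_self (F := E₁) (𝓔.e (𝓔.t x₁))
  have hes := mem_dom_self (F := E₁) (𝓔.e (𝓔.s x₁))
  have hT : ContDiffAt ℝ ∞ (mapLoc E₁ E₀ x₁ (𝓔.t x₁) 𝓔.t) (chart E₁ x₁ x₁) :=
    contDiffAt_mapLoc hx hm (𝓔.contMDiff_t x₁)
  have hS : ContDiffAt ℝ ∞ (mapLoc E₁ E₀ x₁ (𝓔.s x₁) 𝓔.s) (chart E₁ x₁ x₁) :=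
    contDiffAt_mapLoc hx hn (𝓔.contMDiff_s x₁)
  have hT0 := mapLoc_chart (F' := E₀) (𝓔.t x₁) 𝓔.t hx
  have hS0 := mapLoc_chart (F' := E₀) (𝓔.s x₁) 𝓔.s hx
  have h1 := hQ u v w hu hv
  have h2 := covExt_sub_endomorphism (Γ := Gam α (𝓔.t x₁)) hT hS
    (by rw [hT0]; exact B.contDiffAt_loc hm he) (by rw [hS0]; exact B.contDiffAt_loc hn hes) hA u v w
  have h3 := connCurv_pullConn (Γ := Gam α (𝓔.t x₁)) hT
    (by rw [hT0]; exact (contDiffAt_Gam α hm he).differentiableAt (by simp)) u v (evE α x₁ w)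
  simp only [fderiv_mapLoc_self (mdiff_t x₁), fderiv_mapLoc_self (mdiff_s x₁), hT0, hS0, loc_self]
    at h2 h3
  have hA1 : DifferentiableAt ℝ A (chart E₁ x₁ x₁) := hA.differentiableAt (by simp)
  -- In the horizontal directions `u` and `v` the derivatives of `A` become `A` applied to the `Γ`
  -- terms of `d^∇ B` at the source. The direction `w` is arbitrary, so its defect stays in the
  -- statement.
  have h4 := fderiv_adI_operator hα hA1 hAf hu (valE_mem B (𝓔.s x₁)
    ![tmap E₁ E₀ 𝓔.s x₁ v, tmap E₁ E₀ 𝓔.s x₁ w])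
  have h5 := fderiv_adI_operator hα hA1 hAf hv (valE_mem B (𝓔.s x₁)
    ![tmap E₁ E₀ 𝓔.s x₁ u, tmap E₁ E₀ 𝓔.s x₁ w])
  rw [h4, h5] at h2
  rw [h3] at h1
  rw [← h1, h2, extLoc_self, extLoc_self, covExt_two_eq_extDeriv_add _ (B.loc (𝓔.s x₁) (𝓔.s x₁)),
    loc_self]
  simp only [map_add, map_sub]
  abel

end LieGroupoidExtension

theorem tmap_of_leftInverse {F N F' N' : Type*}
    [NormedAddCommGroup F] [NormedSpace ℝ F] [TopologicalSpace N] [ChartedSpace F N]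
    [NormedAddCommGroup F'] [NormedSpace ℝ F'] [TopologicalSpace N'] [ChartedSpace F' N']
    {f : N → N'} {g : N' → N} {x : N} (hg : MDifferentiableAt 𝓘(ℝ, F') 𝓘(ℝ, F) g (f x))
    (hf : MDifferentiableAt 𝓘(ℝ, F) 𝓘(ℝ, F') f x) (h : ∀ y, g (f y) = y) (v : F) :
    tmap F' F g (f x) (tmap F F' f x v) = v := by
  have h1 := tmap_comp (F := F) (F' := F') (F'' := F) (g := g) (f := f) hg hf
  have h2 : (fun y => g (f y)) = id := funext h
  rw [h2] at h1
  have h3 : tmap F F (id : N → N) x = ContinuousLinearMap.id ℝ F := mfderiv_id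
  rw [h3] at h1
  exact (congrArg (fun L : F →L[ℝ] F => L v) h1).symm

/-! ### The coboundary of the 3-curvature, and the curvature of the covariant derivative. -/

namespace LieGroupoidExtension

variable {E₀ E₁ E₂ M X Y : Type*}
  [NormedAddCommGroup E₀] [NormedSpace ℝ E₀] [NormedAddCommGroup E₁] [NormedSpace ℝ E₁]
  [NormedAddCommGroup E₂] [NormedSpace ℝ E₂]
  [TopologicalSpace M] [ChartedSpace E₀ M] [TopologicalSpace X] [ChartedSpace E₁ X]
  [TopologicalSpace Y] [ChartedSpace E₂ Y]
  {𝓔 : LieGroupoidExtension E₀ E₁ E₂ M X Y}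
  [IsManifold 𝓘(ℝ, E₀) ∞ M] [IsManifold 𝓘(ℝ, E₁) ∞ X] [IsManifold 𝓘(ℝ, E₂) ∞ Y]
  [FiniteDimensional ℝ E₀] [FiniteDimensional ℝ E₁]
  {α : 𝓔.ArrowForm 1} {B : 𝓔.BaseForm 2} {Ω : 𝓔.BaseForm 3}

/-- In the Bianchi identity the defect in the direction `w` vanishes because `w` is horizontal, and
the right side vanishes because it is linear in `α(w) = 0`. -/
theorem deltaE_three_horizontal (hα : IsRightConnection α) (hB : α.IsCurving B)
    (hΩ : α.IsExtCovDeriv B fun m v => Ω.val m v) {x : X} {u v w : E₁}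
    (hu : evE α x u = 0) (hv : evE α x v = 0) (hw : evE α x w = 0) :
    deltaE Ω x ![u, v, w] = 0 := by
  obtain ⟨A, hA, hAf⟩ := exists_adI_operator (𝓔 := 𝓔) x
  obtain ⟨Q, hQ⟩ := exists_bianchi_curving hα hB hA hAf
  have h1 := hQ u v w hu hv
  have h2 := fderiv_adI_operator hα (hA.differentiableAt (by simp)) hAf hw (valE_mem B (𝓔.s x)
    ![tmap E₁ E₀ 𝓔.s x u, tmap E₁ E₀ 𝓔.s x v])
  rw [h2, sub_self, add_zero, hw, map_zero, sub_zero, ← IsExtCovDeriv.eq_extLoc hα hΩ,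
    ← IsExtCovDeriv.eq_extLoc hα hΩ, operator_self hAf (valE_mem Ω (𝓔.s x) _)] at h1
  have e3 : ∀ L : E₁ →L[ℝ] E₀, (fun i => L (![u, v, w] i)) = ![L u, L v, L w] := fun L => by
    ext i; fin_cases i <;> rfl
  rw [deltaE, e3, e3, h1]
  simp [connCurv]

/-- The 3-curvature is closed for the coboundary. -/
theorem deltaE_three (hα : IsRightConnection α) (hB : α.IsCurving B)
    (hΩ : α.IsExtCovDeriv B fun m v => Ω.val m v) (x : X) (v : Fin 3 → E₁) :
    deltaE Ω x v = 0 := by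
  -- The horizontal part of a vector has the same images under `s_*` and `t_*` as the vector itself,
  -- and `deltaE` sees only these.
  let h : E₁ → E₁ := fun u => u - 𝓔.fundE x (evE α x u)
  have h0 : ∀ u, evE α x (h u) = 0 := fun u => by
    simp only [h, map_sub, evE_fundE hα (evE_mem α x u), sub_self]
  have ht : ∀ u, tmap E₁ E₀ 𝓔.t x (h u) = tmap E₁ E₀ 𝓔.t x u := fun u => by
    simp only [h, map_sub, tmap_t_fundE (evE_mem α x u), sub_zero]
  have hs : ∀ u, tmap E₁ E₀ 𝓔.s x (h u) = tmap E₁ E₀ 𝓔.s x u := fun u => by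
    simp only [h, map_sub, tmap_s_fundE (evE_mem α x u), sub_zero]
  have h1 := deltaE_three_horizontal hα hB hΩ (h0 (v 0)) (h0 (v 1)) (h0 (v 2))
  have h2 : ![h (v 0), h (v 1), h (v 2)] = fun i => h (v i) := by ext i; fin_cases i <;> rfl
  rw [h2] at h1
  rw [← h1]
  simp only [deltaE, ht, hs]

/-- The curvature of the covariant derivative, in terms of the curving. -/
theorem connCurv_Gam (hα : IsRightConnection α) (hB : α.IsCurving B) {m : M}
    {A : E₁ → E₁ →L[ℝ] E₁} (hA : ContDiffAt ℝ ∞ A (chart E₁ (𝓔.e m) (𝓔.e m)))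
    (hAf : ∀ᶠ x in 𝓝 (𝓔.e m), ∀ ξ ∈ 𝓔.K (𝓔.s x),
        A (chart E₁ (𝓔.e m) x) (dchart E₁ (𝓔.e (𝓔.s (𝓔.e m))) (𝓔.e (𝓔.s x)) ξ) =
          dchart E₁ (𝓔.e (𝓔.t (𝓔.e m))) (𝓔.e (𝓔.t x)) (𝓔.adI x ξ))
    (u v : E₀) {ξ : E₁} (hξ : ξ ∈ 𝓔.K m) :
    connCurv (Gam α m) (chart E₀ m m) u v ξ =
      -fderiv ℝ A (chart E₁ (𝓔.e m) (𝓔.e m)) ξ (B.valE m ![u, v]) := by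
  obtain ⟨Q, hQ⟩ := exists_bianchi_curving hα hB hA hAf
  have ht : ∀ u, tmap E₁ E₀ 𝓔.t (𝓔.e m) (tmap E₀ E₁ 𝓔.e m u) = u :=
    tmap_of_leftInverse (mdiff_t _) (mdiff_e m) 𝓔.t_e
  have hs : ∀ u, tmap E₁ E₀ 𝓔.s (𝓔.e m) (tmap E₀ E₁ 𝓔.e m u) = u :=
    tmap_of_leftInverse (mdiff_s _) (mdiff_e m) 𝓔.s_e
  have htξ : tmap E₁ E₀ 𝓔.t (𝓔.e m) ξ = 0 := by
    rw [← fundE_one hξ]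
    exact tmap_t_fundE (by rwa [t_e])
  have hsξ : tmap E₁ E₀ 𝓔.s (𝓔.e m) ξ = 0 := by
    rw [← fundE_one hξ]
    exact tmap_s_fundE (by rwa [t_e])
  -- Bianchi at a unit, with two vectors tangent to the units and one vertical. The vertical vector
  -- projects to zero under `s` and `t`, so the terms with `d^∇ B` vanish and only the derivative of
  -- `A` along `ξ` is left of the defect.
  have h1 := hQ _ _ ξ (evE_one hα m u) (evE_one hα m v)
  -- Along the units source and target agree and `Ad` is trivial, so `∂^▷ B` vanishes there and
  -- removes `Q`.
  have hδ : deltaE B (𝓔.e m) ![tmap E₀ E₁ 𝓔.e m u, tmap E₀ E₁ 𝓔.e m v] = 0 := by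
    have e2 : ∀ (L : E₁ →L[ℝ] E₀) (y z : E₁), (fun i => L (![y, z] i)) = ![L y, L z] :=
      fun L y z => by ext i; fin_cases i <;> rfl
    rw [deltaE, e2, e2, ht, ht, hs, hs, s_e, t_e, adI_one (valE_mem B m _), sub_self]
  rw [hδ, map_zero, zero_apply, sub_zero, ht, ht, hs, hs, htξ, hsξ, s_e, t_e,
    evE_of_mem_K hα hξ] at h1
  rw [← h1]
  have h0 : ∀ (L : E₀ [⋀^Fin 3]→L[ℝ] E₁), L ![u, v, 0] = 0 := fun L => L.map_coord_zero 2 rfl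
  rw [h0]
  simp

end LieGroupoidExtension

/-! ### The Lie bracket as an exterior derivative of the connection. -/

namespace LieGroupoidExtension

variable {E₀ E₁ E₂ M X Y : Type*}
  [NormedAddCommGroup E₀] [NormedSpace ℝ E₀] [NormedAddCommGroup E₁] [NormedSpace ℝ E₁]
  [NormedAddCommGroup E₂] [NormedSpace ℝ E₂]
  [TopologicalSpace M] [ChartedSpace E₀ M] [TopologicalSpace X] [ChartedSpace E₁ X]
  [TopologicalSpace Y] [ChartedSpace E₂ Y]
  {𝓔 : LieGroupoidExtension E₀ E₁ E₂ M X Y}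
  [IsManifold 𝓘(ℝ, E₀) ∞ M] [IsManifold 𝓘(ℝ, E₁) ∞ X] [IsManifold 𝓘(ℝ, E₂) ∞ Y]
  [FiniteDimensional ℝ E₀] [FiniteDimensional ℝ E₁]
  {α : 𝓔.ArrowForm 1}

theorem operator_on_ker {m : M} {A : E₁ → E₁ →L[ℝ] E₁}
    (hAf : ∀ᶠ x in 𝓝 (𝓔.e m), ∀ ξ ∈ 𝓔.K (𝓔.s x),
        A (chart E₁ (𝓔.e m) x) (dchart E₁ (𝓔.e (𝓔.s (𝓔.e m))) (𝓔.e (𝓔.s x)) ξ) =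
          dchart E₁ (𝓔.e (𝓔.t (𝓔.e m))) (𝓔.e (𝓔.t x)) (𝓔.adI x ξ)) :
    ∀ᶠ x in 𝓝 (𝓔.e m), x ∈ 𝓔.ker m → ∀ ξ ∈ 𝓔.K m, A (chart E₁ (𝓔.e m) x) ξ = 𝓔.adI x ξ := by
  filter_upwards [hAf] with x hx hk ξ hξ
  have h := hx ξ (by rwa [s_of_mem_ker hk])
  rwa [s_of_mem_ker hk, t_of_mem_ker hk, s_e, t_e, dchart_self] at h

/-- The derivative of the adjoint representation, in terms of the exterior derivative of a
connection. -/
theorem fderiv_adI_operator_eq_daloc (hα : IsRightConnection α) {m : M} {A : E₁ → E₁ →L[ℝ] E₁}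
    (hA : DifferentiableAt ℝ A (chart E₁ (𝓔.e m) (𝓔.e m)))
    (hAf : ∀ᶠ x in 𝓝 (𝓔.e m), ∀ ξ ∈ 𝓔.K (𝓔.s x),
        A (chart E₁ (𝓔.e m) x) (dchart E₁ (𝓔.e (𝓔.s (𝓔.e m))) (𝓔.e (𝓔.s x)) ξ) =
          dchart E₁ (𝓔.e (𝓔.t (𝓔.e m))) (𝓔.e (𝓔.t x)) (𝓔.adI x ξ))
    {ξ η : E₁} (hξ : ξ ∈ 𝓔.K m) (hη : η ∈ 𝓔.K m) :
    fderiv ℝ A (chart E₁ (𝓔.e m) (𝓔.e m)) ξ η =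
      daloc α (𝓔.e m) m (chart E₁ (𝓔.e m) (𝓔.e m)) ξ η := by
  obtain ⟨k, hk, hk0, hkk, hkv⟩ := exists_ker_curve hξ
  obtain ⟨l, hl, hl0, hlk, hlv⟩ := exists_ker_curve hη
  have hk1 := hk.mdifferentiableAt (by simp)
  have hl1 := hl.mdifferentiableAt (by simp)
  -- Cartan's formula for `l(τ) k(r)`: along `r = 0` the value `α(∂_r f) = ξ` is constant, since
  -- `∂_r f` is a fundamental vector, and along `τ = 0` multiplicativity gives `α(∂_τ f) =
  -- Ad_{k(r)⁻¹} η`.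
  let f : ℝ × ℝ → X := fun p => 𝓔.total.mul (l p.2) (k p.1)
  have t1 : Filter.Tendsto (Prod.fst : ℝ × ℝ → ℝ) (𝓝 (0, 0)) (𝓝 0) := continuous_fst.tendsto' _ _ rfl
  have t2 : Filter.Tendsto (Prod.snd : ℝ × ℝ → ℝ) (𝓝 (0, 0)) (𝓝 0) := continuous_snd.tendsto' _ _ rfl
  have hf : ContMDiffAt 𝓘(ℝ, ℝ × ℝ) 𝓘(ℝ, E₁) ∞ f (0, 0) := by
    refine 𝓔.total.contMDiffAt_mul ?_ ?_ ?_
    · exact ContMDiffAt.comp ((0 : ℝ), (0 : ℝ)) (g := l) (f := Prod.snd) hl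
        (contMDiffAt_iff_contDiffAt.2 contDiffAt_snd)
    · exact ContMDiffAt.comp ((0 : ℝ), (0 : ℝ)) (g := k) (f := Prod.fst) hk
        (contMDiffAt_iff_contDiffAt.2 contDiffAt_fst)
    · filter_upwards [t1.eventually hkk, t2.eventually hlk] with p h1 h2
      exact (t_of_mem_ker h2).trans (s_of_mem_ker h1).symm
  have hkr : ∀ᶠ r in 𝓝 (0 : ℝ), f (r, 0) = k r := by
    filter_upwards [hkk] with r hr
    simp only [f, hl0]
    exact 𝓔.total.one_mul' _ (s_of_mem_ker hr)
  have hlτ : ∀ᶠ τ in 𝓝 (0 : ℝ), f (0, τ) = l τ := by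
    filter_upwards [hlk] with τ hτ
    simp only [f, hk0]
    exact 𝓔.total.mul_one' _ (t_of_mem_ker hτ)
  have h00 : f (0, 0) = 𝓔.e m := hkr.self_of_nhds.trans hk0
  have hft : ∀ᶠ r : ℝ in 𝓝 0, 𝓔.t (f (r, 0)) = 𝓔.t (f (0, 0)) := by
    filter_upwards [hkr, hkk] with r h1 h2
    rw [h1, t_of_mem_ker h2, h00, t_e]
  have hmain := hasDerivAt_evE_family α (x₀ := 𝓔.e m) (m₀ := m) hf
    (by rw [h00]; exact mem_dom_self _) (by rw [h00, t_e]; exact mem_dom_self _) hft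
  have e1 : tmap ℝ E₁ (fun r : ℝ => f (r, 0)) 0 1 = ξ := by rw [tmap_congr hkr, hkv]
  have e2 : tmap ℝ E₁ (fun τ : ℝ => f (0, τ)) 0 1 = η := by rw [tmap_congr hlτ, hlv]
  have e3 : ∀ᶠ τ in 𝓝 (0 : ℝ), dchart E₁ (𝓔.e m) (𝓔.e (𝓔.t (f (0, τ))))
      (evE α (f (0, τ)) (tmap ℝ E₁ (fun r : ℝ => f (r, τ)) 0 1)) = ξ := by
    filter_upwards [hlτ, hlk] with τ h1 h2
    have ht := t_of_mem_ker h2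
    have h3 := 𝓔.tmap_fund hk1 (l τ) (by rw [hk0, ht]) (by rwa [ht]) 1
    rw [hkv] at h3
    have h4 := evE_fundE hα (x := l τ) (ξ := ξ) (by rwa [ht])
    rw [← h3] at h4
    rw [h1, ht, dchart_self]
    exact h4
  have e4 : deriv (fun τ : ℝ => dchart E₁ (𝓔.e m) (𝓔.e (𝓔.t (f (0, τ))))
      (evE α (f (0, τ)) (tmap ℝ E₁ (fun r : ℝ => f (r, τ)) 0 1))) 0 = 0 :=
    ((hasDerivAt_const (0 : ℝ) ξ).congr_of_eventuallyEq e3).deriv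
  rw [e4, e1, e2, h00, t_e, dchart_self, dparam_self, zero_add] at hmain
  have e5 : ∀ᶠ r in 𝓝 (0 : ℝ), A (chart E₁ (𝓔.e m) (k r)) η =
      evE α (f (r, 0)) (tmap ℝ E₁ (fun τ : ℝ => f (r, τ)) 0 1) := by
    have hkA := operator_on_ker hAf
    rw [← hk0] at hkA
    filter_upwards [hkk, hkr, hk.continuousAt.eventually hkA] with r h1 h2 h3
    rw [hk0] at h3
    have h5 : ∀ᶠ τ in 𝓝 (0 : ℝ), 𝓔.t (l τ) = 𝓔.s (k r) := by
      filter_upwards [hlk] with τ hτ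
      exact (t_of_mem_ker hτ).trans (s_of_mem_ker h1).symm
    have h6 := evE_mul hα hl1 (mdifferentiableAt_const (c := k r)) h5 1
    have h7 : tmap ℝ E₁ (fun _ : ℝ => k r) 0 = 0 := mfderiv_const
    rw [h7, zero_apply, map_zero, zero_add, hlv, hl0, evE_of_mem_K hα hη] at h6
    rw [h3 h1 η hη, ← h6, ← hl0]
  have e6 := deriv_chart_comp hk1 (n₀ := 𝓔.e m) (by rw [hk0]; exact mem_dom_self _)
  rw [hk0, dchart_self, hkv] at e6
  have e7 : HasDerivAt (fun r => A (chart E₁ (𝓔.e m) (k r)))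
      (fderiv ℝ A (chart E₁ (𝓔.e m) (𝓔.e m)) ξ) 0 :=
    HasFDerivAt.comp_hasDerivAt (0 : ℝ) (by rw [hk0]; exact hA.hasFDerivAt) e6
  have e8 : HasDerivAt (fun r => A (chart E₁ (𝓔.e m) (k r)) η)
      (fderiv ℝ A (chart E₁ (𝓔.e m) (𝓔.e m)) ξ η) 0 := by
    have := e7.clm_apply (hasDerivAt_const (0 : ℝ) η)
    simpa using this
  exact e8.unique (hmain.congr_of_eventuallyEq e5)

/-- The tangent product at `(e, e)` is linear in the pair, and the product with a constant unit
changes nothing. So differentiating `k k⁻¹ = e` gives `k' + (k⁻¹)' = 0`. -/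
theorem tmap_inv_curve {m : M} {k : ℝ → X} (hk : MDifferentiableAt 𝓘(ℝ, ℝ) 𝓘(ℝ, E₁) k 0)
    (hk0 : k 0 = 𝓔.e m) (hkk : ∀ᶠ r in 𝓝 0, k r ∈ 𝓔.ker m) :
    tmap ℝ E₁ (fun r => 𝓔.total.inv (k r)) 0 1 = -tmap ℝ E₁ k 0 1 := by
  have hi : MDifferentiableAt 𝓘(ℝ, ℝ) 𝓘(ℝ, E₁) (fun r => 𝓔.total.inv (k r)) 0 :=
    MDifferentiableAt.comp (0 : ℝ) (g := 𝓔.total.inv)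
      ((𝓔.total.contMDiff_inv _).mdifferentiableAt (by simp)) hk
  have hi0 : 𝓔.total.inv (k 0) = 𝓔.e m := by rw [hk0]; exact 𝓔.total.inv_one m
  have hc : MDifferentiableAt 𝓘(ℝ, ℝ) 𝓘(ℝ, E₁) (fun _ : ℝ => 𝓔.e m) 0 := mdifferentiableAt_const
  have hc0 : tmap ℝ E₁ (fun _ : ℝ => 𝓔.e m) 0 = 0 := mfderiv_const
  have h1 := 𝓔.tmap_mul hk hi (Filter.Eventually.of_forall fun r => (s_inv _).symm) 1
  have h2 := 𝓔.tmap_mul hk hc (hkk.mono fun r hr => (t_of_mem_ker hr).trans (s_e m).symm) 1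
  have h3 := 𝓔.tmap_mul hc hi
    (hkk.mono fun r hr => (t_e m).trans ((s_inv _).trans (t_of_mem_ker hr)).symm) 1
  have e1 : tmap ℝ E₁ (fun r => 𝓔.total.mul (k r) (𝓔.total.inv (k r))) 0 =
      tmap ℝ E₁ (fun _ : ℝ => 𝓔.e m) 0 := by
    refine tmap_congr ?_
    filter_upwards [hkk] with r hr
    rw [𝓔.total.mul_inv]
    exact congrArg 𝓔.e (s_of_mem_ker hr)
  have e2 : tmap ℝ E₁ (fun r => 𝓔.total.mul (k r) (𝓔.e m)) 0 = tmap ℝ E₁ k 0 :=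
    tmap_congr (hkk.mono fun r hr => 𝓔.total.mul_one' _ (t_of_mem_ker hr))
  have e3 : tmap ℝ E₁ (fun r => 𝓔.total.mul (𝓔.e m) (𝓔.total.inv (k r))) 0 =
      tmap ℝ E₁ (fun r => 𝓔.total.inv (k r)) 0 :=
    tmap_congr (hkk.mono fun r hr => 𝓔.total.one_mul' _ ((s_inv _).trans (t_of_mem_ker hr)))
  rw [e1, hi0, hk0, hc0, zero_apply] at h1
  rw [e2, hk0, hc0, zero_apply] at h2
  rw [e3, hi0, hc0, zero_apply] at h3
  refine eq_neg_of_add_eq_zero_right ?_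
  rw [h1]
  refine (congrArg₂ (· + ·) h2 h3).trans ?_
  simp only [← map_add, Prod.mk_add_mk, add_zero, zero_add]

/-- The bracket of the Lie algebra, on the model space. -/
def bracketE (𝓔 : LieGroupoidExtension E₀ E₁ E₂ M X Y) (m : M) (ξ η : E₁) : E₁ := 𝓔.bracket m ξ η

/-- The adjoint representation, on the model spaces. -/
def adE (𝓔 : LieGroupoidExtension E₀ E₁ E₂ M X Y) (x : X) : E₁ →L[ℝ] E₁ := 𝓔.Ad x

theorem adE_eq_adI (k : X) : 𝓔.adE k = 𝓔.adI (𝓔.total.inv k) :=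
  congrArg 𝓔.adE (𝓔.total.inv_inv k).symm

/-- `Ad` is differentiated only along the kernel; there it agrees with the smooth operator `A` at
the inverse element, which provides the differentiability that the chain rule along `k` requires. -/
theorem bracketE_eq_of_curve {m : M} {η : E₁} (hη : η ∈ 𝓔.K m) {k : ℝ → X}
    (hk : MDifferentiableAt 𝓘(ℝ, ℝ) 𝓘(ℝ, E₁) k 0)
    (hk0 : k 0 = 𝓔.e m) (hkk : ∀ᶠ r in 𝓝 0, k r ∈ 𝓔.ker m) :
    bracketE 𝓔 m (tmap ℝ E₁ k 0 1) η = deriv (fun r => 𝓔.adI (𝓔.total.inv (k r)) η) 0 := by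
  obtain ⟨A, hA, hAf⟩ := exists_adI_operator (𝓔 := 𝓔) (𝓔.e m)
  have hker := operator_on_ker hAf
  have hinv : 𝓔.total.inv (𝓔.e m) = 𝓔.e m := 𝓔.total.inv_one m
  have hg : MDifferentiableAt 𝓘(ℝ, E₁) 𝓘(ℝ, E₁)
      (fun x => A (chart E₁ (𝓔.e m) (𝓔.total.inv x)) η) (𝓔.e m) := by
    have h1 : MDifferentiableAt 𝓘(ℝ, E₁) 𝓘(ℝ, E₁)
        (fun x => chart E₁ (𝓔.e m) (𝓔.total.inv x)) (𝓔.e m) :=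
      MDifferentiableAt.comp (𝓔.e m) (g := chart E₁ (𝓔.e m))
        (by rw [hinv]; exact mdiff_chart (mem_dom_self _))
        ((𝓔.total.contMDiff_inv _).mdifferentiableAt (by simp))
    refine MDifferentiableAt.comp (𝓔.e m) (I' := 𝓘(ℝ, E₁)) (g := fun q => A q η) ?_ h1
    rw [hinv]
    exact mdifferentiableAt_iff_differentiableAt.2
      ((hA.differentiableAt (by simp)).clm_apply (differentiableAt_const η))
  have ti : Filter.Tendsto 𝓔.total.inv (𝓝 (𝓔.e m)) (𝓝 (𝓔.e m)) := by
    have := (𝓔.total.contMDiff_inv (𝓔.e m)).continuousAt.tendsto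
    rwa [hinv] at this
  have heq : ∀ᶠ x in 𝓝 (𝓔.e m), x ∈ 𝓔.ker m →
      𝓔.adE x η = A (chart E₁ (𝓔.e m) (𝓔.total.inv x)) η := by
    filter_upwards [ti.eventually hker] with x hx hxk
    rw [adE_eq_adI, hx (inv_mem_ker hxk) η hη]
  have hg2 : MDifferentiableWithinAt 𝓘(ℝ, E₁) 𝓘(ℝ, E₁) (fun x => 𝓔.adE x η)
      (𝓔.ker m) (𝓔.e m) :=
    (hg.mdifferentiableWithinAt (s := 𝓔.ker m)).congr_of_eventuallyEq
      (eventually_nhdsWithin_iff.2 heq) (heq.self_of_nhds (𝓔.one_mem_ker m))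
  have h3 := tmap_comp_within (F := ℝ) (F' := E₁) (F'' := E₁)
    (g := fun x => 𝓔.adE x η) (f := k) (by rw [hk0]; exact hg2) hk hkk
  rw [hk0] at h3
  have h4 : tmap ℝ E₁ (fun r => 𝓔.adE (k r) η) 0 1 = bracketE 𝓔 m (tmap ℝ E₁ k 0 1) η :=
    congrArg (fun L : ℝ →L[ℝ] E₁ => L 1) h3
  rw [← h4, tmap_eq_fderiv, fderiv_apply_one_eq_deriv]
  simp only [adE_eq_adI]

/-- The bracket, in terms of the exterior derivative of a connection. -/
theorem bracketE_eq_daloc (hα : IsRightConnection α) {m : M} {ξ η : E₁} (hξ : ξ ∈ 𝓔.K m)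
    (hη : η ∈ 𝓔.K m) :
    bracketE 𝓔 m ξ η = -daloc α (𝓔.e m) m (chart E₁ (𝓔.e m) (𝓔.e m)) ξ η := by
  obtain ⟨A, hA, hAf⟩ := exists_adI_operator (𝓔 := 𝓔) (𝓔.e m)
  have hA1 := hA.differentiableAt (by simp)
  obtain ⟨k, hk, hk0, hkk, rfl⟩ := exists_ker_curve hξ
  have hk1 := hk.mdifferentiableAt (by simp)
  have hi0 : 𝓔.total.inv (k 0) = 𝓔.e m := by rw [hk0]; exact 𝓔.total.inv_one m
  have hi : MDifferentiableAt 𝓘(ℝ, ℝ) 𝓘(ℝ, E₁) (fun r => 𝓔.total.inv (k r)) 0 :=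
    MDifferentiableAt.comp (0 : ℝ) (g := 𝓔.total.inv)
      ((𝓔.total.contMDiff_inv _).mdifferentiableAt (by simp)) hk1
  have h1 := deriv_chart_comp hi (n₀ := 𝓔.e m) (by rw [hi0]; exact mem_dom_self _)
  -- The sign of the result arises here: `Ad k` is `adI` of `k⁻¹`, and inversion reverses the
  -- velocity.
  rw [hi0, dchart_self, tmap_inv_curve hk1 hk0 hkk] at h1
  have h2 : HasDerivAt (fun r => A (chart E₁ (𝓔.e m) (𝓔.total.inv (k r))))
      (fderiv ℝ A (chart E₁ (𝓔.e m) (𝓔.e m)) (-tmap ℝ E₁ k 0 1)) 0 :=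
    HasFDerivAt.comp_hasDerivAt (0 : ℝ) (by rw [hi0]; exact hA1.hasFDerivAt) h1
  have h3 := h2.clm_apply (hasDerivAt_const (0 : ℝ) η)
  have hker := operator_on_ker hAf
  rw [← hi0] at hker
  have h4 : ∀ᶠ r in 𝓝 (0 : ℝ), 𝓔.adI (𝓔.total.inv (k r)) η =
      A (chart E₁ (𝓔.e m) (𝓔.total.inv (k r))) η := by
    filter_upwards [hi.continuousAt.eventually hker, hkk] with r h5 h6
    rw [hi0] at h5
    exact (h5 (inv_mem_ker h6) η hη).symm
  rw [bracketE_eq_of_curve hη hk1 hk0 hkk, (h3.congr_of_eventuallyEq h4).deriv,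
    ← fderiv_adI_operator_eq_daloc hα hA1 hAf hξ hη]
  simp

/-- Antisymmetry is hidden in the definition by the derivative of `Ad`, but evident for an exterior
derivative. -/
theorem bracketE_antisymm (hα : IsRightConnection α) {m : M} {ξ η : E₁} (hξ : ξ ∈ 𝓔.K m)
    (hη : η ∈ 𝓔.K m) : bracketE 𝓔 m ξ η = -bracketE 𝓔 m η ξ := by
  rw [bracketE_eq_daloc hα hξ hη, bracketE_eq_daloc hα hη hξ]
  simp only [daloc]
  abel

end LieGroupoidExtension

/-! ### Centrality and the Bianchi identity of the 3-curvature. -/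

namespace LieGroupoidExtension

variable {E₀ E₁ E₂ M X Y : Type*}
  [NormedAddCommGroup E₀] [NormedSpace ℝ E₀] [NormedAddCommGroup E₁] [NormedSpace ℝ E₁]
  [NormedAddCommGroup E₂] [NormedSpace ℝ E₂]
  [TopologicalSpace M] [ChartedSpace E₀ M] [TopologicalSpace X] [ChartedSpace E₁ X]
  [TopologicalSpace Y] [ChartedSpace E₂ Y]
  {𝓔 : LieGroupoidExtension E₀ E₁ E₂ M X Y}
  [IsManifold 𝓘(ℝ, E₀) ∞ M] [IsManifold 𝓘(ℝ, E₁) ∞ X] [IsManifold 𝓘(ℝ, E₂) ∞ Y]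
  [FiniteDimensional ℝ E₀] [FiniteDimensional ℝ E₁]
  {α : 𝓔.ArrowForm 1} {B : 𝓔.BaseForm 2} {Ω : 𝓔.BaseForm 3}

/-- At the points of the kernel, tangent vectors of `M` lift linearly to tangent vectors of `X` over
them, for the source and for the target map. -/
theorem exists_tangent_lift {m : M} {k : X} (hk : k ∈ 𝓔.ker m) :
    ∃ L : E₀ →L[ℝ] E₁, ∀ w, tmap E₁ E₀ 𝓔.s k (L w) = w ∧ tmap E₁ E₀ 𝓔.t k (L w) = w := by
  obtain ⟨L, hL, hφL, hL0⟩ := 𝓔.isSubmersion_φ.exists_section_family k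
  have hk' : 𝓔.φ k = 𝓔.quot.one m := hk
  rw [hk'] at hL hφL
  -- A local section of `φ` through `k`, composed with the units of `Y`. It takes values in the
  -- kernel, so source and target both restrict to the identity along it.
  let g : M → X := fun m => L (𝓔.quot.one m, k)
  have hc : ContMDiffAt 𝓘(ℝ, E₀) (𝓘(ℝ, E₂).prod 𝓘(ℝ, E₁)) ∞ (fun m => (𝓔.quot.one m, k)) m :=
    (𝓔.quot.contMDiff_one m).prodMk contMDiffAt_const
  have hg : ContMDiffAt 𝓘(ℝ, E₀) 𝓘(ℝ, E₁) ∞ g m :=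
    ContMDiffAt.comp m (g := L) (f := fun m => (𝓔.quot.one m, k)) hL hc
  have hg0 : g m = k := by
    have := hL0.self_of_nhds
    rwa [hk'] at this
  have hφ : ∀ᶠ m' in 𝓝 m, 𝓔.φ (g m') = 𝓔.quot.one m' := hc.continuousAt.eventually hφL
  have hg1 := hg.mdifferentiableAt (by simp)
  have hid : tmap E₀ E₀ (id : M → M) m = ContinuousLinearMap.id ℝ E₀ := mfderiv_id
  have hs : tmap E₀ E₀ (fun m => 𝓔.s (g m)) m = tmap E₀ E₀ id m := tmap_congr (by
    filter_upwards [hφ] with m' h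
    exact s_of_mem_ker h)
  have ht : tmap E₀ E₀ (fun m => 𝓔.t (g m)) m = tmap E₀ E₀ id m := tmap_congr (by
    filter_upwards [hφ] with m' h
    exact t_of_mem_ker h)
  rw [tmap_comp (F' := E₁) (g := 𝓔.s) (mdiff_s _) hg1, hid, hg0] at hs
  rw [tmap_comp (F' := E₁) (g := 𝓔.t) (mdiff_t _) hg1, hid, hg0] at ht
  exact ⟨tmap E₀ E₁ g m, fun w => ⟨congrArg (fun L : E₀ →L[ℝ] E₀ => L w) hs,
    congrArg (fun L : E₀ →L[ℝ] E₀ => L w) ht⟩⟩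

/-- A form on `M` which is closed for the coboundary is invariant under the kernel. -/
theorem adI_valE_of_mem_ker {k : ℕ} {η : 𝓔.BaseForm k} (h : ∀ x v, deltaE η x v = 0) {m : M} {x : X}
    (hx : x ∈ 𝓔.ker m) (w : Fin k → E₀) : 𝓔.adI x (η.valE m w) = η.valE m w := by
  obtain ⟨L, hL⟩ := exists_tangent_lift hx
  have h1 := h x fun i => L (w i)
  simp only [deltaE, (hL _).1, (hL _).2] at h1
  rw [s_of_mem_ker hx, t_of_mem_ker hx] at h1
  exact (sub_eq_zero.1 h1).symm

/-- Along a curve in the kernel `Ad` fixes the value of `η`, so the bracket with this value in the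
second slot is the derivative of a constant; antisymmetry moves it to the first slot. -/
theorem bracketE_valE_eq_zero (hα : IsRightConnection α) {k : ℕ} {η : 𝓔.BaseForm k}
    (h : ∀ x v, deltaE η x v = 0) {m : M} (w : Fin k → E₀) {ξ : E₁} (hξ : ξ ∈ 𝓔.K m) :
    bracketE 𝓔 m (η.valE m w) ξ = 0 := by
  rw [bracketE_antisymm hα (valE_mem η m w) hξ, neg_eq_zero]
  obtain ⟨k, hk, hk0, hkk, rfl⟩ := exists_ker_curve hξ
  rw [bracketE_eq_of_curve (valE_mem η m w) (hk.mdifferentiableAt (by simp)) hk0 hkk]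
  refine ((hasDerivAt_const (0 : ℝ) (η.valE m w)).congr_of_eventuallyEq ?_).deriv
  filter_upwards [hkk] with r hr
  exact adI_valE_of_mem_ker h (inv_mem_ker hr) w

/-- The Bianchi identity of the 3-curvature. -/
theorem isExtCovDeriv_three_zero (hα : IsRightConnection α) (hB : α.IsCurving B)
    (hΩ : α.IsExtCovDeriv B fun m v => Ω.val m v) : α.IsExtCovDeriv Ω fun _ _ => 0 := by
  refine isExtCovDeriv_zero hα fun m => ?_
  have hm := mem_dom_self (F := E₀) m
  have he := mem_dom_self (F := E₁) (𝓔.e m)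
  obtain ⟨A, hA, hAf⟩ := exists_adI_operator (𝓔 := 𝓔) (𝓔.e m)
  have h1 := IsExtCovDeriv.loc_eventuallyEq hα hΩ hm he
  have h2 : covExt (Gam α m) (Ω.loc m m) (chart E₀ m m) =
      covExt (Gam α m) (covExt (Gam α m) (B.loc m m)) (chart E₀ m m) := by
    rw [covExt, covExt, h1.fderiv_eq, h1.eq_of_nhds]
  -- The curvature acts on `B` as a bracket of two values of `B`, which changes sign when the pairs
  -- `(a, b)` and `(c, d)` are exchanged. The six terms of `covExt_covExt_two` therefore cancel in
  -- three pairs.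
  have h3 : ∀ a b c d : E₀, connCurv (Gam α m) (chart E₀ m m) a b (B.valE m ![c, d]) =
      -daloc α (𝓔.e m) m (chart E₁ (𝓔.e m) (𝓔.e m)) (B.valE m ![c, d]) (B.valE m ![a, b]) := by
    intro a b c d
    rw [connCurv_Gam hα hB hA hAf a b (valE_mem B m _), fderiv_adI_operator_eq_daloc hα
      (hA.differentiableAt (by simp)) hAf (valE_mem B m _) (valE_mem B m _)]
  rw [h2]
  ext v
  have h4 : v = ![v 0, v 1, v 2, v 3] := by ext i; fin_cases i <;> rfl
  rw [h4, covExt_covExt_two (contDiffAt_Gam α hm he) (B.contDiffAt_loc hm he), loc_self]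
  simp only [h3, daloc]
  change _ = (0 : E₁)
  abel

end LieGroupoidExtension

end

theorem theorem6p24 {E₀ E₁ E₂ M X Y : Type*}
    [NormedAddCommGroup E₀] [NormedSpace ℝ E₀] [FiniteDimensional ℝ E₀]
    [NormedAddCommGroup E₁] [NormedSpace ℝ E₁] [FiniteDimensional ℝ E₁]
    [NormedAddCommGroup E₂] [NormedSpace ℝ E₂] [FiniteDimensional ℝ E₂]
    [TopologicalSpace M] [T2Space M] [ChartedSpace E₀ M] [IsManifold 𝓘(ℝ, E₀) ∞ M]
    [TopologicalSpace X] [T2Space X] [ChartedSpace E₁ X] [IsManifold 𝓘(ℝ, E₁) ∞ X]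
    [TopologicalSpace Y] [T2Space Y] [ChartedSpace E₂ Y] [IsManifold 𝓘(ℝ, E₂) ∞ Y]
    (𝓔 : LieGroupoidExtension E₀ E₁ E₂ M X Y)
    (α : 𝓔.ArrowForm 1) (hα : LieGroupoidExtension.IsRightConnection α)
    (B : 𝓔.BaseForm 2) (hB : α.IsCurving B) :
    (∃! Ω : 𝓔.BaseForm 3, α.IsExtCovDeriv B (fun m v => Ω.val m v)) ∧
    ∀ Ω : 𝓔.BaseForm 3, α.IsExtCovDeriv B (fun m v => Ω.val m v) →
      (∀ m v, Ω.val m v ∈ 𝓔.center m) ∧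
      α.IsExtCovDeriv Ω (fun _ _ => 0) ∧
      ∀ x v, 𝓔.delta Ω x v = 0 := by
  refine ⟨LieGroupoidExtension.existsUnique_isExtCovDeriv hα B, fun Ω hΩ => ?_⟩
  have hδ := LieGroupoidExtension.deltaE_three hα hB hΩ
  exact ⟨fun m v => ⟨Ω.mem m v, fun ξ hξ => LieGroupoidExtension.bracketE_valE_eq_zero hα hδ v hξ⟩,
    LieGroupoidExtension.isExtCovDeriv_three_zero hα hB hΩ, hδ⟩
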